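/- **Setting.** Let $T>0$, $\beta>0$, let $\Omega\subset\mathbb{R}^d$ be open, convex and bounded, and let $\omega\subset\Omega$ be open and nonempty with $\overline\omega\subset\Omega$. Let $f\in C([0,T];C^1(\overline\Omega;\mathbb{R}^d))$, $B\in\mathbb{R}^{d\times M}$, and let $\ell\in C([0,T];C^1(\overline\Omega))$ and $g\in C^1(\overline\Omega)$ be nonnegative. Here $C([0,T];C^n(\overline\Omega))$ carries the norm $\max_t\|v(t,\cdot)\|_{C^n(\overline\Omega)}$. *Open loop problem.* For $t_0\in[0,T]$, $y_0\in\Omega$, a control $u\in L^2((t_0,T);\mathbb{R}^M)$ is admissible if $y'=f(t,y)+Bu$, $y(t_0)=y_0$ has an (absolutely continuous) solution on $[t_0,T]$ with values in $\overline\Omega$ (the set on which $f$ is defined). Its cost is $J(t_0,y_0,u)=\int_{t_0}^T\big(\ell(t,y)+\frac\beta2|u|^2\big)dt+g(y(T))$, and $V(t_0,y_0)=\inf_u J(t_0,y_0,u)$ is the value function; an admissible $u$ attaining the infimum is an optimal control. *Learning problem.* For $v\in C([0,T];C^2(\overline\Omega))$ put $U_v(t,y)=-\frac1\beta B^\top\nabla_yv(t,y)$,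 and let $\Phi(t_0,y_0,v)$ be the (unique) solution $y:[t_0,T]\to\overline\Omega$, if it exists, of $y'=f(t,y)+BU_v(t,y)$, $y(t_0)=y_0$. Let $\mathcal{D}$ be the set of all $v\in C([0,T];C^2(\overline\Omega))$ such that $\Phi(t_0,y_0,v)$ exists for all $(t_0,y_0)\in[0,T]\times\omega$ and the closure of $\{\Phi(t_0,y_0,v)(t): t_0\in(0,T),\,y_0\in\omega,\,t\in[t_0,T)\}$ is contained in $\Omega$; let $\overline{\mathcal{D}}$ be its closure in $C([0,T];C^2(\overline\Omega))$. With $y=\Phi(t_0,y_0,v)$ let $$\mathcal{V}(t_0,y_0,v)=\int_{t_0}^T\Big(\ell(t,y(t))+\frac\beta2|U_v(t,y(t))|^2\Big)dt+g(y(T)),\qquad \mathcal{J}(v)=\frac1{T|\omega|}\int_\omega\int_0^T\mathcal{V}(t_0,y_0,v)\,dt_0\,dy_0 .$$ *Finite dimensional problems.* For $k\in\mathbb{N}$ let $X_k=\mathbb{R}^{N_k}$ and let $\mathcal{I}_k:X_k\to C([0,T];C^2(\overline\Omega))$ be continuous and injective. For $\gamma\ge0$ and $r\in[0,1]$ consider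 $$(P_{k,\gamma,r})\qquad \min_{\theta\in X_k,\ \mathcal{I}_k(\theta)\in\overline{\mathcal{D}}}\ \mathcal{J}(\mathcal{I}_k(\theta))+\gamma\Big(\frac{1-r}2|\theta|_2^2+r|\theta|_1\Big).$$ **Theorem.** Assume that the value function $V$ is finite on $[0,T]\times\Omega$ and (after continuous extension to $[0,T]\times\overline\Omega$) belongs to $\mathcal{D}$, and that there are $\vartheta_k\in X_k$ with $\lim_{k\to\infty}\|\mathcal{I}_k(\vartheta_k)-V\|_{C([0,T];C^1(\overline\Omega))}=0$. Then there is $k_0\in\mathbb{N}$ such that $(P_{k,\gamma,r})$ has a solution for all $k\ge k_0$, $\gamma>0$ and $r\in[0,1]$. Moreover, for every $r\in[0,1]$ there are penalty coefficients $\gamma_k\ge0$, with $\gamma_k>0$ for every $k$ with $\mathcal{I}_k(\vartheta_k)\ne V$, such that for $k\ge k_0$ the problem $(P_{k,\gamma_k,r})$ has a solution, and for every choice of solutions $\theta_k$ of $(P_{k,\gamma_k,r})$, $k\ge k_0$, the following hold. 1. For all $k\ge k_0$ the functions $\mathcal{V}(\cdot,\cdot,\mathcal{I}_k(\theta_k))$,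 $\mathcal{V}(\cdot,\cdot,V)$ and $V$ are integrable on $(0,T)\times\omega$, and $$\int_\omega\int_0^T\big|\mathcal{V}(t_0,y_0,\mathcal{I}_k(\theta_k))-\mathcal{V}(t_0,y_0,V)\big|\,dt_0\,dy_0\le C\,\|\mathcal{I}_k(\vartheta_k)-V\|_{C([0,T];C^1(\overline\Omega))},$$ and the same bound holds with $V(t_0,y_0)$ in place of $\mathcal{V}(t_0,y_0,V)$. The constant $C>0$ depends only on $\|f\|_{C([0,T]\times\Omega)}$, $\|V\|_{C([0,T];C^1(\overline\Omega))}$, $|B|$, $\beta$, $\Omega$ and $T$ (and the dimensions $d,M$). 2. For $(t_0,y_0)\in(0,T)\times\omega$ let $y_k=\Phi(t_0,y_0,\mathcal{I}_k(\theta_k))$ and $u_k(t)=U_{\mathcal{I}_k(\theta_k)}(t,y_k(t))$, $t\in[t_0,T]$. Then $u_k\in L^2((t_0,T);\mathbb{R}^M)$ for $k\ge k_0$. Every subsequence of the indices $k$ has a further subsequence $(k_j)_j$, independent of $(t_0,y_0)$, such that for almost every $(t_0,y_0)\in(0,T)\times\omega$ the sequence $(u_{k_j})_j$ has a weakly convergent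 subsequence in $L^2((t_0,T);\mathbb{R}^M)$, and every weakly convergent subsequence of $(u_{k_j})_j$ converges strongly in $L^2((t_0,T);\mathbb{R}^M)$ to an optimal control of the open loop problem with initial condition $y(t_0)=y_0$. -/

import Mathlib

open Set Filter Topology MeasureTheory

noncomputable section

/-- `ℝⁿ` with the Euclidean norm. -/
abbrev Eucl (n : ℕ) : Type := EuclideanSpace ℝ (Fin n)

section FunctionSpaces

variable {E F : Type*} [NormedAddCommGroup E] [NormedSpace ℝ E]
  [NormedAddCommGroup F] [NormedSpace ℝ F]

/-- Membership in `C([0,T]; Cⁿ(K))` for a compact convex set `K` with nonempty interior: every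
`v(t, ·)` is `n` times continuously differentiable on `K`, and all derivatives in the second
variable up to order `n` depend continuously on `(t, y) ∈ [0,T] × K` (as `K` is compact, this is
the continuity of `t ↦ v(t, ·)` with values in `Cⁿ(K)`).
Only the values of `v` on `[0,T] × K` matter. -/
def MemCTC (T : ℝ) (K : Set E) (n : ℕ) (v : ℝ → E → F) : Prop :=
  (∀ t ∈ Icc 0 T, ContDiffOn ℝ n (v t) K) ∧
    ∀ j ≤ n, ContinuousOn (fun p : ℝ × E => iteratedFDerivWithin ℝ j (v p.1) K p.2)
      (Icc 0 T ×ˢ K)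

/-- The norm of `Cⁿ(K)`: the sum over `j ≤ n` of the suprema over `K` of the `j`-th derivative. -/
def ckNorm (K : Set E) (n : ℕ) (φ : E → F) : ℝ :=
  ∑ j ∈ Finset.range (n + 1), sSup ((fun y => ‖iteratedFDerivWithin ℝ j φ K y‖) '' K)

/-- The norm of `C([0,T]; Cⁿ(K))`: the maximum over `t ∈ [0,T]` of the `Cⁿ(K)` norm. -/
def ctcNorm (T : ℝ) (K : Set E) (n : ℕ) (v : ℝ → E → F) : ℝ :=
  sSup ((fun t => ckNorm K n (v t)) '' Icc 0 T)

end FunctionSpaces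

/-- Weak convergence in `L²((a,b); ℝᴹ)` of a sequence of (representatives of) `L²` functions. -/
def WeakConvL2 {M : ℕ} (a b : ℝ) (u : ℕ → ℝ → Eucl M) (uLim : ℝ → Eucl M) : Prop :=
  MemLp uLim 2 (volume.restrict (Ioo a b)) ∧
    ∀ φ : ℝ → Eucl M, MemLp φ 2 (volume.restrict (Ioo a b)) →
      Tendsto (fun n => ∫ t in Ioo a b, inner ℝ (u n t) (φ t)) atTop
        (𝓝 (∫ t in Ioo a b, inner ℝ (uLim t) (φ t)))

/-- Strong convergence in `L²((a,b); ℝᴹ)`. -/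
def StrongConvL2 {M : ℕ} (a b : ℝ) (u : ℕ → ℝ → Eucl M) (uLim : ℝ → Eucl M) : Prop :=
  MemLp uLim 2 (volume.restrict (Ioo a b)) ∧
    Tendsto (fun n => eLpNorm (u n - uLim) 2 (volume.restrict (Ioo a b))) atTop (𝓝 0)

/-- The data of the finite horizon control problem and of the learning problem, with the standing
regularity assumptions. The matrix `B ∈ ℝ^{d × M}` is given as the linear map `ℝᴹ → ℝᵈ`. -/
structure ControlProblem (d M : ℕ) where
  /-- time horizon -/
  T : ℝ
  /-- control cost weight -/
  β : ℝ
  /-- state domain -/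
  Ω : Set (Eucl d)
  /-- set of initial states used for learning -/
  ω : Set (Eucl d)
  /-- drift -/
  f : ℝ → Eucl d → Eucl d
  /-- control operator -/
  B : Eucl M →L[ℝ] Eucl d
  /-- running cost -/
  ℓ : ℝ → Eucl d → ℝ
  /-- terminal cost -/
  g : Eucl d → ℝ
  T_pos : 0 < T
  β_pos : 0 < β
  isOpen_Ω : IsOpen Ω
  convex_Ω : Convex ℝ Ω
  isBounded_Ω : Bornology.IsBounded Ω
  isOpen_ω : IsOpen ω
  nonempty_ω : ω.Nonempty
  closure_ω_subset : closure ω ⊆ Ω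
  f_mem : MemCTC T (closure Ω) 1 f
  ℓ_mem : MemCTC T (closure Ω) 1 ℓ
  g_mem : ContDiffOn ℝ 1 g (closure Ω)
  ℓ_nonneg : ∀ t ∈ Icc 0 T, ∀ y ∈ closure Ω, 0 ≤ ℓ t y
  g_nonneg : ∀ y ∈ closure Ω, 0 ≤ g y

namespace ControlProblem

variable {d M : ℕ} (P : ControlProblem d M)

/-! ### The open loop problem -/

/-- `(u, y)` is an admissible control-state pair for the initial condition `y(t₀) = y₀`:
`u ∈ L²((t₀,T); ℝᴹ)`, and `y` is a continuous (hence absolutely continuous) solution of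
`y' = f(t,y) + B u` on `[t₀,T]` that stays in the set `closure Ω` on which `f` is defined. -/
structure IsAdmissible (t₀ : ℝ) (y₀ : Eucl d) (u : ℝ → Eucl M) (y : ℝ → Eucl d) : Prop where
  memLp : MemLp u 2 (volume.restrict (Ioo t₀ P.T))
  continuousOn : ContinuousOn y (Icc t₀ P.T)
  mem_closure : ∀ t ∈ Icc t₀ P.T, y t ∈ closure P.Ω
  state_eq : ∀ t ∈ Icc t₀ P.T, y t = y₀ + ∫ s in t₀..t, (P.f s (y s) + P.B (u s))

/-- The cost `∫_{t₀}^T (ℓ(t,y) + β/2 |u|²) dt + g(y(T))` of a control-state pair. -/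
def cost (t₀ : ℝ) (u : ℝ → Eucl M) (y : ℝ → Eucl d) : ℝ :=
  (∫ t in t₀..P.T, (P.ℓ t (y t) + P.β / 2 * ‖u t‖ ^ 2)) + P.g (y P.T)

/-- The value function of the open loop problem (`⊤` if there is no admissible pair). -/
def valueFn (t₀ : ℝ) (y₀ : Eucl d) : EReal :=
  ⨅ (u : ℝ → Eucl M) (y : ℝ → Eucl d) (_ : P.IsAdmissible t₀ y₀ u y), (P.cost t₀ u y : EReal)

/-- `u` is an optimal control of the open loop problem with initial condition `y(t₀) = y₀`. -/
def IsOptimalControl (t₀ : ℝ) (y₀ : Eucl d) (u : ℝ → Eucl M) : Prop :=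
  ∃ y, P.IsAdmissible t₀ y₀ u y ∧
    ∀ u' y', P.IsAdmissible t₀ y₀ u' y' → P.cost t₀ u y ≤ P.cost t₀ u' y'

/-! ### Feedback laws and the learning problem -/

/-- The feedback `U_v(t,y) = -(1/β) Bᵀ ∇_y v(t,y)` on `[0,T] × closure Ω`. -/
def feedback (v : ℝ → Eucl d → ℝ) (t : ℝ) (y : Eucl d) : Eucl M :=
  -((1 / P.β) • ContinuousLinearMap.adjoint P.B (gradientWithin (v t) (closure P.Ω) y))

/-- The closed loop vector field `F_v(t,y) = f(t,y) + B U_v(t,y)`. -/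
def closedLoopField (v : ℝ → Eucl d → ℝ) (t : ℝ) (y : Eucl d) : Eucl d :=
  P.f t y + P.B (P.feedback v t y)

/-- `y` solves the closed loop problem `y' = F_v(t,y)` on `[t₀,T]`, `y(t₀) = y₀`; it has to stay in
the set `closure Ω` on which `F_v` is defined. -/
structure IsClosedLoop (v : ℝ → Eucl d → ℝ) (t₀ : ℝ) (y₀ : Eucl d) (y : ℝ → Eucl d) : Prop where
  init : y t₀ = y₀
  mem_closure : ∀ t ∈ Icc t₀ P.T, y t ∈ closure P.Ω
  hasDeriv : ∀ t ∈ Icc t₀ P.T,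
    HasDerivWithinAt y (P.closedLoopField v t (y t)) (Icc t₀ P.T) t

/-- The solution `Φ(t₀,y₀,v)` of the closed loop problem on `[t₀,T]`. For `v ∈ C([0,T]; C²)` the
field `F_v` is Lipschitz in `y ∈ closure Ω`, so the solution is unique on `[t₀,T]` if it exists. -/
def flow (v : ℝ → Eucl d → ℝ) (t₀ : ℝ) (y₀ : Eucl d) : ℝ → Eucl d :=
  Classical.epsilon fun y => P.IsClosedLoop v t₀ y₀ y

/-- The set `R(v)` of states reached by closed loop trajectories that start in `(0,T) × ω`. -/
def reach (v : ℝ → Eucl d → ℝ) : Set (Eucl d) :=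
  {x | ∃ t₀ ∈ Ioo 0 P.T, ∃ y₀ ∈ P.ω, ∃ t ∈ Ico t₀ P.T, x = P.flow v t₀ y₀ t}

/-- The set `D` of functions `v ∈ C([0,T]; C²(closure Ω))` whose closed loop problem is solvable for
all `(t₀,y₀) ∈ [0,T] × ω`, with the closure of the reached states contained in `Ω`. -/
def setD : Set (ℝ → Eucl d → ℝ) :=
  {v | MemCTC P.T (closure P.Ω) 2 v ∧
    (∀ t₀ ∈ Icc 0 P.T, ∀ y₀ ∈ P.ω, ∃ y, P.IsClosedLoop v t₀ y₀ y) ∧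
    closure (P.reach v) ⊆ P.Ω}

/-- The closure of `D` in the norm of `C([0,T]; C²(closure Ω))`. -/
def closureD : Set (ℝ → Eucl d → ℝ) :=
  {v | MemCTC P.T (closure P.Ω) 2 v ∧
    ∀ ε > 0, ∃ w ∈ P.setD, ctcNorm P.T (closure P.Ω) 2 (v - w) < ε}

/-- The closed loop control `t ↦ U_v(t, Φ(t₀,y₀,v)(t))`. -/
def closedLoopControl (v : ℝ → Eucl d → ℝ) (t₀ : ℝ) (y₀ : Eucl d) (t : ℝ) : Eucl M :=
  P.feedback v t (P.flow v t₀ y₀ t)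

/-- The closed loop cost `𝒱(t₀,y₀,v)`. -/
def closedLoopCost (v : ℝ → Eucl d → ℝ) (t₀ : ℝ) (y₀ : Eucl d) : ℝ :=
  P.cost t₀ (P.closedLoopControl v t₀ y₀) (P.flow v t₀ y₀)

/-- The learning functional: the mean of `𝒱(t₀,y₀,v)` over `(0,T) × ω`. -/
def learnCost (v : ℝ → Eucl d → ℝ) : ℝ :=
  (P.T * (volume P.ω).toReal)⁻¹ * ∫ y₀ in P.ω, ∫ t₀ in (0)..P.T, P.closedLoopCost v t₀ y₀

/-! ### The finite dimensional learning problem -/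

/-- The penalty `(1-r)/2 |θ|₂² + r |θ|₁`. -/
def penalty {N : ℕ} (r : ℝ) (θ : Fin N → ℝ) : ℝ :=
  (1 - r) / 2 * ∑ i, θ i ^ 2 + r * ∑ i, |θ i|

/-- `θ` minimizes `𝒥(I(θ)) + γ ((1-r)/2 |θ|₂² + r |θ|₁)` over all `θ ∈ ℝᴺ` with `I(θ)` in the
closure of `D`. -/
def IsSolution {N : ℕ} (I : (Fin N → ℝ) → ℝ → Eucl d → ℝ) (γ r : ℝ) (θ : Fin N → ℝ) : Prop :=
  I θ ∈ P.closureD ∧ ∀ θ', I θ' ∈ P.closureD →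
    P.learnCost (I θ) + γ * penalty r θ ≤ P.learnCost (I θ') + γ * penalty r θ'

/-- The approximation hypothesis: the maps `I k : ℝ^{N k} → C([0,T]; C²(closure Ω))` are continuous
and injective, and `I k (ϑ k) → V` in `C([0,T]; C¹(closure Ω))`. -/
structure Approximates (V : ℝ → Eucl d → ℝ) (N : ℕ → ℕ)
    (I : (k : ℕ) → (Fin (N k) → ℝ) → ℝ → Eucl d → ℝ) (ϑ : (k : ℕ) → Fin (N k) → ℝ) : Prop where
  mem : ∀ k θ, MemCTC P.T (closure P.Ω) 2 (I k θ)
  continuous : ∀ k θ,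
    Tendsto (fun θ' => ctcNorm P.T (closure P.Ω) 2 (I k θ' - I k θ)) (𝓝 θ) (𝓝 0)
  injective : ∀ k θ θ', (∀ t ∈ Icc 0 P.T, ∀ y ∈ closure P.Ω, I k θ t y = I k θ' t y) → θ = θ'
  tendsto : Tendsto (fun k => ctcNorm P.T (closure P.Ω) 1 (I k (ϑ k) - V)) atTop (𝓝 0)

/-- The norm `‖f‖_{C([0,T] × Ω)}`. -/
def fNorm : ℝ :=
  sSup ((fun p : ℝ × Eucl d => ‖P.f p.1 p.2‖) '' (Icc 0 P.T ×ˢ P.Ω))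

end ControlProblem

end

/-!
The proof rests on a verification argument for the value function `V`, which is only assumed to be
`C²` in the state and continuous in time.

*Verification.* By dynamic programming with almost optimal controls, the forward difference
quotients of `V` in time satisfy one half of the Hamilton-Jacobi-Bellman equation
(`IsValue.eventually_mul_le_sub`). Integrating this along the closed loop trajectories of some
`v ∈ D` gives `𝒱(t₀,y₀,v) ≤ V(t₀,y₀) + ∫ β/2 |U_v - U_V|²` (`IsValue.verification`,
`IsValue.extCost_le`), and `V ≤ 𝒱(·,·,v)` holds for every `v` whose closed loop problem is solvable,
as the closed loop pair is admissible. Hence `𝒱(·,·,V) = V`, and since the costs are never below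
`V`, the `L¹` distance between `𝒱(·,·,v)` and `V` is the difference `𝒥(v) - 𝒥(V)` up to a factor
(`IsValue.setIntegral_abs_sub_eq`). For `v = I k (ϑ k)` this difference is quadratic in the `C¹`
distance to `V`; so a minimizer of the penalized problem inherits a linear bound as soon as the
penalty of `ϑ k` is at most that distance.

*Closed loop trajectories.* To avoid continuation arguments, the closed loop field is extended from
`[0,T] × closure Ω` to the whole space by nearest point projections. The extended field is bounded
and Lipschitz in the state, so all its trajectories exist on `[t₀,T]`, and by Grönwall's inequality
they depend continuously on the initial values and on `v` in the norm of `C([0,T]; C¹)`. It follows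
that `D` is open in this norm (`exists_forall_mem_setD`), that the closed loop problem remains
solvable on the closure of `D` (`solvable_of_mem_closureD`), and that the learning functional is
continuous there, which together with the coercive penalty gives minimizers (`exists_isSolution`).

*Controls.* Convergence of the costs in `L¹` gives convergence for almost every initial value along
a subsequence. For such an initial value the controls are bounded in `L²`, and weak convergence of
controls implies pointwise convergence of the states (`exists_isAdmissible_of_weakConvL2`). As the
costs converge to the minimal value, the norms of the controls converge to the norm of the weak
limit, so the convergence is strong and the limit is optimal (`IsValue.strongConvL2_of_tendsto`).
-/

noncomputable section

/-! ### The norms of `C([0,T]; Cⁿ(K))` -/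

section FunctionSpaceFacts

variable {E F : Type*} [NormedAddCommGroup E] [NormedSpace ℝ E]
  [NormedAddCommGroup F] [NormedSpace ℝ F] {T : ℝ} {K : Set E} {n m : ℕ} {v w : ℝ → E → F}

theorem MemCTC.of_le (h : MemCTC T K n v) (hm : m ≤ n) : MemCTC T K m v :=
  ⟨fun t ht => (h.1 t ht).of_le (by exact_mod_cast hm), fun j hj => h.2 j (hj.trans hm)⟩

theorem MemCTC.continuousOn (h : MemCTC T K n v) :
    ContinuousOn (fun p : ℝ × E => v p.1 p.2) (Icc 0 T ×ˢ K) := by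
  have h0 := h.2 0 (Nat.zero_le _)
  have := (continuousMultilinearCurryFin0 ℝ E F).continuous.comp_continuousOn h0
  refine this.congr fun p _ => ?_
  simp

theorem MemCTC.continuousOn_fderivWithin (hK : UniqueDiffOn ℝ K) (h : MemCTC T K n v)
    (hn : 1 ≤ n) :
    ContinuousOn (fun p : ℝ × E => fderivWithin ℝ (v p.1) K p.2) (Icc 0 T ×ˢ K) := by
  have h1 := h.2 1 hn
  have := (continuousMultilinearCurryFin1 ℝ E F).continuous.comp_continuousOn h1
  refine this.congr fun p hp => ?_
  ext x
  simp [iteratedFDerivWithin_one_apply (hK p.2 hp.2)]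

theorem norm_iteratedFDerivWithin_one_eq {φ : E → F} (hK : UniqueDiffOn ℝ K) {y : E}
    (hy : y ∈ K) : ‖iteratedFDerivWithin ℝ 1 φ K y‖ = ‖fderivWithin ℝ φ K y‖ := by
  rw [← zero_add 1, ← norm_iteratedFDerivWithin_fderivWithin hK hy, norm_iteratedFDerivWithin_zero]

theorem MemCTC.sub (hK : UniqueDiffOn ℝ K) (hv : MemCTC T K n v) (hw : MemCTC T K n w) :
    MemCTC T K n (v - w) := by
  refine ⟨fun t ht => (hv.1 t ht).sub (hw.1 t ht), fun j hj => ?_⟩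
  refine ((hv.2 j hj).sub (hw.2 j hj)).congr fun p hp => ?_
  have hj' : ((j : ℕ) : WithTop ℕ∞) ≤ n := by exact_mod_cast hj
  exact iteratedFDerivWithin_sub_apply (((hv.1 p.1 hp.1).of_le hj') p.2 hp.2)
    (((hw.1 p.1 hp.1).of_le hj') p.2 hp.2) hK hp.2

theorem MemCTC.exists_bound (hK : IsCompact K) (h : MemCTC T K n v) {j : ℕ} (hj : j ≤ n) :
    ∃ C, 0 ≤ C ∧ ∀ t ∈ Icc 0 T, ∀ y ∈ K, ‖iteratedFDerivWithin ℝ j (v t) K y‖ ≤ C := by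
  obtain ⟨C, hC⟩ := (isCompact_Icc.prod hK).exists_bound_of_continuousOn (h.2 j hj)
  exact ⟨max C 0, le_max_right _ _, fun t ht y hy => (hC (t, y) ⟨ht, hy⟩).trans (le_max_left _ _)⟩

theorem ckNorm_nonneg (φ : E → F) : 0 ≤ ckNorm K n φ :=
  Finset.sum_nonneg fun _ _ => Real.sSup_nonneg <| by rintro _ ⟨y, _, rfl⟩; positivity

theorem ctcNorm_nonneg : 0 ≤ ctcNorm T K n v :=
  Real.sSup_nonneg <| by rintro _ ⟨y, _, rfl⟩; exact ckNorm_nonneg _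

theorem MemCTC.bddAbove_iteratedFDerivWithin (hK : IsCompact K) (h : MemCTC T K n v) {j : ℕ}
    (hj : j ≤ n) {t : ℝ} (ht : t ∈ Icc 0 T) :
    BddAbove ((fun y => ‖iteratedFDerivWithin ℝ j (v t) K y‖) '' K) := by
  obtain ⟨C, -, hC⟩ := h.exists_bound hK hj
  exact ⟨C, by rintro _ ⟨y, hy, rfl⟩; exact hC t ht y hy⟩

theorem MemCTC.norm_iteratedFDerivWithin_le_ckNorm (hK : IsCompact K) (h : MemCTC T K n v) {j : ℕ}
    (hj : j ≤ n) {t : ℝ} (ht : t ∈ Icc 0 T) {y : E} (hy : y ∈ K) :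
    ‖iteratedFDerivWithin ℝ j (v t) K y‖ ≤ ckNorm K n (v t) := by
  refine (le_csSup (h.bddAbove_iteratedFDerivWithin hK hj ht) ⟨y, hy, rfl⟩).trans ?_
  exact Finset.single_le_sum
    (f := fun j => sSup ((fun y => ‖iteratedFDerivWithin ℝ j (v t) K y‖) '' K))
    (fun _ _ => Real.sSup_nonneg <| by rintro _ ⟨y, _, rfl⟩; positivity)
    (Finset.mem_range.2 (Nat.lt_succ_of_le hj))

theorem MemCTC.bddAbove_ckNorm (hK : IsCompact K) (h : MemCTC T K n v) :
    BddAbove ((fun t => ckNorm K n (v t)) '' Icc 0 T) := by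
  have : ∀ j, ∃ C, 0 ≤ C ∧ (j ≤ n → ∀ t ∈ Icc 0 T, ∀ y ∈ K,
      ‖iteratedFDerivWithin ℝ j (v t) K y‖ ≤ C) := fun j => by
    by_cases hj : j ≤ n
    · obtain ⟨C, h0, hC⟩ := h.exists_bound hK hj
      exact ⟨C, h0, fun _ => hC⟩
    · exact ⟨0, le_rfl, fun h => absurd h hj⟩
  choose C h0 hC using this
  refine ⟨∑ j ∈ Finset.range (n + 1), C j, ?_⟩
  rintro _ ⟨t, ht, rfl⟩
  refine Finset.sum_le_sum fun j hj => Real.sSup_le ?_ (h0 j)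
  rintro _ ⟨y, hy, rfl⟩
  exact hC j (Nat.lt_succ_iff.1 (Finset.mem_range.1 hj)) t ht y hy

theorem MemCTC.ckNorm_le_ctcNorm (hK : IsCompact K) (h : MemCTC T K n v) {t : ℝ}
    (ht : t ∈ Icc 0 T) : ckNorm K n (v t) ≤ ctcNorm T K n v :=
  le_csSup (h.bddAbove_ckNorm hK) ⟨t, ht, rfl⟩

theorem MemCTC.norm_iteratedFDerivWithin_le_ctcNorm (hK : IsCompact K) (h : MemCTC T K n v) {j : ℕ}
    (hj : j ≤ n) {t : ℝ} (ht : t ∈ Icc 0 T) {y : E} (hy : y ∈ K) :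
    ‖iteratedFDerivWithin ℝ j (v t) K y‖ ≤ ctcNorm T K n v :=
  (h.norm_iteratedFDerivWithin_le_ckNorm hK hj ht hy).trans (h.ckNorm_le_ctcNorm hK ht)

theorem MemCTC.norm_le_ctcNorm (hK : IsCompact K) (h : MemCTC T K n v) {t : ℝ} (ht : t ∈ Icc 0 T)
    {y : E} (hy : y ∈ K) : ‖v t y‖ ≤ ctcNorm T K n v := by
  simpa using h.norm_iteratedFDerivWithin_le_ctcNorm hK (Nat.zero_le _) ht hy

theorem MemCTC.norm_fderivWithin_le_ctcNorm (hK : IsCompact K) (hu : UniqueDiffOn ℝ K)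
    (h : MemCTC T K n v) (hn : 1 ≤ n) {t : ℝ} (ht : t ∈ Icc 0 T) {y : E} (hy : y ∈ K) :
    ‖fderivWithin ℝ (v t) K y‖ ≤ ctcNorm T K n v := by
  rw [← norm_iteratedFDerivWithin_one_eq hu hy]
  exact h.norm_iteratedFDerivWithin_le_ctcNorm hK hn ht hy

theorem MemCTC.ctcNorm_mono (hK : IsCompact K) (h : MemCTC T K n v) (hm : m ≤ n) :
    ctcNorm T K m v ≤ ctcNorm T K n v := by
  refine Real.sSup_le ?_ ctcNorm_nonneg
  rintro _ ⟨t, ht, rfl⟩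
  refine le_trans ?_ (h.ckNorm_le_ctcNorm hK ht)
  exact Finset.sum_le_sum_of_subset_of_nonneg (Finset.range_subset_range.2 (by omega))
    fun _ _ _ => Real.sSup_nonneg <| by rintro _ ⟨y, _, rfl⟩; positivity

/-- The triangle inequality for `ctcNorm`. -/
theorem ctcNorm_sub_le (hK : IsCompact K) (hu : UniqueDiffOn ℝ K) {z : ℝ → E → F}
    (hv : MemCTC T K n v) (hw : MemCTC T K n w) (hz : MemCTC T K n z) :
    ctcNorm T K n (v - z) ≤ ctcNorm T K n (v - w) + ctcNorm T K n (w - z) := by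
  have hvw := hv.sub hu hw
  have hwz := hw.sub hu hz
  refine Real.sSup_le ?_ (add_nonneg ctcNorm_nonneg ctcNorm_nonneg)
  rintro _ ⟨t, ht, rfl⟩
  refine le_trans ?_ (add_le_add (hvw.ckNorm_le_ctcNorm hK ht) (hwz.ckNorm_le_ctcNorm hK ht))
  unfold ckNorm
  rw [← Finset.sum_add_distrib]
  refine Finset.sum_le_sum fun j hj => ?_
  have hj : j ≤ n := Nat.lt_succ_iff.1 (Finset.mem_range.1 hj)
  have hj' : ((j : ℕ) : WithTop ℕ∞) ≤ n := by exact_mod_cast hj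
  refine Real.sSup_le ?_ (add_nonneg (Real.sSup_nonneg ?_) (Real.sSup_nonneg ?_))
  · rintro _ ⟨y, hy, rfl⟩
    have e : (v - z) t = (v - w) t + (w - z) t := by ext; simp
    dsimp only
    rw [e, iteratedFDerivWithin_add_apply (((hvw.1 t ht).of_le hj') y hy)
      (((hwz.1 t ht).of_le hj') y hy) hu hy]
    exact (norm_add_le _ _).trans (add_le_add
      (le_csSup (hvw.bddAbove_iteratedFDerivWithin hK hj ht) ⟨y, hy, rfl⟩)
      (le_csSup (hwz.bddAbove_iteratedFDerivWithin hK hj ht) ⟨y, hy, rfl⟩))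
  all_goals rintro _ ⟨y, hy, rfl⟩; positivity

theorem ctcNorm_sub_comm (hK : IsCompact K) (hu : UniqueDiffOn ℝ K)
    (hv : MemCTC T K n v) (hw : MemCTC T K n w) :
    ctcNorm T K n (v - w) = ctcNorm T K n (w - v) := by
  have key : ∀ {v w : ℝ → E → F}, MemCTC T K n v → MemCTC T K n w →
      ctcNorm T K n (v - w) ≤ ctcNorm T K n (w - v) := by
    intro v w hv hw
    have h := hw.sub hu hv
    refine Real.sSup_le ?_ ctcNorm_nonneg
    rintro _ ⟨t, ht, rfl⟩
    refine le_trans (Finset.sum_le_sum fun j hj => ?_) (h.ckNorm_le_ctcNorm hK ht)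
    have hj : j ≤ n := Nat.lt_succ_iff.1 (Finset.mem_range.1 hj)
    refine Real.sSup_le ?_ (Real.sSup_nonneg <| by rintro _ ⟨y, _, rfl⟩; positivity)
    rintro _ ⟨y, hy, rfl⟩
    have e : (v - w) t = - (w - v) t := by ext; simp
    dsimp only
    rw [e, iteratedFDerivWithin_neg_apply hu hy, norm_neg]
    exact le_csSup (h.bddAbove_iteratedFDerivWithin hK hj ht) ⟨y, hy, rfl⟩
  exact le_antisymm (key hv hw) (key hw hv)

theorem ctcNorm_sub_self (v : ℝ → E → F) : ctcNorm T K n (v - v) = 0 := by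
  refine le_antisymm (Real.sSup_le ?_ le_rfl) ctcNorm_nonneg
  rintro _ ⟨t, ht, rfl⟩
  refine Finset.sum_nonpos fun j _ => Real.sSup_le ?_ le_rfl
  rintro _ ⟨y, hy, rfl⟩
  simp

theorem MemCTC.exists_lipschitzOnWith (hK : IsCompact K) (hu : UniqueDiffOn ℝ K)
    (hc : Convex ℝ K) (h : MemCTC T K 1 v) :
    ∃ C : NNReal, ∀ t ∈ Icc 0 T, LipschitzOnWith C (v t) K := by
  obtain ⟨C, h0, hC⟩ := h.exists_bound hK le_rfl
  refine ⟨C.toNNReal, fun t ht => hc.lipschitzOnWith_of_nnnorm_fderivWithin_le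
    ((h.1 t ht).differentiableOn (by simp)) fun y hy => ?_⟩
  rw [← NNReal.coe_le_coe, coe_nnnorm, Real.coe_toNNReal _ h0,
    ← norm_iteratedFDerivWithin_one_eq hu hy]
  exact hC t ht y hy

theorem MemCTC.exists_lipschitzOnWith_fderivWithin (hK : IsCompact K) (hu : UniqueDiffOn ℝ K)
    (hc : Convex ℝ K) (h : MemCTC T K 2 v) :
    ∃ C : NNReal, ∀ t ∈ Icc 0 T, LipschitzOnWith C (fderivWithin ℝ (v t) K) K := by
  obtain ⟨C, h0, hC⟩ := h.exists_bound hK le_rfl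
  refine ⟨C.toNNReal, fun t ht => hc.lipschitzOnWith_of_nnnorm_fderivWithin_le
    (((h.1 t ht).fderivWithin hu (m := 1) (by norm_num)).differentiableOn (by simp)) fun y hy => ?_⟩
  rw [← NNReal.coe_le_coe, coe_nnnorm, Real.coe_toNNReal _ h0,
    ← norm_iteratedFDerivWithin_one_eq hu hy,
    norm_iteratedFDerivWithin_fderivWithin hu hy]
  exact hC t ht y hy

end FunctionSpaceFacts

/-! ### Gradients of functions in `C([0,T]; Cⁿ(K))` -/

section GradientFacts

variable {E : Type*} [NormedAddCommGroup E] [InnerProductSpace ℝ E] [CompleteSpace E]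
  {T : ℝ} {K : Set E} {n : ℕ} {v w : ℝ → E → ℝ}

theorem MemCTC.continuousOn_gradientWithin (hu : UniqueDiffOn ℝ K) (h : MemCTC T K n v)
    (hn : 1 ≤ n) :
    ContinuousOn (fun p : ℝ × E => gradientWithin (v p.1) K p.2) (Icc 0 T ×ˢ K) :=
  (InnerProductSpace.toDual ℝ E).symm.continuous.comp_continuousOn
    (h.continuousOn_fderivWithin hu hn)

theorem norm_gradientWithin_sub_le (hK : IsCompact K) (hu : UniqueDiffOn ℝ K)
    (hv : MemCTC T K 1 v) (hw : MemCTC T K 1 w) {t : ℝ} (ht : t ∈ Icc 0 T) {y : E} (hy : y ∈ K) :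
    ‖gradientWithin (v t) K y - gradientWithin (w t) K y‖ ≤ ctcNorm T K 1 (v - w) := by
  have hd : ∀ {u : ℝ → E → ℝ}, MemCTC T K 1 u → DifferentiableWithinAt ℝ (u t) K y := fun hu =>
    (hu.1 t ht).differentiableOn (by simp) y hy
  unfold gradientWithin
  rw [← map_sub, LinearIsometryEquiv.norm_map]
  have : fderivWithin ℝ ((v - w) t) K y = fderivWithin ℝ (v t) K y - fderivWithin ℝ (w t) K y :=
    fderivWithin_sub (hu y hy) (hd hv) (hd hw)
  rw [← this]
  exact (hv.sub hu hw).norm_fderivWithin_le_ctcNorm hK hu le_rfl ht hy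

theorem MemCTC.exists_lipschitzOnWith_gradientWithin (hK : IsCompact K) (hu : UniqueDiffOn ℝ K)
    (hc : Convex ℝ K) (h : MemCTC T K 2 v) :
    ∃ C : NNReal, ∀ t ∈ Icc 0 T, LipschitzOnWith C (gradientWithin (v t) K) K := by
  obtain ⟨C, hC⟩ := h.exists_lipschitzOnWith_fderivWithin hK hu hc
  refine ⟨C, fun t ht => ?_⟩
  have := ((InnerProductSpace.toDual ℝ E).symm.lipschitz.lipschitzOnWith
    (s := univ)).comp (hC t ht) (mapsTo_univ _ _)
  rw [one_mul] at this
  exact this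

/-- First order expansion of `v(t, ·)` on `K` with quadratic remainder, uniform in `t`. -/
theorem MemCTC.exists_abs_sub_le_sq (hK : IsCompact K) (hu : UniqueDiffOn ℝ K)
    (hc : Convex ℝ K) (h : MemCTC T K 2 v) :
    ∃ C, 0 ≤ C ∧ ∀ t ∈ Icc 0 T, ∀ x ∈ K, ∀ y ∈ K,
      |v t y - v t x - inner ℝ (gradientWithin (v t) K x) (y - x)| ≤ C * ‖y - x‖ ^ 2 := by
  obtain ⟨C, hC⟩ := h.exists_lipschitzOnWith_fderivWithin hK hu hc
  refine ⟨C, C.2, fun t ht x hx y hy => ?_⟩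
  have hseg : segment ℝ x y ⊆ K := hc.segment_subset hx hy
  have key := Convex.norm_image_sub_le_of_norm_hasFDerivWithin_le' (𝕜 := ℝ) (f := v t)
    (f' := fderivWithin ℝ (v t) K) (φ := fderivWithin ℝ (v t) K x) (s := segment ℝ x y)
    (C := C * ‖y - x‖) (x := x) (y := y)
    (fun z hz => (((h.1 t ht).differentiableOn (by simp) z (hseg hz)).hasFDerivWithinAt).mono hseg)
    (fun z hz => by
      refine ((hC t ht).norm_sub_le (hseg hz) hx).trans ?_
      gcongr
      rw [segment_eq_image'] at hz
      obtain ⟨s, hs, rfl⟩ := hz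
      simp only [add_sub_cancel_left, norm_smul, Real.norm_eq_abs, abs_of_nonneg hs.1]
      exact mul_le_of_le_one_left (norm_nonneg _) hs.2)
    (convex_segment x y) (left_mem_segment ℝ x y) (right_mem_segment ℝ x y)
  have e : inner ℝ (gradientWithin (v t) K x) (y - x) = fderivWithin ℝ (v t) K x (y - x) := by
    simp [gradientWithin]
  rw [e, ← Real.norm_eq_abs]
  exact key.trans_eq (by ring)

end GradientFacts

/-! ### The nearest point projection onto a compact convex set -/

section Projection

variable {E : Type*} [NormedAddCommGroup E] [InnerProductSpace ℝ E]

/-- The nearest point of a set `K`, when there is one. It is used for nonempty compact convex `K`,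
where it is unique. -/
def nearestPoint (K : Set E) (x : E) : E :=
  Classical.epsilon fun y => y ∈ K ∧ ‖x - y‖ = ⨅ w : K, ‖x - w‖

variable {K : Set E}

theorem nearestPoint_spec (hne : K.Nonempty) (hK : IsCompact K) (hc : Convex ℝ K) (x : E) :
    nearestPoint K x ∈ K ∧ ∀ w ∈ K, inner ℝ (x - nearestPoint K x) (w - nearestPoint K x) ≤ 0 := by
  have h : nearestPoint K x ∈ K ∧ ‖x - nearestPoint K x‖ = ⨅ w : K, ‖x - w‖ :=
    Classical.epsilon_spec (p := fun y => y ∈ K ∧ ‖x - y‖ = ⨅ w : K, ‖x - w‖)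
      (exists_norm_eq_iInf_of_complete_convex hne hK.isComplete hc x)
  exact ⟨h.1, (norm_eq_iInf_iff_real_inner_le_zero hc h.1).1 h.2⟩

theorem nearestPoint_eq_self (hK : IsCompact K) (hc : Convex ℝ K) {x : E} (hx : x ∈ K) :
    nearestPoint K x = x := by
  have h := (nearestPoint_spec ⟨x, hx⟩ hK hc x).2 x hx
  have : ‖x - nearestPoint K x‖ ^ 2 ≤ 0 := by rwa [← real_inner_self_eq_norm_sq]
  have : ‖x - nearestPoint K x‖ = 0 := by
    nlinarith [norm_nonneg (x - nearestPoint K x)]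
  exact (sub_eq_zero.1 (norm_eq_zero.1 this)).symm

theorem lipschitzWith_nearestPoint (hne : K.Nonempty) (hK : IsCompact K) (hc : Convex ℝ K) :
    LipschitzWith 1 (nearestPoint K) := by
  refine LipschitzWith.of_dist_le_mul fun x y => ?_
  obtain ⟨hx, hx'⟩ := nearestPoint_spec hne hK hc x
  obtain ⟨hy, hy'⟩ := nearestPoint_spec hne hK hc y
  have h1 := hx' _ hy
  have h2 := hy' _ hx
  set p := nearestPoint K x
  set q := nearestPoint K y
  rw [dist_eq_norm, dist_eq_norm, NNReal.coe_one, one_mul]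
  have key : ‖p - q‖ ^ 2 ≤ inner ℝ (x - y) (p - q) := by
    have e : inner ℝ (x - y) (p - q) - ‖p - q‖ ^ 2
        = -inner ℝ (x - p) (q - p) - inner ℝ (y - q) (p - q) := by
      rw [← real_inner_self_eq_norm_sq, ← inner_sub_left, ← neg_sub p q, inner_neg_right, neg_neg,
        ← inner_sub_left]
      congr 1; abel
    linarith
  have h3 := key.trans (real_inner_le_norm _ _)
  by_contra hlt
  push Not at hlt
  nlinarith [norm_nonneg (x - y), norm_nonneg (p - q)]

end Projection

/-! ### Ordinary differential equations with globally Lipschitz fields -/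

section ODE

variable {E : Type*} [NormedAddCommGroup E] [NormedSpace ℝ E]

/-- Global solvability of an ODE with a bounded, globally Lipschitz field. -/
theorem exists_hasDerivWithinAt_of_bounded_lipschitz [CompleteSpace E] {F : ℝ → E → E}
    (hF : Continuous fun p : ℝ × E => F p.1 p.2) {L : NNReal} (hL : ∀ t x, ‖F t x‖ ≤ L)
    {K : NNReal} (hK : ∀ t, LipschitzWith K (F t)) {a b : ℝ} (hab : a ≤ b) (x₀ : E) :
    ∃ z : ℝ → E, z a = x₀ ∧ ∀ t ∈ Icc a b, HasDerivWithinAt z (F t (z t)) (Icc a b) t := by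
  have hpl : IsPicardLindelof F (tmin := a) (tmax := b) ⟨a, left_mem_Icc.2 hab⟩ x₀
      (L * (b - a).toNNReal) 0 L K :=
    { lipschitzOnWith := fun t _ => (hK t).lipschitzOnWith
      continuousOn := fun x _ =>
        (hF.comp (Continuous.prodMk continuous_id continuous_const)).continuousOn
      norm_le := fun t _ x _ => hL t x
      mul_max_le := by simp [hab] }
  exact hpl.exists_eq_forall_mem_Icc_hasDerivWithinAt₀

theorem gronwallBound_le {δ ε x C : ℝ} {K : NNReal} (hδ : 0 ≤ δ) (hε : 0 ≤ ε) (hK : 1 ≤ K)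
    (hx : x ≤ C) : gronwallBound δ K ε x ≤ (δ + ε) * Real.exp (K * C) := by
  have hK' : (1 : ℝ) ≤ K := by exact_mod_cast hK
  rw [gronwallBound_of_K_ne_0 (by positivity)]
  have h1 : Real.exp (K * x) ≤ Real.exp (K * C) := by gcongr
  have h2 : ε / K ≤ ε := div_le_self hε hK'
  have h3 := Real.exp_pos (K * x)
  calc δ * Real.exp (K * x) + ε / K * (Real.exp (K * x) - 1)
      ≤ δ * Real.exp (K * x) + ε / K * Real.exp (K * x) := by
        have : 0 ≤ ε / K := by positivity
        nlinarith
    _ ≤ δ * Real.exp (K * C) + ε * Real.exp (K * C) := by gcongr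
    _ = _ := by ring

/-- Solutions of two ODEs whose fields differ by at most `ε` stay close. -/
theorem norm_sub_le_of_hasDerivWithinAt {F G : ℝ → E → E} {K : NNReal} (hK1 : 1 ≤ K)
    (hK : ∀ t, LipschitzWith K (F t)) {ε : ℝ} (hε : 0 ≤ ε)
    (hFG : ∀ t x, ‖G t x - F t x‖ ≤ ε)
    {a b C : ℝ} (hC : b - a ≤ C) {y z : ℝ → E}
    (hy : ∀ t ∈ Icc a b, HasDerivWithinAt y (F t (y t)) (Icc a b) t)
    (hz : ∀ t ∈ Icc a b, HasDerivWithinAt z (G t (z t)) (Icc a b) t) :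
    ∀ t ∈ Icc a b, ‖y t - z t‖ ≤ (‖y a - z a‖ + ε) * Real.exp (K * C) := by
  intro t ht
  have conv : ∀ {w : ℝ → E} {w' : ℝ → E}, (∀ t ∈ Icc a b, HasDerivWithinAt w (w' t) (Icc a b) t) →
      ∀ t ∈ Ico a b, HasDerivWithinAt w (w' t) (Ici t) t := fun h t ht =>
    (h t ⟨ht.1, ht.2.le⟩).mono_of_mem_nhdsWithin (Icc_mem_nhdsGE_of_mem ht)
  have key := dist_le_of_approx_trajectories_ODE (v := F) (K := K) (f := y) (g := z)
    (f' := fun t => F t (y t)) (g' := fun t => G t (z t)) (a := a) (b := b) (εf := 0) (εg := ε)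
    (δ := ‖y a - z a‖) hK (fun t ht => (hy t ht).continuousWithinAt) (conv hy)
    (fun t _ => by simp) (fun t ht => (hz t ht).continuousWithinAt) (conv hz)
    (fun t _ => by rw [dist_eq_norm]; exact hFG t _) (by rw [dist_eq_norm]) t ht
  rw [dist_eq_norm, zero_add] at key
  exact key.trans (gronwallBound_le (norm_nonneg _) hε hK1 (by linarith [ht.2]))

end ODE

namespace ControlProblem

variable {d M : ℕ} (P : ControlProblem d M)

/-! ### The state domain -/

theorem isCompact_closure_Ω : IsCompact (closure P.Ω) := P.isBounded_Ω.isCompact_closure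

theorem convex_closure_Ω : Convex ℝ (closure P.Ω) := P.convex_Ω.closure

theorem ω_subset_Ω : P.ω ⊆ P.Ω := subset_closure.trans P.closure_ω_subset

theorem nonempty_Ω : P.Ω.Nonempty := P.nonempty_ω.mono P.ω_subset_Ω

theorem nonempty_closure_Ω : (closure P.Ω).Nonempty := P.nonempty_Ω.closure

theorem uniqueDiffOn_closure_Ω : UniqueDiffOn ℝ (closure P.Ω) :=
  uniqueDiffOn_convex P.convex_closure_Ω
    (P.nonempty_Ω.mono (interior_maximal subset_closure P.isOpen_Ω))

/-! ### Extension from `[0,T] × closure Ω` to the whole space -/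

/-- The nearest point of `[0,T]`. -/
def clip (t : ℝ) : ℝ := max 0 (min P.T t)

/-- The nearest point of `closure Ω`. -/
def proj (x : Eucl d) : Eucl d := nearestPoint (closure P.Ω) x

/-- The extension of a function on `[0,T] × closure Ω` to `ℝ × ℝᵈ` that is constant along the fibres
of the nearest point projections. It preserves boundedness, continuity, and the Lipschitz constant
in the second variable. -/
def extend {G : Type*} (h : ℝ → Eucl d → G) (t : ℝ) (x : Eucl d) : G := h (P.clip t) (P.proj x)

theorem clip_mem (t : ℝ) : P.clip t ∈ Icc 0 P.T :=
  ⟨le_max_left _ _, max_le P.T_pos.le (min_le_left _ _)⟩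

theorem clip_eq {t : ℝ} (ht : t ∈ Icc 0 P.T) : P.clip t = t := by
  simp [clip, ht.1, ht.2]

theorem continuous_clip : Continuous P.clip := by unfold clip; fun_prop

theorem abs_clip_sub_clip_le (s t : ℝ) : |P.clip s - P.clip t| ≤ |s - t| := by
  unfold clip
  refine (abs_max_sub_max_le_max _ _ _ _).trans (max_le (by simp) ?_)
  exact (abs_min_sub_min_le_max _ _ _ _).trans (max_le (by simp) le_rfl)

theorem proj_mem (x : Eucl d) : P.proj x ∈ closure P.Ω :=
  (nearestPoint_spec P.nonempty_closure_Ω P.isCompact_closure_Ω P.convex_closure_Ω x).1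

theorem proj_eq {x : Eucl d} (hx : x ∈ closure P.Ω) : P.proj x = x :=
  nearestPoint_eq_self P.isCompact_closure_Ω P.convex_closure_Ω hx

theorem lipschitzWith_proj : LipschitzWith 1 P.proj :=
  lipschitzWith_nearestPoint P.nonempty_closure_Ω P.isCompact_closure_Ω P.convex_closure_Ω

theorem continuous_proj : Continuous P.proj := P.lipschitzWith_proj.continuous

theorem extend_eq {G : Type*} (h : ℝ → Eucl d → G) {t : ℝ} (ht : t ∈ Icc 0 P.T) {x : Eucl d}
    (hx : x ∈ closure P.Ω) : P.extend h t x = h t x := by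
  rw [extend, P.clip_eq ht, P.proj_eq hx]

section

variable {G : Type*} [NormedAddCommGroup G] {h : ℝ → Eucl d → G}

theorem continuous_extend
    (hh : ContinuousOn (fun p : ℝ × Eucl d => h p.1 p.2) (Icc 0 P.T ×ˢ closure P.Ω)) :
    Continuous fun p : ℝ × Eucl d => P.extend h p.1 p.2 :=
  hh.comp_continuous (f := fun p : ℝ × Eucl d => (P.clip p.1, P.proj p.2))
    ((P.continuous_clip.comp continuous_fst).prodMk (P.continuous_proj.comp continuous_snd))
    fun _ => ⟨P.clip_mem _, P.proj_mem _⟩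

theorem exists_bound
    (hh : ContinuousOn (fun p : ℝ × Eucl d => h p.1 p.2) (Icc 0 P.T ×ˢ closure P.Ω)) :
    ∃ L : NNReal, ∀ t ∈ Icc 0 P.T, ∀ x ∈ closure P.Ω, ‖h t x‖ ≤ L := by
  obtain ⟨C, hC⟩ := (isCompact_Icc.prod P.isCompact_closure_Ω).exists_bound_of_continuousOn hh
  refine ⟨C.toNNReal, fun t ht x hx => ?_⟩
  exact (hC (t, x) ⟨ht, hx⟩).trans (Real.le_coe_toNNReal C)

theorem lipschitzWith_extend {C : NNReal}
    (hh : ∀ t ∈ Icc 0 P.T, LipschitzOnWith C (h t) (closure P.Ω)) (t : ℝ) :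
    LipschitzWith C (P.extend h t) := by
  have := (hh _ (P.clip_mem t)).comp (P.lipschitzWith_proj.lipschitzOnWith (s := univ))
    (fun x _ => P.proj_mem x)
  rw [mul_one, lipschitzOnWith_univ] at this
  exact this

end

/-! ### The closed loop field -/

variable {P} {v w : ℝ → Eucl d → ℝ}

theorem continuousOn_feedback (hv : MemCTC P.T (closure P.Ω) 1 v) :
    ContinuousOn (fun p : ℝ × Eucl d => P.feedback v p.1 p.2) (Icc 0 P.T ×ˢ closure P.Ω) :=
  (((ContinuousLinearMap.adjoint P.B).continuous.comp_continuousOn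
    (hv.continuousOn_gradientWithin P.uniqueDiffOn_closure_Ω le_rfl)).const_smul (1 / P.β)).neg

theorem continuousOn_closedLoopField (hv : MemCTC P.T (closure P.Ω) 1 v) :
    ContinuousOn (fun p : ℝ × Eucl d => P.closedLoopField v p.1 p.2)
      (Icc 0 P.T ×ˢ closure P.Ω) :=
  P.f_mem.continuousOn.add (P.B.continuous.comp_continuousOn (continuousOn_feedback hv))

theorem norm_feedback_sub_le (hv : MemCTC P.T (closure P.Ω) 1 v)
    (hw : MemCTC P.T (closure P.Ω) 1 w) {t : ℝ} (ht : t ∈ Icc 0 P.T) {y : Eucl d}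
    (hy : y ∈ closure P.Ω) :
    ‖P.feedback v t y - P.feedback w t y‖
      ≤ ‖P.B‖ / P.β * ctcNorm P.T (closure P.Ω) 1 (v - w) := by
  have e : P.feedback v t y - P.feedback w t y = -((1 / P.β) • ContinuousLinearMap.adjoint P.B
      (gradientWithin (v t) (closure P.Ω) y - gradientWithin (w t) (closure P.Ω) y)) := by
    simp only [feedback, map_sub, smul_sub]; abel
  rw [e, norm_neg, norm_smul, Real.norm_eq_abs, abs_of_pos (one_div_pos.2 P.β_pos),
    div_mul_eq_mul_div, one_mul, div_mul_eq_mul_div]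
  refine div_le_div_of_nonneg_right ?_ P.β_pos.le
  refine (ContinuousLinearMap.le_opNorm _ _).trans ?_
  rw [LinearIsometryEquiv.norm_map]
  gcongr
  exact norm_gradientWithin_sub_le P.isCompact_closure_Ω P.uniqueDiffOn_closure_Ω hv hw ht hy

theorem norm_closedLoopField_sub_le (hv : MemCTC P.T (closure P.Ω) 1 v)
    (hw : MemCTC P.T (closure P.Ω) 1 w) {t : ℝ} (ht : t ∈ Icc 0 P.T) {y : Eucl d}
    (hy : y ∈ closure P.Ω) :
    ‖P.closedLoopField v t y - P.closedLoopField w t y‖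
      ≤ ‖P.B‖ * (‖P.B‖ / P.β * ctcNorm P.T (closure P.Ω) 1 (v - w)) := by
  rw [closedLoopField, closedLoopField, add_sub_add_left_eq_sub, ← map_sub]
  refine (ContinuousLinearMap.le_opNorm _ _).trans ?_
  gcongr
  exact norm_feedback_sub_le hv hw ht hy

theorem exists_lipschitzOnWith_f :
    ∃ C : NNReal, ∀ t ∈ Icc 0 P.T, LipschitzOnWith C (P.f t) (closure P.Ω) :=
  P.f_mem.exists_lipschitzOnWith P.isCompact_closure_Ω P.uniqueDiffOn_closure_Ω P.convex_closure_Ω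

theorem exists_lipschitzOnWith_closedLoopField (hv : MemCTC P.T (closure P.Ω) 2 v) :
    ∃ C : NNReal, 1 ≤ C ∧
      ∀ t ∈ Icc 0 P.T, LipschitzOnWith C (P.closedLoopField v t) (closure P.Ω) := by
  obtain ⟨C₁, h₁⟩ := P.exists_lipschitzOnWith_f
  obtain ⟨C₂, h₂⟩ := hv.exists_lipschitzOnWith_gradientWithin P.isCompact_closure_Ω
    P.uniqueDiffOn_closure_Ω P.convex_closure_Ω
  set A : Eucl d →L[ℝ] Eucl d := -((1 / P.β) • P.B.comp (ContinuousLinearMap.adjoint P.B))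
  refine ⟨(C₁ + ‖A‖₊ * C₂) + 1, le_add_self, fun t ht => ?_⟩
  have e : P.closedLoopField v t
      = fun y => P.f t y + A (gradientWithin (v t) (closure P.Ω) y) := by
    ext1 y; simp [closedLoopField, feedback, A]
  rw [e]
  exact ((h₁ t ht).add ((A.lipschitz.lipschitzOnWith (s := univ)).comp (h₂ t ht)
    (mapsTo_univ _ _))).weaken le_self_add

/-! ### Closed loop trajectories -/

variable (P) in
/-- `z` solves the ODE with the extended closed loop field on `[a, T]`. Unlike the closed loop
problem itself, this one is solvable for all initial values. -/
def IsExtTraj (v : ℝ → Eucl d → ℝ) (a : ℝ) (z : ℝ → Eucl d) : Prop :=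
  ∀ t ∈ Icc a P.T, HasDerivWithinAt z (P.extend (P.closedLoopField v) t (z t)) (Icc a P.T) t

theorem exists_isExtTraj (hv : MemCTC P.T (closure P.Ω) 2 v) {a : ℝ} (ha : a ≤ P.T)
    (x : Eucl d) : ∃ z, z a = x ∧ P.IsExtTraj v a z := by
  have hc := continuousOn_closedLoopField (hv.of_le one_le_two)
  obtain ⟨L, hL⟩ := P.exists_bound hc
  obtain ⟨C, -, hC⟩ := exists_lipschitzOnWith_closedLoopField hv
  exact exists_hasDerivWithinAt_of_bounded_lipschitz (P.continuous_extend hc)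
    (fun t x => hL _ (P.clip_mem t) _ (P.proj_mem x)) (P.lipschitzWith_extend hC) ha x

theorem IsClosedLoop.isExtTraj {t₀ : ℝ} (ht₀ : 0 ≤ t₀) {y₀ : Eucl d} {y : ℝ → Eucl d}
    (h : P.IsClosedLoop v t₀ y₀ y) : P.IsExtTraj v t₀ y := fun t ht => by
  rw [P.extend_eq _ ⟨ht₀.trans ht.1, ht.2⟩ (h.mem_closure t ht)]
  exact h.hasDeriv t ht

theorem IsExtTraj.isClosedLoop {t₀ : ℝ} (ht₀ : 0 ≤ t₀) {y : ℝ → Eucl d}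
    (h : P.IsExtTraj v t₀ y) (hy : ∀ t ∈ Icc t₀ P.T, y t ∈ closure P.Ω) :
    P.IsClosedLoop v t₀ (y t₀) y where
  init := rfl
  mem_closure := hy
  hasDeriv t ht := by
    have := h t ht
    rwa [P.extend_eq _ ⟨ht₀.trans ht.1, ht.2⟩ (hy t ht)] at this

theorem IsExtTraj.mono {a b : ℝ} {z : ℝ → Eucl d} (h : P.IsExtTraj v a z) (hab : a ≤ b) :
    P.IsExtTraj v b z := fun t ht =>
  (h t ⟨hab.trans ht.1, ht.2⟩).mono (Icc_subset_Icc_left hab)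

variable (P) in
/-- The trajectory of the extended closed loop field through `p = (t₀, y₀)`, frozen before `t₀` and
after `T`. -/
def extTraj (v : ℝ → Eucl d → ℝ) (p : ℝ × Eucl d) (t : ℝ) : Eucl d :=
  Classical.epsilon (fun z => z (P.clip p.1) = p.2 ∧ P.IsExtTraj v (P.clip p.1) z)
    (max (P.clip p.1) (P.clip t))

theorem extTraj_spec (hv : MemCTC P.T (closure P.Ω) 2 v) (p : ℝ × Eucl d) :
    P.extTraj v p (P.clip p.1) = p.2 ∧ P.IsExtTraj v (P.clip p.1) (P.extTraj v p) := by
  have h := Classical.epsilon_spec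
    (p := fun z => z (P.clip p.1) = p.2 ∧ P.IsExtTraj v (P.clip p.1) z)
    (exists_isExtTraj hv (P.clip_mem p.1).2 p.2)
  have e : ∀ t ∈ Icc (P.clip p.1) P.T, P.extTraj v p t
      = Classical.epsilon (fun z => z (P.clip p.1) = p.2 ∧ P.IsExtTraj v (P.clip p.1) z) t :=
    fun t ht => by
      rw [extTraj, P.clip_eq ⟨(P.clip_mem p.1).1.trans ht.1, ht.2⟩, max_eq_right ht.1]
  refine ⟨by rw [e _ (left_mem_Icc.2 (P.clip_mem p.1).2)]; exact h.1, fun t ht => ?_⟩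
  rw [e t ht]
  exact (h.2 t ht).congr e (e t ht)

theorem extTraj_eq_max (v : ℝ → Eucl d → ℝ) (p : ℝ × Eucl d) (t : ℝ) :
    P.extTraj v p t = P.extTraj v p (max (P.clip p.1) (P.clip t)) := by
  have h : max (P.clip p.1) (P.clip t) ∈ Icc 0 P.T :=
    ⟨(P.clip_mem t).1.trans (le_max_right _ _), max_le (P.clip_mem _).2 (P.clip_mem _).2⟩
  unfold extTraj
  rw [P.clip_eq h, max_eq_right (le_max_left _ _)]

theorem IsExtTraj.norm_sub_le {L : NNReal}
    (hL : ∀ t ∈ Icc 0 P.T, ∀ x ∈ closure P.Ω, ‖P.closedLoopField v t x‖ ≤ L) {a : ℝ}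
    {z : ℝ → Eucl d} (hz : P.IsExtTraj v a z) {s t : ℝ} (hs : s ∈ Icc a P.T)
    (ht : t ∈ Icc a P.T) : ‖z t - z s‖ ≤ L * |t - s| :=
  (convex_Icc a P.T).norm_image_sub_le_of_norm_hasDerivWithin_le hz
    (fun t _ => hL _ (P.clip_mem t) _ (P.proj_mem _)) hs ht

/-- Trajectories are jointly Lipschitz in the initial time, the initial state and the time. -/
theorem exists_norm_extTraj_sub_le (hv : MemCTC P.T (closure P.Ω) 2 v) :
    ∃ L : ℝ, 0 ≤ L ∧ ∀ p q s t, ‖P.extTraj v p s - P.extTraj v q t‖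
      ≤ L * (|s - t| + (|p.1 - q.1| + ‖p.2 - q.2‖)) := by
  obtain ⟨L, hL⟩ := P.exists_bound (continuousOn_closedLoopField (hv.of_le one_le_two))
  obtain ⟨C, hC1, hC⟩ := exists_lipschitzOnWith_closedLoopField hv
  set A := Real.exp (C * P.T)
  have hA : 1 ≤ A := Real.one_le_exp (mul_nonneg C.2 P.T_pos.le)
  have h1 : ∀ p s t, ‖P.extTraj v p s - P.extTraj v p t‖ ≤ L * |s - t| := fun p s t => by
    rw [extTraj_eq_max v p s, extTraj_eq_max v p t]
    have hm : ∀ r, max (P.clip p.1) (P.clip r) ∈ Icc (P.clip p.1) P.T := fun r =>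
      ⟨le_max_left _ _, max_le (P.clip_mem _).2 (P.clip_mem _).2⟩
    refine ((extTraj_spec hv p).2.norm_sub_le hL (hm t) (hm s)).trans ?_
    refine mul_le_mul_of_nonneg_left ?_ L.2
    refine (abs_max_sub_max_le_max _ _ _ _).trans (max_le (by simp) ?_)
    exact P.abs_clip_sub_clip_le _ _
  have h2 : ∀ p q t, P.clip p.1 ≤ P.clip q.1 →
      ‖P.extTraj v p t - P.extTraj v q t‖ ≤ (L * |p.1 - q.1| + ‖p.2 - q.2‖) * A := by
    intro p q t hpq
    have hp := extTraj_spec hv p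
    have hq := extTraj_spec hv q
    -- all trajectories are frozen before their initial times
    have e : ∀ s ≤ P.clip q.1, ‖P.extTraj v p s - q.2‖ ≤ L * |p.1 - q.1| + ‖p.2 - q.2‖ := by
      intro s hs
      have hs' : P.clip s ≤ P.clip q.1 :=
        max_le (P.clip_mem _).1 ((min_le_right _ _).trans hs)
      have h3 : ‖P.extTraj v p s - p.2‖ ≤ L * |p.1 - q.1| := by
        rw [extTraj_eq_max]
        conv_lhs => rw [← hp.1]
        refine (hp.2.norm_sub_le hL (left_mem_Icc.2 (P.clip_mem _).2)
          ⟨le_max_left _ _, max_le (P.clip_mem _).2 (P.clip_mem _).2⟩).trans ?_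
        refine mul_le_mul_of_nonneg_left ?_ L.2
        refine le_trans ?_ (P.abs_clip_sub_clip_le p.1 q.1)
        rw [abs_of_nonneg (sub_nonneg.2 (le_max_left _ _)), abs_sub_comm,
          abs_of_nonneg (sub_nonneg.2 hpq)]
        exact sub_le_sub_right (max_le hpq hs') _
      calc _ = ‖(P.extTraj v p s - p.2) + (p.2 - q.2)‖ := by congr 1; abel
        _ ≤ _ := (norm_add_le _ _).trans (by gcongr)
    have hnn : 0 ≤ L * |p.1 - q.1| + ‖p.2 - q.2‖ := by positivity
    rcases le_total (P.clip t) (P.clip q.1) with h | h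
    · have : P.extTraj v q t = q.2 := by
        rw [extTraj_eq_max, max_eq_left h, hq.1]
      rw [this, extTraj_eq_max]
      exact (e _ (max_le hpq h)).trans (le_mul_of_one_le_right hnn hA)
    · rw [extTraj_eq_max v q, extTraj_eq_max v p, max_eq_right h, max_eq_right (hpq.trans h)]
      have := norm_sub_le_of_hasDerivWithinAt hC1 (P.lipschitzWith_extend hC) le_rfl
        (fun t x => by simp) (C := P.T) (by linarith [(P.clip_mem q.1).1]) (hp.2.mono hpq) hq.2
        (P.clip t) ⟨h, (P.clip_mem t).2⟩
      rw [add_zero, hq.1] at this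
      exact this.trans (by gcongr; exact e _ le_rfl)
  refine ⟨(L + 1) * A, by positivity, fun p q s t => ?_⟩
  have h3 : ‖P.extTraj v p t - P.extTraj v q t‖ ≤ (L * |p.1 - q.1| + ‖p.2 - q.2‖) * A := by
    rcases le_total (P.clip p.1) (P.clip q.1) with h | h
    · exact h2 p q t h
    · rw [norm_sub_rev, abs_sub_comm, norm_sub_rev p.2]
      exact h2 q p t h
  have h4 : (L : ℝ) * |s - t| ≤ (L + 1) * A * |s - t| := by
    gcongr
    have := L.2
    change (0 : ℝ) ≤ L at this
    nlinarith
  have h5 : (L * |p.1 - q.1| + ‖p.2 - q.2‖) * A ≤ (L + 1) * A * (|p.1 - q.1| + ‖p.2 - q.2‖) := by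
    have : (L : ℝ) * |p.1 - q.1| + ‖p.2 - q.2‖ ≤ (L + 1) * (|p.1 - q.1| + ‖p.2 - q.2‖) := by
      have := mul_nonneg L.2 (norm_nonneg (p.2 - q.2))
      change (0 : ℝ) ≤ L * _ at this
      nlinarith [abs_nonneg (p.1 - q.1)]
    nlinarith
  calc _ = ‖(P.extTraj v p s - P.extTraj v p t) + (P.extTraj v p t - P.extTraj v q t)‖ := by
        congr 1; abel
    _ ≤ _ := (norm_add_le _ _).trans (by linarith [h1 p s t])

theorem continuous_extTraj (hv : MemCTC P.T (closure P.Ω) 2 v) :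
    Continuous fun q : (ℝ × Eucl d) × ℝ => P.extTraj v q.1 q.2 := by
  obtain ⟨L, hL0, hL⟩ := exists_norm_extTraj_sub_le hv
  refine continuous_iff_continuousAt.2 fun q => ?_
  refine tendsto_iff_norm_sub_tendsto_zero.2 ?_
  refine squeeze_zero (fun _ => norm_nonneg _) (fun r => hL r.1 q.1 r.2 q.2) ?_
  have : Continuous fun r : (ℝ × Eucl d) × ℝ =>
      L * (|r.2 - q.2| + (|r.1.1 - q.1.1| + ‖r.1.2 - q.1.2‖)) := by fun_prop
  simpa using this.tendsto q

/-- By Grönwall's inequality the trajectories of `w` are close to those of `v`, uniformly in the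
initial values; only the `C¹` distance enters, as the control is a gradient. -/
theorem exists_norm_extTraj_sub_le_ctcNorm (hv : MemCTC P.T (closure P.Ω) 2 v) :
    ∃ A : ℝ, 0 ≤ A ∧ ∀ w, MemCTC P.T (closure P.Ω) 2 w → ∀ p t,
      ‖P.extTraj v p t - P.extTraj w p t‖ ≤ A * ctcNorm P.T (closure P.Ω) 1 (w - v) := by
  obtain ⟨C, hC1, hC⟩ := exists_lipschitzOnWith_closedLoopField hv
  have hβ := P.β_pos
  refine ⟨‖P.B‖ * (‖P.B‖ / P.β) * Real.exp (C * P.T), by positivity, fun w hw p t => ?_⟩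
  rw [extTraj_eq_max v, extTraj_eq_max w]
  have hvs := extTraj_spec hv p
  have hws := extTraj_spec hw p
  have := norm_sub_le_of_hasDerivWithinAt (F := P.extend (P.closedLoopField v))
    (G := P.extend (P.closedLoopField w)) hC1 (P.lipschitzWith_extend hC)
    (ε := ‖P.B‖ * (‖P.B‖ / P.β * ctcNorm P.T (closure P.Ω) 1 (w - v)))
    (by have := ctcNorm_nonneg (T := P.T) (K := closure P.Ω) (n := 1) (v := w - v); positivity)
    (fun t x => norm_closedLoopField_sub_le (hw.of_le one_le_two) (hv.of_le one_le_two)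
      (P.clip_mem t) (P.proj_mem x)) (C := P.T) (by linarith [(P.clip_mem p.1).1]) hvs.2 hws.2
    (max (P.clip p.1) (P.clip t)) ⟨le_max_left _ _, max_le (P.clip_mem _).2 (P.clip_mem _).2⟩
  rw [hvs.1, hws.1, sub_self, norm_zero, zero_add] at this
  exact this.trans_eq (by ring)

theorem IsClosedLoop.eq_extTraj (hv : MemCTC P.T (closure P.Ω) 2 v) {t₀ : ℝ}
    (ht₀ : t₀ ∈ Icc 0 P.T) {y₀ : Eucl d} {y : ℝ → Eucl d} (h : P.IsClosedLoop v t₀ y₀ y)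
    {t : ℝ} (ht : t ∈ Icc t₀ P.T) : y t = P.extTraj v (t₀, y₀) t := by
  obtain ⟨C, hC1, hC⟩ := exists_lipschitzOnWith_closedLoopField hv
  have hs := extTraj_spec hv (t₀, y₀)
  simp only [P.clip_eq ht₀] at hs
  have := norm_sub_le_of_hasDerivWithinAt hC1 (P.lipschitzWith_extend hC) le_rfl
    (fun t x => by simp) (C := P.T) (by linarith [ht₀.1]) (h.isExtTraj ht₀.1) hs.2 t ht
  rw [hs.1, h.init, sub_self, norm_zero, zero_add, zero_mul] at this
  exact sub_eq_zero.1 (norm_le_zero_iff.1 this)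

theorem isClosedLoop_extTraj (hv : MemCTC P.T (closure P.Ω) 2 v) {t₀ : ℝ}
    (ht₀ : t₀ ∈ Icc 0 P.T) {y₀ : Eucl d}
    (h : ∀ t ∈ Icc t₀ P.T, P.extTraj v (t₀, y₀) t ∈ closure P.Ω) :
    P.IsClosedLoop v t₀ y₀ (P.extTraj v (t₀, y₀)) := by
  have hs := extTraj_spec hv (t₀, y₀)
  simp only [P.clip_eq ht₀] at hs
  have := hs.2.isClosedLoop ht₀.1 h
  rwa [hs.1] at this

variable (P) in
/-- `v ∈ C([0,T]; C²)` and the closed loop problem is solvable for all initial values in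
`[0,T] × ω`. -/
def Solvable (v : ℝ → Eucl d → ℝ) : Prop :=
  MemCTC P.T (closure P.Ω) 2 v ∧
    ∀ t₀ ∈ Icc 0 P.T, ∀ y₀ ∈ P.ω, ∃ y, P.IsClosedLoop v t₀ y₀ y

theorem Solvable.isClosedLoop_flow (h : P.Solvable v) {t₀ : ℝ} (ht₀ : t₀ ∈ Icc 0 P.T)
    {y₀ : Eucl d} (hy₀ : y₀ ∈ P.ω) : P.IsClosedLoop v t₀ y₀ (P.flow v t₀ y₀) :=
  Classical.epsilon_spec (h.2 t₀ ht₀ y₀ hy₀)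

theorem Solvable.flow_eq (h : P.Solvable v) {t₀ : ℝ} (ht₀ : t₀ ∈ Icc 0 P.T)
    {y₀ : Eucl d} (hy₀ : y₀ ∈ P.ω) {t : ℝ} (ht : t ∈ Icc t₀ P.T) :
    P.flow v t₀ y₀ t = P.extTraj v (t₀, y₀) t :=
  (h.isClosedLoop_flow ht₀ hy₀).eq_extTraj h.1 ht₀ ht

theorem Solvable.extTraj_mem (h : P.Solvable v) {t₀ : ℝ} (ht₀ : t₀ ∈ Icc 0 P.T)
    {y₀ : Eucl d} (hy₀ : y₀ ∈ P.ω) {t : ℝ} (ht : t ∈ Icc t₀ P.T) :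
    P.extTraj v (t₀, y₀) t ∈ closure P.Ω := by
  rw [← h.flow_eq ht₀ hy₀ ht]
  exact (h.isClosedLoop_flow ht₀ hy₀).mem_closure t ht

theorem solvable_of_mem_setD (h : v ∈ P.setD) : P.Solvable v := ⟨h.1, h.2.1⟩

/-- Solvability is inherited by limits, as the trajectories converge uniformly. -/
theorem solvable_of_mem_closureD (h : v ∈ P.closureD) : P.Solvable v := by
  refine ⟨h.1, fun t₀ ht₀ y₀ hy₀ => ⟨_, isClosedLoop_extTraj h.1 ht₀ fun t ht => ?_⟩⟩
  obtain ⟨A, hA0, hA⟩ := exists_norm_extTraj_sub_le_ctcNorm h.1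
  rw [← closure_closure]
  refine Metric.mem_closure_iff.2 fun ε hε => ?_
  obtain ⟨w, hw, hwv⟩ := h.2 (ε / (A + 1)) (by positivity)
  refine ⟨_, (solvable_of_mem_setD hw).extTraj_mem ht₀ hy₀ ht, ?_⟩
  rw [dist_eq_norm]
  have hs := ctcNorm_sub_comm (n := 1) P.isCompact_closure_Ω P.uniqueDiffOn_closure_Ω
    (h.1.of_le one_le_two) (hw.1.of_le one_le_two)
  have hm := (h.1.sub P.uniqueDiffOn_closure_Ω hw.1).ctcNorm_mono P.isCompact_closure_Ω one_le_two
  have h0 := ctcNorm_nonneg (T := P.T) (K := closure P.Ω) (n := 1) (v := w - v)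
  calc _ ≤ A * ctcNorm P.T (closure P.Ω) 1 (w - v) := hA w hw.1 _ _
    _ ≤ (A + 1) * ctcNorm P.T (closure P.Ω) 1 (w - v) := by nlinarith
    _ < (A + 1) * (ε / (A + 1)) := by
        have : 0 < A + 1 := by linarith
        exact mul_lt_mul_of_pos_left (by linarith) this
    _ = ε := by field_simp

theorem setD_subset_closureD : P.setD ⊆ P.closureD := fun v hv =>
  ⟨hv.1, fun _ hε => ⟨v, hv, by rwa [ctcNorm_sub_self]⟩⟩

theorem mem_closureD_of_tendsto {ι : Type*} {l : Filter ι} [l.NeBot] {u : ι → ℝ → Eucl d → ℝ}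
    (hu : ∃ᶠ i in l, u i ∈ P.closureD) (hv : MemCTC P.T (closure P.Ω) 2 v)
    (h : Tendsto (fun i => ctcNorm P.T (closure P.Ω) 2 (u i - v)) l (𝓝 0)) : v ∈ P.closureD := by
  refine ⟨hv, fun ε hε => ?_⟩
  obtain ⟨i, hi, hi'⟩ := (hu.and_eventually (h.eventually_lt_const (half_pos hε))).exists
  obtain ⟨w, hw, hw'⟩ := hi.2 (ε / 2) (half_pos hε)
  refine ⟨w, hw, ?_⟩
  have h1 := ctcNorm_sub_le P.isCompact_closure_Ω P.uniqueDiffOn_closure_Ω hv hi.1 hw.1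
  rw [ctcNorm_sub_comm P.isCompact_closure_Ω P.uniqueDiffOn_closure_Ω hv hi.1] at h1
  linarith

theorem extTraj_mem_reach (h : P.Solvable v) {t₀ : ℝ} (ht₀ : t₀ ∈ Ioo 0 P.T) {y₀ : Eucl d}
    (hy₀ : y₀ ∈ P.ω) {t : ℝ} (ht : t ∈ Ico t₀ P.T) : P.extTraj v (t₀, y₀) t ∈ P.reach v :=
  ⟨t₀, ht₀, y₀, hy₀, t, ht, (h.flow_eq ⟨ht₀.1.le, ht₀.2.le⟩ hy₀ ⟨ht.1, ht.2.le⟩).symm⟩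

/-- Trajectories of a solvable `v` that start in `[0,T] × ω` stay in the closure of the states
reached from initial times in `(0,T)` before `T`. -/
theorem extTraj_mem_closure_reach (h : P.Solvable v) {t₀ : ℝ} (ht₀ : t₀ ∈ Icc 0 P.T)
    {y₀ : Eucl d} (hy₀ : y₀ ∈ P.ω) (t : ℝ) :
    P.extTraj v (t₀, y₀) t ∈ closure (P.reach v) := by
  have hc := continuous_extTraj h.1
  -- interior initial times and all times in `[t₀, T)`
  have h1 : ∀ s ∈ Ioo 0 P.T, ∀ t ∈ Iio P.T, P.extTraj v (s, y₀) t ∈ P.reach v := by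
    intro s hs t ht
    have hs' : P.clip s = s := P.clip_eq ⟨hs.1.le, hs.2.le⟩
    rw [extTraj_eq_max]
    refine extTraj_mem_reach h hs hy₀ ⟨?_, ?_⟩
    · simp [hs']
    · exact max_lt (by simpa [hs'] using hs.2)
        (max_lt P.T_pos ((min_le_right _ _).trans_lt ht))
  have h2 : ∀ q ∈ closure (Ioo 0 P.T) ×ˢ closure (Iio P.T),
      P.extTraj v (q.1, y₀) q.2 ∈ closure (P.reach v) := by
    intro q hq
    rw [← closure_prod_eq] at hq
    exact map_mem_closure (f := fun q : ℝ × ℝ => P.extTraj v (q.1, y₀) q.2)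
      (hc.comp (by fun_prop : Continuous fun q : ℝ × ℝ => ((q.1, y₀), q.2))) hq
      fun q hq => h1 q.1 hq.1 q.2 hq.2
  have h3 : P.extTraj v (t₀, y₀) t = P.extTraj v (t₀, y₀) (P.clip t) := by
    rw [extTraj_eq_max, extTraj_eq_max v _ (P.clip t), P.clip_eq (P.clip_mem t)]
  rw [h3]
  refine h2 (t₀, P.clip t) ⟨?_, ?_⟩
  · rwa [closure_Ioo P.T_pos.ne]
  · rw [closure_Iio]; exact (P.clip_mem t).2

/-- `D` is a neighbourhood of each of its elements, even in the coarser norm of `C([0,T]; C¹)`. -/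
theorem exists_forall_mem_setD (hv : v ∈ P.setD) :
    ∃ ε > 0, ∀ w, MemCTC P.T (closure P.Ω) 2 w → ctcNorm P.T (closure P.Ω) 1 (w - v) < ε →
      w ∈ P.setD := by
  have hs := solvable_of_mem_setD hv
  have hcomp : IsCompact (closure (P.reach v)) :=
    P.isCompact_closure_Ω.of_isClosed_subset isClosed_closure (hv.2.2.trans subset_closure)
  obtain ⟨δ, hδ, hsub⟩ := hcomp.exists_cthickening_subset_open P.isOpen_Ω hv.2.2
  obtain ⟨A, hA0, hA⟩ := exists_norm_extTraj_sub_le_ctcNorm hv.1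
  refine ⟨δ / (A + 1), by positivity, fun w hw hwv => ?_⟩
  have hmem : ∀ t₀ ∈ Icc 0 P.T, ∀ y₀ ∈ P.ω, ∀ t,
      P.extTraj w (t₀, y₀) t ∈ Metric.cthickening δ (closure (P.reach v)) := by
    intro t₀ ht₀ y₀ hy₀ t
    refine Metric.mem_cthickening_of_dist_le _ _ δ _ (extTraj_mem_closure_reach hs ht₀ hy₀ t) ?_
    rw [dist_comm, dist_eq_norm]
    have h0 := ctcNorm_nonneg (T := P.T) (K := closure P.Ω) (n := 1) (v := w - v)
    calc _ ≤ A * ctcNorm P.T (closure P.Ω) 1 (w - v) := hA w hw _ _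
      _ ≤ (A + 1) * (δ / (A + 1)) := by gcongr; linarith
      _ = δ := by field_simp
  have hsol : P.Solvable w := ⟨hw, fun t₀ ht₀ y₀ hy₀ => ⟨_, isClosedLoop_extTraj hw ht₀
    fun t _ => subset_closure (hsub (hmem t₀ ht₀ y₀ hy₀ t))⟩⟩
  refine ⟨hw, hsol.2, (closure_minimal ?_ Metric.isClosed_cthickening).trans hsub⟩
  rintro _ ⟨t₀, ht₀, y₀, hy₀, t, ht, rfl⟩
  rw [hsol.flow_eq ⟨ht₀.1.le, ht₀.2.le⟩ hy₀ ⟨ht.1, ht.2.le⟩]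
  exact hmem t₀ ⟨ht₀.1.le, ht₀.2.le⟩ y₀ hy₀ t

end ControlProblem

namespace ControlProblem

variable {d M : ℕ} {P : ControlProblem d M} {v w : ℝ → Eucl d → ℝ}

/-! ### The closed loop cost as a function of the initial values -/

variable (P) in
/-- The integrand of the closed loop cost, as a function of time and state. -/
def runCost (v : ℝ → Eucl d → ℝ) (t : ℝ) (x : Eucl d) : ℝ :=
  P.ℓ t x + P.β / 2 * ‖P.feedback v t x‖ ^ 2

theorem continuousOn_runCost (hv : MemCTC P.T (closure P.Ω) 1 v) :
    ContinuousOn (fun p : ℝ × Eucl d => P.runCost v p.1 p.2) (Icc 0 P.T ×ˢ closure P.Ω) :=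
  P.ℓ_mem.continuousOn.add (continuousOn_const.mul ((continuousOn_feedback hv).norm.pow 2))

variable (P) in
/-- The closed loop cost along the trajectories of the extended field. -/
def extCost (v : ℝ → Eucl d → ℝ) (p : ℝ × Eucl d) : ℝ :=
  (∫ t in p.1..P.T, P.extend (P.runCost v) t (P.extTraj v p t)) + P.g (P.proj (P.extTraj v p P.T))

theorem continuous_g_proj : Continuous fun x => P.g (P.proj x) :=
  P.g_mem.continuousOn.comp_continuous P.continuous_proj P.proj_mem

theorem continuous_extend_extTraj (hv : MemCTC P.T (closure P.Ω) 2 v) :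
    Continuous fun q : (ℝ × Eucl d) × ℝ => P.extend (P.runCost v) q.2 (P.extTraj v q.1 q.2) :=
  (P.continuous_extend (continuousOn_runCost (hv.of_le one_le_two))).comp
    (continuous_snd.prodMk (continuous_extTraj hv))

theorem continuous_extCost (hv : MemCTC P.T (closure P.Ω) 2 v) : Continuous (P.extCost v) := by
  have hc := continuous_extend_extTraj hv
  refine Continuous.add ?_ (continuous_g_proj.comp
    ((continuous_extTraj hv).comp (continuous_id.prodMk continuous_const)))
  simp only [intervalIntegral.integral_symm P.T]
  exact (intervalIntegral.continuous_parametric_intervalIntegral_of_continuous hc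
    continuous_fst).neg

theorem Solvable.closedLoopCost_eq (h : P.Solvable v) {t₀ : ℝ} (ht₀ : t₀ ∈ Icc 0 P.T)
    {y₀ : Eucl d} (hy₀ : y₀ ∈ P.ω) : P.closedLoopCost v t₀ y₀ = P.extCost v (t₀, y₀) := by
  have hT : P.T ∈ Icc t₀ P.T := right_mem_Icc.2 ht₀.2
  rw [closedLoopCost, cost, extCost, h.flow_eq ht₀ hy₀ hT, P.proj_eq (h.extTraj_mem ht₀ hy₀ hT)]
  congr 1
  refine intervalIntegral.integral_congr fun t ht => ?_
  rw [uIcc_of_le ht₀.2] at ht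
  simp only [closedLoopControl]
  rw [h.flow_eq ht₀ hy₀ ht, P.extend_eq _ ⟨ht₀.1.trans ht.1, ht.2⟩ (h.extTraj_mem ht₀ hy₀ ht)]
  rfl

theorem extCost_nonneg {p : ℝ × Eucl d} (hp : p.1 ∈ Icc 0 P.T) : 0 ≤ P.extCost v p := by
  refine add_nonneg (intervalIntegral.integral_nonneg hp.2 fun t _ => ?_)
    (P.g_nonneg _ (P.proj_mem _))
  refine add_nonneg (P.ℓ_nonneg _ (P.clip_mem _) _ (P.proj_mem _)) ?_
  have := P.β_pos
  positivity

theorem exists_abs_runCost_sub_le (hv : MemCTC P.T (closure P.Ω) 1 v) :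
    ∃ C : ℝ, 0 ≤ C ∧ ∀ w, MemCTC P.T (closure P.Ω) 1 w →
      ctcNorm P.T (closure P.Ω) 1 (w - v) ≤ 1 → ∀ t ∈ Icc 0 P.T, ∀ x ∈ closure P.Ω,
      |P.runCost w t x - P.runCost v t x| ≤ C * ctcNorm P.T (closure P.Ω) 1 (w - v) := by
  obtain ⟨R, hR⟩ := P.exists_bound (continuousOn_feedback hv)
  have hβ := P.β_pos
  set c := ‖P.B‖ / P.β
  have hc : 0 ≤ c := by positivity
  refine ⟨P.β / 2 * (c * (2 * R + c)), by positivity, fun w hw h1 t ht x hx => ?_⟩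
  have hd := norm_feedback_sub_le hw hv ht hx
  have h0 := ctcNorm_nonneg (T := P.T) (K := closure P.Ω) (n := 1) (v := w - v)
  set n := ctcNorm P.T (closure P.Ω) 1 (w - v)
  have e : P.runCost w t x - P.runCost v t x
      = P.β / 2 * ((‖P.feedback w t x‖ - ‖P.feedback v t x‖)
        * (‖P.feedback w t x‖ + ‖P.feedback v t x‖)) := by
    unfold runCost; ring
  have h2 : |‖P.feedback w t x‖ - ‖P.feedback v t x‖| ≤ c * n :=
    (abs_norm_sub_norm_le _ _).trans hd
  have h3 : ‖P.feedback w t x‖ + ‖P.feedback v t x‖ ≤ 2 * R + c := by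
    have := (le_abs_self _).trans h2
    nlinarith [hR t ht x hx]
  rw [e, abs_mul, abs_mul, abs_of_pos (half_pos hβ), abs_of_nonneg (add_nonneg (norm_nonneg _)
    (norm_nonneg _))]
  calc _ ≤ P.β / 2 * ((c * n) * (2 * R + c)) := by
        refine mul_le_mul_of_nonneg_left ?_ (half_pos hβ).le
        exact mul_le_mul h2 h3 (by positivity) (by positivity)
    _ = _ := by ring

/-- Continuous dependence of the closed loop cost on `v`, uniformly in the initial values. -/
theorem exists_abs_extCost_sub_le (hv : MemCTC P.T (closure P.Ω) 2 v) {η : ℝ} (hη : 0 < η) :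
    ∃ δ > 0, ∀ w, MemCTC P.T (closure P.Ω) 2 w → ctcNorm P.T (closure P.Ω) 1 (w - v) < δ →
      ∀ p : ℝ × Eucl d, p.1 ∈ Icc 0 P.T → |P.extCost w p - P.extCost v p| ≤ η := by
  have hT := P.T_pos
  have hcr := continuousOn_runCost (hv.of_le one_le_two)
  obtain ⟨C, hC0, hC⟩ := exists_abs_runCost_sub_le (hv.of_le one_le_two)
  obtain ⟨A, hA0, hA⟩ := exists_norm_extTraj_sub_le_ctcNorm hv
  set ε := η / (2 * (P.T + 1))
  have hε : 0 < ε := by positivity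
  have hpd : ∀ x y, dist (P.proj x) (P.proj y) ≤ ‖x - y‖ := fun x y => by
    rw [← dist_eq_norm]; simpa using P.lipschitzWith_proj.dist_le_mul x y
  obtain ⟨δ₁, hδ₁, h₁⟩ := Metric.uniformContinuousOn_iff.1
    ((isCompact_Icc.prod P.isCompact_closure_Ω).uniformContinuousOn_of_continuous hcr) ε hε
  obtain ⟨δ₂, hδ₂, h₂⟩ := Metric.uniformContinuousOn_iff.1
    (P.isCompact_closure_Ω.uniformContinuousOn_of_continuous P.g_mem.continuousOn) ε hε
  refine ⟨min (min 1 (min δ₁ δ₂ / (A + 1))) (η / (2 * (P.T * C + 1))), by positivity,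
    fun w hw hwv p hp => ?_⟩
  have h0 := ctcNorm_nonneg (T := P.T) (K := closure P.Ω) (n := 1) (v := w - v)
  set n := ctcNorm P.T (closure P.Ω) 1 (w - v)
  have hn1 : n ≤ 1 := (hwv.trans_le ((min_le_left _ _).trans (min_le_left _ _))).le
  have hn2 : n < min δ₁ δ₂ / (A + 1) :=
    hwv.trans_le ((min_le_left _ _).trans (min_le_right _ _))
  have hn3 : n < η / (2 * (P.T * C + 1)) := hwv.trans_le (min_le_right _ _)
  have hz : ∀ t, ‖P.extTraj w p t - P.extTraj v p t‖ < min δ₁ δ₂ := fun t => by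
    rw [norm_sub_rev]
    rw [lt_div_iff₀ (by positivity)] at hn2
    refine lt_of_le_of_lt (hA w hw p t) (lt_of_le_of_lt ?_ hn2)
    nlinarith
  have hpt : ∀ t, |P.extend (P.runCost w) t (P.extTraj w p t)
      - P.extend (P.runCost v) t (P.extTraj v p t)| ≤ C * n + ε := fun t => by
    have ha := hC w (hw.of_le one_le_two) hn1 _ (P.clip_mem t) _ (P.proj_mem (P.extTraj w p t))
    have hb := h₁ (P.clip t, P.proj (P.extTraj w p t)) ⟨P.clip_mem t, P.proj_mem _⟩
      (P.clip t, P.proj (P.extTraj v p t)) ⟨P.clip_mem t, P.proj_mem _⟩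
      (by
        rw [Prod.dist_eq, dist_self, max_eq_right dist_nonneg]
        exact (hpd _ _).trans_lt ((hz t).trans_le (min_le_left _ _)))
    rw [Real.dist_eq] at hb
    exact (abs_sub_le _ _ _).trans (add_le_add ha hb.le)
  have hg := h₂ _ (P.proj_mem (P.extTraj w p P.T)) _ (P.proj_mem (P.extTraj v p P.T))
    ((hpd _ _).trans_lt ((hz P.T).trans_le (min_le_right _ _)))
  rw [Real.dist_eq] at hg
  have hint : ∀ {u : ℝ → Eucl d → ℝ}, MemCTC P.T (closure P.Ω) 2 u →
      IntervalIntegrable (fun t => P.extend (P.runCost u) t (P.extTraj u p t)) volume p.1 P.T :=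
    fun hu => ((continuous_extend_extTraj hu).comp
      (continuous_const.prodMk continuous_id : Continuous fun t : ℝ => (p, t))).intervalIntegrable
        _ _
  have hi : |∫ t in p.1..P.T, (P.extend (P.runCost w) t (P.extTraj w p t)
      - P.extend (P.runCost v) t (P.extTraj v p t))| ≤ (C * n + ε) * P.T := by
    refine (intervalIntegral.norm_integral_le_of_norm_le_const (C := C * n + ε)
      fun t _ => (Real.norm_eq_abs _).trans_le (hpt t)).trans ?_
    rw [abs_of_nonneg (sub_nonneg.2 hp.2)]
    gcongr
    linarith [hp.1]
  rw [intervalIntegral.integral_sub (hint hw) (hint hv)] at hi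
  have e : P.extCost w p - P.extCost v p
      = ((∫ t in p.1..P.T, P.extend (P.runCost w) t (P.extTraj w p t))
        - ∫ t in p.1..P.T, P.extend (P.runCost v) t (P.extTraj v p t))
        + (P.g (P.proj (P.extTraj w p P.T)) - P.g (P.proj (P.extTraj v p P.T))) := by
    unfold extCost; ring
  rw [e]
  refine (abs_add_le _ _).trans ((add_le_add hi hg.le).trans ?_)
  have h4 : ε * (P.T + 1) = η / 2 := by simp only [ε]; field_simp
  rw [lt_div_iff₀ (by positivity)] at hn3
  nlinarith

/-! ### Averages over the initial values -/

variable (P) in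
/-- The set of initial values `(t₀, y₀)` used for learning. -/
def initSet : Set (ℝ × Eucl d) := Ioo 0 P.T ×ˢ P.ω

theorem measurableSet_initSet : MeasurableSet P.initSet :=
  measurableSet_Ioo.prod P.isOpen_ω.measurableSet

theorem volume_ω_lt_top : volume P.ω < ⊤ :=
  ((P.isBounded_Ω.subset P.ω_subset_Ω).measure_lt_top)

theorem volume_ω_toReal_pos : 0 < (volume P.ω).toReal :=
  ENNReal.toReal_pos (P.isOpen_ω.measure_pos _ P.nonempty_ω).ne' volume_ω_lt_top.ne

theorem measureReal_initSet : volume.real P.initSet = P.T * (volume P.ω).toReal := by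
  rw [initSet, Measure.volume_eq_prod, measureReal_prod_prod]
  simp [Measure.real, P.T_pos.le]

theorem volume_initSet_lt_top : volume P.initSet < ⊤ := by
  rw [initSet, Measure.volume_eq_prod, Measure.prod_prod]
  exact ENNReal.mul_lt_top (by simp) volume_ω_lt_top

theorem integrableOn_initSet {F G : ℝ × Eucl d → ℝ} (hG : Continuous G)
    (h : EqOn F G P.initSet) : IntegrableOn F P.initSet := by
  have hc : IsCompact (Icc 0 P.T ×ˢ closure P.ω) :=
    isCompact_Icc.prod (P.isBounded_Ω.subset P.ω_subset_Ω).isCompact_closure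
  refine IntegrableOn.congr_fun ?_ h.symm measurableSet_initSet
  exact (hG.continuousOn.integrableOn_compact hc).mono_set
    (prod_mono Ioo_subset_Icc_self subset_closure)

theorem integral_integral_eq {F : ℝ × Eucl d → ℝ} (hF : IntegrableOn F P.initSet) :
    ∫ y₀ in P.ω, ∫ t₀ in (0)..P.T, F (t₀, y₀) = ∫ p in P.initSet, F p := by
  unfold IntegrableOn initSet at *
  rw [Measure.volume_eq_prod, ← Measure.prod_restrict] at *
  rw [integral_prod_symm _ hF]
  congr 1
  ext y₀
  rw [intervalIntegral.integral_of_le P.T_pos.le, integral_Ioc_eq_integral_Ioo]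

theorem Solvable.eqOn_closedLoopCost (h : P.Solvable v) :
    EqOn (fun p : ℝ × Eucl d => P.closedLoopCost v p.1 p.2) (P.extCost v) P.initSet :=
  fun _ hp => h.closedLoopCost_eq (Ioo_subset_Icc_self hp.1) hp.2

theorem Solvable.integrableOn_closedLoopCost (h : P.Solvable v) :
    IntegrableOn (fun p : ℝ × Eucl d => P.closedLoopCost v p.1 p.2) P.initSet :=
  integrableOn_initSet (continuous_extCost h.1) h.eqOn_closedLoopCost

theorem Solvable.learnCost_eq (h : P.Solvable v) :
    P.learnCost v = (P.T * (volume P.ω).toReal)⁻¹ * ∫ p in P.initSet, P.extCost v p := by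
  rw [learnCost, integral_integral_eq (F := fun p => P.closedLoopCost v p.1 p.2)
    h.integrableOn_closedLoopCost,
    setIntegral_congr_fun measurableSet_initSet h.eqOn_closedLoopCost]

theorem Solvable.learnCost_nonneg (h : P.Solvable v) : 0 ≤ P.learnCost v := by
  rw [h.learnCost_eq]
  have := P.T_pos
  exact mul_nonneg (by positivity) (setIntegral_nonneg measurableSet_initSet
    fun p hp => extCost_nonneg (Ioo_subset_Icc_self hp.1))

/-- Continuity of the learning functional on the set of solvable `v`. -/
theorem Solvable.exists_abs_learnCost_sub_le (hv : P.Solvable v) {η : ℝ} (hη : 0 < η) :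
    ∃ δ > 0, ∀ w, P.Solvable w → ctcNorm P.T (closure P.Ω) 1 (w - v) < δ →
      |P.learnCost w - P.learnCost v| ≤ η := by
  obtain ⟨δ, hδ, h⟩ := exists_abs_extCost_sub_le hv.1 hη
  refine ⟨δ, hδ, fun w hw hwv => ?_⟩
  have hpos : 0 < P.T * (volume P.ω).toReal := mul_pos P.T_pos volume_ω_toReal_pos
  rw [hw.learnCost_eq, hv.learnCost_eq, ← mul_sub, ← integral_sub
    (integrableOn_initSet (continuous_extCost hw.1) fun _ _ => rfl)
    (integrableOn_initSet (continuous_extCost hv.1) fun _ _ => rfl), abs_mul,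
    abs_of_pos (inv_pos.2 hpos), inv_mul_le_iff₀ hpos, mul_comm, ← measureReal_initSet]
  exact norm_setIntegral_le_of_norm_le_const (C := η) volume_initSet_lt_top
    fun p hp => (Real.norm_eq_abs _).trans_le (h w hw.1 hwv p (Ioo_subset_Icc_self hp.1))

/-! ### Solvability of the finite dimensional problems -/

theorem penalty_nonneg {N : ℕ} {r : ℝ} (hr : r ∈ Icc (0 : ℝ) 1) (θ : Fin N → ℝ) :
    0 ≤ penalty r θ :=
  add_nonneg (mul_nonneg (by linarith [hr.2]) (Finset.sum_nonneg fun _ _ => sq_nonneg _))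
    (mul_nonneg hr.1 (Finset.sum_nonneg fun _ _ => abs_nonneg _))

theorem continuous_penalty {N : ℕ} (r : ℝ) : Continuous (penalty (N := N) r) := by
  unfold penalty; fun_prop

theorem abs_le_penalty {N : ℕ} {r : ℝ} (hr : r ∈ Icc (0 : ℝ) 1) (θ : Fin N → ℝ) (i : Fin N) :
    |θ i| ≤ 4 * penalty r θ + 1 := by
  have h1 : θ i ^ 2 ≤ ∑ i, θ i ^ 2 :=
    Finset.single_le_sum (f := fun i => θ i ^ 2) (fun _ _ => sq_nonneg _) (Finset.mem_univ i)
  have h2 : |θ i| ≤ ∑ i, |θ i| :=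
    Finset.single_le_sum (f := fun i => |θ i|) (fun _ _ => abs_nonneg _) (Finset.mem_univ i)
  have h3 : (1 - r) / 2 * θ i ^ 2 + r * |θ i| ≤ penalty r θ :=
    add_le_add (mul_le_mul_of_nonneg_left h1 (by linarith [hr.2]))
      (mul_le_mul_of_nonneg_left h2 hr.1)
  have h4 : 2 * |θ i| - 1 ≤ θ i ^ 2 := by nlinarith [sq_abs (θ i), sq_nonneg (|θ i| - 1)]
  -- the penalty dominates `(1-r)/2 (2|θᵢ| - 1) + r |θᵢ| = |θᵢ| - (1-r)/2`
  have h5 : (1 - r) / 2 * (2 * |θ i| - 1) ≤ (1 - r) / 2 * θ i ^ 2 :=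
    mul_le_mul_of_nonneg_left h4 (by linarith [hr.2])
  have := penalty_nonneg hr θ
  linarith [hr.1]

/-- The direct method: the penalty is coercive, the feasible set is closed and the learning
functional is continuous on it. -/
theorem exists_isSolution {N : ℕ} {I : (Fin N → ℝ) → ℝ → Eucl d → ℝ}
    (hI : ∀ θ, MemCTC P.T (closure P.Ω) 2 (I θ))
    (hcont : ∀ θ, Tendsto (fun θ' => ctcNorm P.T (closure P.Ω) 2 (I θ' - I θ)) (𝓝 θ) (𝓝 0))
    {θ₀ : Fin N → ℝ} (hθ₀ : I θ₀ ∈ P.closureD) {γ r : ℝ} (hγ : 0 < γ) (hr : r ∈ Icc (0 : ℝ) 1) :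
    ∃ θ, P.IsSolution I γ r θ := by
  have hcl : IsClosed {θ | I θ ∈ P.closureD} := by
    refine isClosed_iff_frequently.2 fun θ h => mem_closureD_of_tendsto h (hI θ) (hcont θ)
  have hco : ContinuousOn (fun θ => P.learnCost (I θ) + γ * penalty r θ)
      {θ | I θ ∈ P.closureD} := by
    refine ContinuousOn.add (fun θ hθ => ?_)
      (continuous_const.mul (continuous_penalty r)).continuousOn
    refine Metric.tendsto_nhds.2 fun η hη => ?_
    obtain ⟨δ, hδ, h⟩ := (solvable_of_mem_closureD hθ).exists_abs_learnCost_sub_le (half_pos hη)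
    filter_upwards [mem_nhdsWithin_of_mem_nhds ((hcont θ).eventually_lt_const hδ),
      self_mem_nhdsWithin] with θ' h1 h2
    rw [Real.dist_eq]
    refine (h _ (solvable_of_mem_closureD h2) (lt_of_le_of_lt ?_ h1)).trans_lt (half_lt_self hη)
    exact ((hI θ').sub P.uniqueDiffOn_closure_Ω (hI θ)).ctcNorm_mono P.isCompact_closure_Ω
      one_le_two
  obtain ⟨θ, hθ, hmin⟩ := hco.exists_isMinOn' hcl hθ₀ (by
    set J₀ := P.learnCost (I θ₀) + γ * penalty r θ₀
    have hK : IsCompact (univ.pi fun _ : Fin N => Icc (-(4 * (J₀ / γ) + 1)) (4 * (J₀ / γ) + 1)) :=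
      isCompact_univ_pi fun _ => isCompact_Icc
    refine mem_inf_iff_superset.2 ⟨_, hK.compl_mem_cocompact, _, mem_principal_self _, ?_⟩
    rintro θ ⟨h1, h2⟩
    by_contra hlt
    refine h1 fun i _ => abs_le.1 ?_
    have h3 : penalty r θ ≤ J₀ / γ := by
      rw [le_div_iff₀ hγ]
      have := (solvable_of_mem_closureD h2).learnCost_nonneg
      simp only [mem_ofPred_eq, not_le] at hlt
      linarith
    linarith [abs_le_penalty hr θ i])
  exact ⟨θ, hθ, fun θ' hθ' => hmin hθ'⟩

end ControlProblem

namespace ControlProblem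

variable {d M : ℕ} {P : ControlProblem d M} {v V : ℝ → Eucl d → ℝ} {t₀ : ℝ} {y₀ : Eucl d}
  {u : ℝ → Eucl M} {y : ℝ → Eucl d}

/-! ### Admissible pairs -/

theorem IsAdmissible.integrableOn_control (h : P.IsAdmissible t₀ y₀ u y) :
    IntegrableOn u (Ioo t₀ P.T) :=
  h.memLp.integrable one_le_two

theorem IsAdmissible.integrableOn_control_sq (h : P.IsAdmissible t₀ y₀ u y) :
    IntegrableOn (fun t => ‖u t‖ ^ 2) (Ioo t₀ P.T) :=
  h.memLp.integrable_norm_pow two_ne_zero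

theorem intervalIntegrable_of_integrableOn_Ioo {G : Type*} [NormedAddCommGroup G] {φ : ℝ → G}
    {a b s t : ℝ} (h : IntegrableOn φ (Ioo a b)) (has : a ≤ s) (hst : s ≤ t) (htb : t ≤ b) :
    IntervalIntegrable φ volume s t := by
  rw [intervalIntegrable_iff_integrableOn_Ioo_of_le hst]
  exact h.mono_set (Ioo_subset_Ioo has htb)

theorem IsAdmissible.continuousOn_comp {G : Type*} [TopologicalSpace G] {φ : ℝ → Eucl d → G}
    (h : P.IsAdmissible t₀ y₀ u y) (ht₀ : 0 ≤ t₀)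
    (hφ : ContinuousOn (fun p : ℝ × Eucl d => φ p.1 p.2) (Icc 0 P.T ×ˢ closure P.Ω)) :
    ContinuousOn (fun t => φ t (y t)) (Icc t₀ P.T) :=
  hφ.comp (f := fun t => (t, y t)) (continuousOn_id.prodMk h.continuousOn)
    fun t ht => ⟨⟨ht₀.trans ht.1, ht.2⟩, h.mem_closure t ht⟩

theorem IsAdmissible.intervalIntegrable_comp {G : Type*} [NormedAddCommGroup G]
    {φ : ℝ → Eucl d → G} (h : P.IsAdmissible t₀ y₀ u y) (ht₀ : 0 ≤ t₀)
    (hφ : ContinuousOn (fun p : ℝ × Eucl d => φ p.1 p.2) (Icc 0 P.T ×ˢ closure P.Ω))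
    {s t : ℝ} (hs : t₀ ≤ s) (hst : s ≤ t) (ht : t ≤ P.T) :
    IntervalIntegrable (fun t => φ t (y t)) volume s t :=
  ((h.continuousOn_comp ht₀ hφ).mono (by rw [uIcc_of_le hst]; exact Icc_subset_Icc hs ht))
    |>.intervalIntegrable

theorem IsAdmissible.intervalIntegrable_control (h : P.IsAdmissible t₀ y₀ u y)
    {s t : ℝ} (hs : t₀ ≤ s) (hst : s ≤ t) (ht : t ≤ P.T) : IntervalIntegrable u volume s t :=
  intervalIntegrable_of_integrableOn_Ioo h.integrableOn_control hs hst ht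

theorem IsAdmissible.intervalIntegrable_control_sq (h : P.IsAdmissible t₀ y₀ u y)
    {s t : ℝ} (hs : t₀ ≤ s) (hst : s ≤ t) (ht : t ≤ P.T) :
    IntervalIntegrable (fun t => ‖u t‖ ^ 2) volume s t :=
  intervalIntegrable_of_integrableOn_Ioo h.integrableOn_control_sq hs hst ht

theorem IsAdmissible.intervalIntegrable_B (h : P.IsAdmissible t₀ y₀ u y)
    {s t : ℝ} (hs : t₀ ≤ s) (hst : s ≤ t) (ht : t ≤ P.T) :
    IntervalIntegrable (fun t => P.B (u t)) volume s t := by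
  have := h.intervalIntegrable_control hs hst ht
  rw [intervalIntegrable_iff] at this ⊢
  exact P.B.integrable_comp this

theorem IsAdmissible.intervalIntegrable_rhs (h : P.IsAdmissible t₀ y₀ u y) (ht₀ : 0 ≤ t₀)
    {s t : ℝ} (hs : t₀ ≤ s) (hst : s ≤ t) (ht : t ≤ P.T) :
    IntervalIntegrable (fun t => P.f t (y t) + P.B (u t)) volume s t :=
  (h.intervalIntegrable_comp ht₀ P.f_mem.continuousOn hs hst ht).add
    (h.intervalIntegrable_B hs hst ht)

theorem IsAdmissible.init (h : P.IsAdmissible t₀ y₀ u y) (ht₀ : t₀ ≤ P.T) : y t₀ = y₀ := by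
  simpa using h.state_eq t₀ (left_mem_Icc.2 ht₀)

theorem IsAdmissible.sub_eq (h : P.IsAdmissible t₀ y₀ u y) (ht₀ : 0 ≤ t₀) {s t : ℝ} (hs : t₀ ≤ s)
    (hst : s ≤ t) (ht : t ≤ P.T) :
    y t = y s + ((∫ r in s..t, P.f r (y r)) + P.B (∫ r in s..t, u r)) := by
  rw [h.state_eq t ⟨hs.trans hst, ht⟩, h.state_eq s ⟨hs, hst.trans ht⟩,
    ← intervalIntegral.integral_add_adjacent_intervals
      (h.intervalIntegrable_rhs ht₀ le_rfl hs (hst.trans ht))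
      (h.intervalIntegrable_rhs ht₀ hs hst ht), add_assoc,
    intervalIntegral.integral_add (h.intervalIntegrable_comp ht₀ P.f_mem.continuousOn hs hst ht)
      (h.intervalIntegrable_B hs hst ht),
    P.B.intervalIntegral_comp_comm (h.intervalIntegrable_control hs hst ht)]

theorem IsAdmissible.restrict (h : P.IsAdmissible t₀ y₀ u y) (ht₀ : 0 ≤ t₀) {s : ℝ}
    (hs : t₀ ≤ s) : P.IsAdmissible s (y s) u y where
  memLp := h.memLp.mono_measure (Measure.restrict_mono (Ioo_subset_Ioo_left hs) le_rfl)
  continuousOn := h.continuousOn.mono (Icc_subset_Icc_left hs)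
  mem_closure t ht := h.mem_closure t ⟨hs.trans ht.1, ht.2⟩
  state_eq t ht := by
    rw [intervalIntegral.integral_add
      (h.intervalIntegrable_comp ht₀ P.f_mem.continuousOn hs ht.1 ht.2)
      (h.intervalIntegrable_B hs ht.1 ht.2),
      P.B.intervalIntegral_comp_comm (h.intervalIntegrable_control hs ht.1 ht.2)]
    exact h.sub_eq ht₀ hs ht.1 ht.2

theorem IsAdmissible.cost_eq (h : P.IsAdmissible t₀ y₀ u y) (ht₀ : 0 ≤ t₀) {s : ℝ} (hs : t₀ ≤ s)
    (hsT : s ≤ P.T) : P.cost t₀ u y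
      = (∫ t in t₀..s, P.ℓ t (y t)) + P.β / 2 * (∫ t in t₀..s, ‖u t‖ ^ 2) + P.cost s u y := by
  have hi : ∀ {a b : ℝ}, t₀ ≤ a → a ≤ b → b ≤ P.T →
      IntervalIntegrable (fun t => P.ℓ t (y t) + P.β / 2 * ‖u t‖ ^ 2) volume a b :=
    fun ha hab hb => (h.intervalIntegrable_comp ht₀ P.ℓ_mem.continuousOn ha hab hb).add
      ((h.intervalIntegrable_control_sq ha hab hb).const_mul _)
  rw [cost, cost, ← intervalIntegral.integral_add_adjacent_intervals (hi le_rfl hs hsT)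
    (hi hs hsT le_rfl), intervalIntegral.integral_add
      (h.intervalIntegrable_comp ht₀ P.ℓ_mem.continuousOn le_rfl hs hsT)
      ((h.intervalIntegrable_control_sq le_rfl hs hsT).const_mul _),
    intervalIntegral.integral_const_mul, add_assoc]

theorem IsAdmissible.cost_nonneg (h : P.IsAdmissible t₀ y₀ u y) (ht₀ : t₀ ∈ Icc 0 P.T) :
    0 ≤ P.cost t₀ u y := by
  refine add_nonneg (intervalIntegral.integral_nonneg ht₀.2 fun t ht => ?_)
    (P.g_nonneg _ (h.mem_closure _ (right_mem_Icc.2 ht₀.2)))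
  have := P.ℓ_nonneg t ⟨ht₀.1.trans ht.1, ht.2⟩ _ (h.mem_closure t ht)
  have := P.β_pos
  positivity

theorem IsAdmissible.integral_ℓ_nonneg (h : P.IsAdmissible t₀ y₀ u y) (ht₀ : t₀ ∈ Icc 0 P.T)
    {s : ℝ} (hs : s ∈ Icc t₀ P.T) : 0 ≤ ∫ t in t₀..s, P.ℓ t (y t) :=
  intervalIntegral.integral_nonneg hs.1 fun t ht =>
    P.ℓ_nonneg t ⟨ht₀.1.trans ht.1, ht.2.trans hs.2⟩ _ (h.mem_closure t ⟨ht.1, ht.2.trans hs.2⟩)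

/-- The energy of the control is controlled by the cost, as the other costs are nonnegative. -/
theorem IsAdmissible.energy_le (h : P.IsAdmissible t₀ y₀ u y) (ht₀ : t₀ ∈ Icc 0 P.T) {s : ℝ}
    (hs : s ∈ Icc t₀ P.T) : P.β / 2 * (∫ t in t₀..s, ‖u t‖ ^ 2) ≤ P.cost t₀ u y := by
  rw [h.cost_eq ht₀.1 hs.1 hs.2]
  have h1 := (h.restrict ht₀.1 hs.1).cost_nonneg ⟨ht₀.1.trans hs.1, hs.2⟩
  linarith [h.integral_ℓ_nonneg ht₀ hs]

/-- The Cauchy-Schwarz inequality for the mean of a function on an interval. -/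
theorem norm_intervalIntegral_sq_le {G : Type*} [NormedAddCommGroup G] [NormedSpace ℝ G]
    {φ : ℝ → G} {a b : ℝ} (hab : a ≤ b) (h1 : IntervalIntegrable φ volume a b)
    (h2 : IntervalIntegrable (fun t => ‖φ t‖ ^ 2) volume a b) :
    ‖∫ t in a..b, φ t‖ ^ 2 ≤ (b - a) * ∫ t in a..b, ‖φ t‖ ^ 2 := by
  rcases hab.eq_or_lt with rfl | hlt
  · simp
  have hpos : 0 < b - a := sub_pos.2 hlt
  set m := ∫ t in a..b, ‖φ t‖
  have hm : ‖∫ t in a..b, φ t‖ ≤ m := intervalIntegral.norm_integral_le_integral_norm hab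
  set c := m / (b - a)
  have h3 : 0 ≤ ∫ t in a..b, (‖φ t‖ ^ 2 - 2 * c * ‖φ t‖ + c ^ 2) :=
    intervalIntegral.integral_nonneg hab fun t _ => by nlinarith [sq_nonneg (‖φ t‖ - c)]
  rw [intervalIntegral.integral_add (h2.sub (h1.norm.const_mul _)) (by simp),
    intervalIntegral.integral_sub h2 (h1.norm.const_mul _),
    intervalIntegral.integral_const_mul, intervalIntegral.integral_const, smul_eq_mul] at h3
  have h4 : (b - a) * c = m := by simp only [c]; field_simp
  have h5 : m ^ 2 ≤ (b - a) * ∫ t in a..b, ‖φ t‖ ^ 2 := by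
    have := mul_nonneg hpos.le h3
    change 0 ≤ (b - a) * ((∫ t in a..b, ‖φ t‖ ^ 2) - 2 * c * m + (b - a) * c ^ 2) at this
    nlinarith
  exact (pow_le_pow_left₀ (norm_nonneg _) hm 2).trans h5

/-- An admissible state moves by at most the order of the square root of the elapsed time. -/
theorem IsAdmissible.norm_sub_sq_le (h : P.IsAdmissible t₀ y₀ u y) (ht₀ : t₀ ∈ Icc 0 P.T)
    {L : NNReal} (hL : ∀ t ∈ Icc 0 P.T, ∀ x ∈ closure P.Ω, ‖P.f t x‖ ≤ L) {s : ℝ}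
    (hs : s ∈ Icc t₀ P.T) :
    ‖y s - y₀‖ ^ 2 ≤ 2 * L ^ 2 * (s - t₀) ^ 2
      + 2 * ‖P.B‖ ^ 2 * ((s - t₀) * ∫ t in t₀..s, ‖u t‖ ^ 2) := by
  have e := h.sub_eq ht₀.1 le_rfl hs.1 hs.2
  rw [h.init ht₀.2] at e
  rw [e, add_sub_cancel_left]
  have h1 : ‖∫ r in t₀..s, P.f r (y r)‖ ≤ L * (s - t₀) := by
    refine (intervalIntegral.norm_integral_le_of_norm_le_const (C := L) fun r hr => ?_).trans_eq
      (by rw [abs_of_nonneg (sub_nonneg.2 hs.1)])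
    rw [uIoc_of_le hs.1] at hr
    exact hL r ⟨ht₀.1.trans hr.1.le, hr.2.trans hs.2⟩ _
      (h.mem_closure r ⟨hr.1.le, hr.2.trans hs.2⟩)
  have h2 : ‖P.B (∫ r in t₀..s, u r)‖ ^ 2
      ≤ ‖P.B‖ ^ 2 * ((s - t₀) * ∫ t in t₀..s, ‖u t‖ ^ 2) := by
    refine (pow_le_pow_left₀ (norm_nonneg _) (P.B.le_opNorm _) 2).trans ?_
    rw [mul_pow]
    gcongr
    exact norm_intervalIntegral_sq_le hs.1 (h.intervalIntegrable_control le_rfl hs.1 hs.2)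
      (h.intervalIntegrable_control_sq le_rfl hs.1 hs.2)
  have h3 := pow_le_pow_left₀ (norm_nonneg _) h1 2
  have h4 := pow_le_pow_left₀ (norm_nonneg _)
    (norm_add_le (∫ r in t₀..s, P.f r (y r)) (P.B (∫ r in t₀..s, u r))) 2
  rw [mul_pow] at h3
  nlinarith [sq_nonneg (‖∫ r in t₀..s, P.f r (y r)‖ - ‖P.B (∫ r in t₀..s, u r)‖)]

/-! ### The value function -/

variable (P) in
/-- `V` is finite on `[0,T] × Ω` and coincides with the value function there. -/
def IsValue (V : ℝ → Eucl d → ℝ) : Prop :=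
  ∀ t₀ ∈ Icc 0 P.T, ∀ y₀ ∈ P.Ω, (V t₀ y₀ : EReal) = P.valueFn t₀ y₀

theorem IsValue.le_cost (hV : P.IsValue V) (ht₀ : t₀ ∈ Icc 0 P.T) (hy₀ : y₀ ∈ P.Ω)
    (h : P.IsAdmissible t₀ y₀ u y) : V t₀ y₀ ≤ P.cost t₀ u y := by
  have : P.valueFn t₀ y₀ ≤ (P.cost t₀ u y : EReal) :=
    (iInf_le _ u).trans ((iInf_le _ y).trans (iInf_le _ h))
  rw [← hV t₀ ht₀ y₀ hy₀] at this
  exact_mod_cast this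

theorem IsValue.exists_cost_lt (hV : P.IsValue V) (ht₀ : t₀ ∈ Icc 0 P.T) (hy₀ : y₀ ∈ P.Ω)
    {ε : ℝ} (hε : 0 < ε) : ∃ u y, P.IsAdmissible t₀ y₀ u y ∧ P.cost t₀ u y < V t₀ y₀ + ε := by
  have : P.valueFn t₀ y₀ < ((V t₀ y₀ + ε : ℝ) : EReal) := by
    rw [← hV t₀ ht₀ y₀ hy₀]
    exact_mod_cast lt_add_of_pos_right _ hε
  simp only [valueFn, iInf_lt_iff] at this
  obtain ⟨u, y, h, hlt⟩ := this
  exact ⟨u, y, h, by exact_mod_cast hlt⟩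

theorem IsValue.g_le (hV : P.IsValue V) (hy₀ : y₀ ∈ P.Ω) : P.g y₀ ≤ V P.T y₀ := by
  have hT : P.T ∈ Icc 0 P.T := right_mem_Icc.2 P.T_pos.le
  refine le_of_forall_pos_le_add fun ε hε => ?_
  obtain ⟨u, y, h, hlt⟩ := hV.exists_cost_lt hT hy₀ hε
  rw [cost, intervalIntegral.integral_same, zero_add, h.init le_rfl] at hlt
  exact hlt.le

theorem Solvable.isAdmissible (h : P.Solvable v) (ht₀ : t₀ ∈ Icc 0 P.T) (hy₀ : y₀ ∈ P.ω) :
    P.IsAdmissible t₀ y₀ (P.closedLoopControl v t₀ y₀) (P.flow v t₀ y₀) := by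
  have hf := h.isClosedLoop_flow ht₀ hy₀
  have hyc : ContinuousOn (P.flow v t₀ y₀) (Icc t₀ P.T) := fun t ht =>
    (hf.hasDeriv t ht).continuousWithinAt
  have hgr : ContinuousOn (fun t => (t, P.flow v t₀ y₀ t)) (Icc t₀ P.T) :=
    continuousOn_id.prodMk hyc
  have hmaps : MapsTo (fun t => (t, P.flow v t₀ y₀ t)) (Icc t₀ P.T)
      (Icc 0 P.T ×ˢ closure P.Ω) := fun t ht => ⟨⟨ht₀.1.trans ht.1, ht.2⟩, hf.mem_closure t ht⟩
  have hv : MemCTC P.T (closure P.Ω) 1 v := h.1.of_le one_le_two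
  have hUc := (continuousOn_feedback hv).comp hgr hmaps
  have huc : ContinuousOn (P.closedLoopControl v t₀ y₀) (Icc t₀ P.T) :=
    hUc.congr fun _ _ => rfl
  refine ⟨?_, hyc, hf.mem_closure, fun t ht => ?_⟩
  · obtain ⟨C, hC⟩ := isCompact_Icc.exists_bound_of_continuousOn huc
    refine MemLp.of_bound ((huc.mono Ioo_subset_Icc_self).aestronglyMeasurable
      measurableSet_Ioo) C ?_
    filter_upwards [ae_restrict_mem measurableSet_Ioo] with t ht using hC t (Ioo_subset_Icc_self ht)
  · have hFc' := (continuousOn_closedLoopField hv).comp hgr hmaps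
    have hFc : ContinuousOn (fun t => P.closedLoopField v t (P.flow v t₀ y₀ t)) (Icc t₀ P.T) :=
      hFc'.congr fun _ _ => rfl
    have := intervalIntegral.integral_eq_sub_of_hasDeriv_right_of_le ht.1
      (hyc.mono (Icc_subset_Icc_right ht.2))
      (fun s hs => ((hf.hasDeriv s ⟨hs.1.le, hs.2.le.trans ht.2⟩).mono_of_mem_nhdsWithin
        (Icc_mem_nhdsGE_of_mem ⟨hs.1.le, hs.2.trans_le ht.2⟩)).mono Ioi_subset_Ici_self)
      ((hFc.mono (by rw [uIcc_of_le ht.1]; exact Icc_subset_Icc_right ht.2)).intervalIntegrable)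
    rw [hf.init] at this
    have e : ∫ s in t₀..t, P.f s (P.flow v t₀ y₀ s) + P.B (P.closedLoopControl v t₀ y₀ s)
        = P.flow v t₀ y₀ t - y₀ := this
    rw [e, add_sub_cancel]

theorem IsValue.le_closedLoopCost (hV : P.IsValue V) (h : P.Solvable v) (ht₀ : t₀ ∈ Icc 0 P.T)
    (hy₀ : y₀ ∈ P.ω) : V t₀ y₀ ≤ P.closedLoopCost v t₀ y₀ :=
  hV.le_cost ht₀ (P.ω_subset_Ω hy₀) (h.isAdmissible ht₀ hy₀)

end ControlProblem

namespace ControlProblem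

variable {d M : ℕ} {P : ControlProblem d M} {v V : ℝ → Eucl d → ℝ}

/-! ### The Hamilton-Jacobi-Bellman inequality -/

theorem neg_le_add_mul_of_sq_le {c h e a b m : ℝ} (hc : 0 < c) (hh : 0 < h)
    (hae : a ^ 2 ≤ h * e) (hm : -(b * a) ≤ m) : -(h * (b ^ 2 / (4 * c))) ≤ c * e + m := by
  have h1 : 0 ≤ (2 * c * a - h * b) ^ 2 := sq_nonneg _
  have h2 : -(h * (b ^ 2 / (4 * c))) = -(h * b ^ 2) / (4 * c) := by ring
  rw [h2, div_le_iff₀ (by positivity)]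
  have h3 : 4 * c ^ 2 * a ^ 2 ≤ 4 * c ^ 2 * (h * e) := by gcongr
  have h4 : h * (-(h * b ^ 2)) ≤ h * ((c * e + m) * (4 * c)) := by
    have : 4 * c * h * -(b * a) ≤ 4 * c * h * m := by gcongr
    nlinarith
  exact le_of_mul_le_mul_left h4 hh

/-- One half of the Hamilton-Jacobi-Bellman equation, for the forward difference quotient of `V` in
time. By the dynamic programming principle, an almost optimal pair from `(t, x)` pays for the
decrease of `V` up to time `s`; expanding `V(s, ·)` at `x` to first order and minimizing over the
mean of the control gives the Hamiltonian. The quadratic remainder of the expansion is harmless as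
the square of the displacement is at most `s - t` times the energy of the control. -/
theorem IsValue.eventually_mul_le_sub (hV : P.IsValue V) (hV2 : MemCTC P.T (closure P.Ω) 2 V)
    {t : ℝ} (ht : t ∈ Ico 0 P.T) {x : Eucl d} (hx : x ∈ P.Ω) {η : ℝ} (hη : 0 < η) :
    ∀ᶠ s in 𝓝[>] t, (s - t) * (P.ℓ t x + inner ℝ (gradientWithin (V t) (closure P.Ω) x) (P.f t x)
      - ‖ContinuousLinearMap.adjoint P.B (gradientWithin (V t) (closure P.Ω) x)‖ ^ 2 / (2 * P.β)
      - η) ≤ V t x - V s x := by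
  have hβ := P.β_pos
  have ht' : t ∈ Icc 0 P.T := Ico_subset_Icc_self ht
  have hxK : x ∈ closure P.Ω := subset_closure hx
  obtain ⟨C, hC0, hC⟩ := hV2.exists_abs_sub_le_sq P.isCompact_closure_Ω P.uniqueDiffOn_closure_Ω
    P.convex_closure_Ω
  obtain ⟨L, hL⟩ := P.exists_bound P.f_mem.continuousOn
  set grad : ℝ → Eucl d → Eucl d := fun t y => gradientWithin (V t) (closure P.Ω) y
  set G := P.extend grad
  have hG : Continuous fun p : ℝ × Eucl d => G p.1 p.2 :=
    P.continuous_extend (hV2.continuousOn_gradientWithin P.uniqueDiffOn_closure_Ω one_le_two)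
  have hGeq : ∀ s ∈ Icc 0 P.T, G s x = grad s x := fun s hs => P.extend_eq _ hs hxK
  have hGx : Continuous fun s => G s x := hG.comp (continuous_id.prodMk continuous_const)
  have hℓ := P.continuous_extend P.ℓ_mem.continuousOn
  have hf := P.continuous_extend P.f_mem.continuousOn
  set H₀ := P.ℓ t x + inner ℝ (grad t x) (P.f t x)
  set b : ℝ → ℝ := fun s => ‖ContinuousLinearMap.adjoint P.B (G s x)‖ with hb
  have hbc : Continuous b := ((ContinuousLinearMap.adjoint P.B).continuous.comp hGx).norm
  -- the running terms are close to their values at `(t, x)`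
  have hΨ : Continuous fun q : ℝ × ℝ × Eucl d =>
      P.extend P.ℓ q.2.1 q.2.2 + inner ℝ (G q.1 x) (P.extend P.f q.2.1 q.2.2) :=
    (hℓ.comp continuous_snd).add ((hGx.comp continuous_fst).inner (hf.comp continuous_snd))
  obtain ⟨δ₁, hδ₁, h₁⟩ := Metric.continuousAt_iff.1 (hΨ.continuousAt (x := (t, t, x))) (η / 2)
    (half_pos hη)
  obtain ⟨δ₂, hδ₂, h₂⟩ := Metric.isOpen_iff.1 P.isOpen_Ω x hx
  set δ := min δ₁ δ₂
  have hδ : 0 < δ := lt_min hδ₁ hδ₂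
  set E₀ := 2 / P.β * (V t x + 1) with hE₀
  have hlim : ∀ {φ : ℝ → ℝ} {c : ℝ}, ContinuousAt φ t → φ t < c → ∀ᶠ s in 𝓝[>] t, φ s < c :=
    fun hφ h => (hφ.eventually_lt_const h).filter_mono nhdsWithin_le_nhds
  have hβ4 : ContinuousAt (fun s => b s ^ 2 / (4 * (P.β / 2 - 2 * C * ‖P.B‖ ^ 2 * (s - t)))
      + 2 * C * L ^ 2 * (s - t) + (s - t)) t := by
    refine ContinuousAt.add (ContinuousAt.add ?_ (by fun_prop)) (by fun_prop)
    refine ContinuousAt.div (by fun_prop) (by fun_prop) ?_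
    simp [hβ.ne']
  have e1 : ∀ᶠ s in 𝓝[>] t, s < P.T := hlim continuousAt_id ht.2
  have e2 : ∀ᶠ s in 𝓝[>] t, s < t + 1 := hlim continuousAt_id (by simp)
  have e3 : ∀ᶠ s in 𝓝[>] t, s < t + δ := hlim continuousAt_id (by simpa using hδ)
  have e4 : ∀ᶠ s in 𝓝[>] t, 2 * (L : ℝ) ^ 2 * (s - t) ^ 2 + 2 * ‖P.B‖ ^ 2 * ((s - t) * E₀)
      < δ ^ 2 := hlim (by fun_prop) (by simpa using by positivity)
  have e5 : ∀ᶠ s in 𝓝[>] t, 2 * C * ‖P.B‖ ^ 2 * (s - t) < P.β / 2 :=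
    hlim (by fun_prop) (by simpa using hβ)
  have e6 : ∀ᶠ s in 𝓝[>] t, b s ^ 2 / (4 * (P.β / 2 - 2 * C * ‖P.B‖ ^ 2 * (s - t)))
      + 2 * C * L ^ 2 * (s - t) + (s - t) < b t ^ 2 / (2 * P.β) + η / 2 := by
    refine hlim hβ4 ?_
    have : 4 * (P.β / 2) = 2 * P.β := by ring
    simp only [sub_self, mul_zero, sub_zero, add_zero, this]
    linarith
  filter_upwards [e1, e2, e3, e4, e5, e6, self_mem_nhdsWithin] with s hsT hs1 hsδ hsE hsC hsR hts
  have hts : t < s := hts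
  have hh : 0 < s - t := sub_pos.2 hts
  have hs' : s ∈ Icc 0 P.T := ⟨ht.1.trans hts.le, hsT.le⟩
  have hsm : s ∈ Icc t P.T := ⟨hts.le, hsT.le⟩
  obtain ⟨u, y, hadm, hcost⟩ := hV.exists_cost_lt ht' hx (pow_pos hh 2)
  have hcost1 : P.cost t u y ≤ V t x + 1 := by nlinarith
  -- the state stays close to `x` on `[t, s]`
  have hnear : ∀ r ∈ Icc t s, ‖y r - x‖ < δ := by
    intro r hr
    have hrT : r ∈ Icc t P.T := ⟨hr.1, hr.2.trans hsT.le⟩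
    have h3 := hadm.norm_sub_sq_le ht' hL hrT
    have h4 : ∫ r in t..r, ‖u r‖ ^ 2 ≤ E₀ := by
      have := (hadm.energy_le ht' hrT).trans hcost1
      have h5 : E₀ = (V t x + 1) / (P.β / 2) := by rw [hE₀]; field_simp
      rw [h5, le_div_iff₀ (by positivity)]
      linarith
    have h5 : 0 ≤ ∫ r in t..r, ‖u r‖ ^ 2 :=
      intervalIntegral.integral_nonneg hr.1 fun _ _ => sq_nonneg _
    refine lt_of_pow_lt_pow_left₀ 2 hδ.le (lt_of_le_of_lt h3 (lt_of_le_of_lt ?_ hsE))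
    have h6 : 0 ≤ r - t := sub_nonneg.2 hr.1
    have h7 : r - t ≤ s - t := sub_le_sub_right hr.2 _
    gcongr
  have hys : y s ∈ P.Ω := h₂ (by
    rw [mem_ball_iff_norm]; exact (hnear s (right_mem_Icc.2 hts.le)).trans_le (min_le_right _ _))
  have hdp := hV.le_cost hs' hys (hadm.restrict ht.1 hts.le)
  have hsplit := hadm.cost_eq ht.1 hts.le hsT.le
  have hexp := neg_le_of_abs_le (hC s hs' x hxK (y s) (subset_closure hys))
  have hΔ := hadm.norm_sub_sq_le ht' hL hsm
  have hcs := norm_intervalIntegral_sq_le hts.le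
    (hadm.intervalIntegrable_control le_rfl hts.le hsT.le)
    (hadm.intervalIntegrable_control_sq le_rfl hts.le hsT.le)
  have hsub := hadm.sub_eq ht.1 le_rfl hts.le hsT.le
  rw [hadm.init ht'.2] at hsub
  have hsub' : y s - x = (∫ r in t..s, P.f r (y r)) + P.B (∫ r in t..s, u r) := by
    rw [hsub]; abel
  set e := ∫ r in t..s, ‖u r‖ ^ 2
  set a := ∫ r in t..s, u r
  have hfi := hadm.intervalIntegrable_comp ht.1 P.f_mem.continuousOn le_rfl hts.le hsT.le
  have hℓi := hadm.intervalIntegrable_comp ht.1 P.ℓ_mem.continuousOn le_rfl hts.le hsT.le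
  have hin : inner ℝ (grad s x) (y s - x) = (∫ r in t..s, inner ℝ (grad s x) (P.f r (y r)))
      + inner ℝ (ContinuousLinearMap.adjoint P.B (G s x)) a := by
    rw [hsub', inner_add_right, hGeq s hs', ContinuousLinearMap.adjoint_inner_left]
    congr 1
    exact ((innerSL ℝ (grad s x)).intervalIntegral_comp_comm hfi).symm
  have hfi' : IntervalIntegrable (fun r => inner ℝ (grad s x) (P.f r (y r))) volume t s := by
    rw [intervalIntegrable_iff] at hfi ⊢
    exact (innerSL ℝ (grad s x)).integrable_comp hfi
  have hrun : (s - t) * (H₀ - η / 2)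
      ≤ (∫ r in t..s, P.ℓ r (y r)) + ∫ r in t..s, inner ℝ (grad s x) (P.f r (y r)) := by
    rw [← intervalIntegral.integral_add hℓi hfi', ← smul_eq_mul,
      ← intervalIntegral.integral_const]
    refine intervalIntegral.integral_mono_on hts.le (by simp) (hℓi.add hfi') fun r hr => ?_
    have hr' : r ∈ Icc 0 P.T := ⟨ht.1.trans hr.1, hr.2.trans hsT.le⟩
    have hyr := hadm.mem_closure r ⟨hr.1, hr.2.trans hsT.le⟩
    have h3 := @h₁ (s, r, y r) (by
      rw [Prod.dist_eq, Prod.dist_eq, Real.dist_eq, Real.dist_eq, dist_eq_norm,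
        abs_of_pos hh, abs_of_nonneg (sub_nonneg.2 hr.1)]
      have hδ' : δ ≤ δ₁ := min_le_left _ _
      have := hnear r hr
      exact max_lt (by linarith) (max_lt (by linarith [hr.2]) (by linarith)))
    rw [Real.dist_eq] at h3
    dsimp only at h3
    rw [P.extend_eq _ hr' hyr, P.extend_eq _ hr' hyr, hGeq s hs', P.extend_eq _ ht' hxK,
      P.extend_eq _ ht' hxK, hGeq t ht'] at h3
    have := (abs_lt.1 h3).1
    linarith
  have hquad := neg_le_add_mul_of_sq_le (c := P.β / 2 - 2 * C * ‖P.B‖ ^ 2 * (s - t)) (b := b s)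
    (m := inner ℝ (ContinuousLinearMap.adjoint P.B (G s x)) a)
    (sub_pos.2 hsC) hh hcs (neg_le_of_abs_le (abs_real_inner_le_norm _ _))
  have hbt : b t = ‖ContinuousLinearMap.adjoint P.B (grad t x)‖ := by
    simp only [hb, hGeq t ht']
  rw [← hbt]
  have hRs := mul_lt_mul_of_pos_left hsR hh
  have hCΔ := mul_le_mul_of_nonneg_left hΔ hC0
  rw [hin] at hexp
  linarith

/-! ### Verification -/

/-- The integrand of the verification identity: the running cost of the feedback `U_v` minus the
penalty for its deviation from the feedback `U_V` of the value function. -/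
theorem inner_gradientWithin_closedLoopField (v V : ℝ → Eucl d → ℝ) (t : ℝ) (x : Eucl d) :
    P.ℓ t x + inner ℝ (gradientWithin (V t) (closure P.Ω) x) (P.f t x)
      - ‖ContinuousLinearMap.adjoint P.B (gradientWithin (V t) (closure P.Ω) x)‖ ^ 2 / (2 * P.β)
      - inner ℝ (gradientWithin (V t) (closure P.Ω) x) (P.closedLoopField v t x)
      = P.runCost v t x - P.β / 2 * ‖P.feedback v t x - P.feedback V t x‖ ^ 2 := by
  have hβ := P.β_pos
  set b := ContinuousLinearMap.adjoint P.B (gradientWithin (V t) (closure P.Ω) x) with hb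
  have h1 : inner ℝ (gradientWithin (V t) (closure P.Ω) x) (P.closedLoopField v t x)
      = inner ℝ (gradientWithin (V t) (closure P.Ω) x) (P.f t x)
        + inner ℝ b (P.feedback v t x) := by
    rw [closedLoopField, inner_add_right, hb, ContinuousLinearMap.adjoint_inner_left]
  have h2 : P.feedback V t x = -((1 / P.β) • b) := rfl
  rw [h1, runCost, h2, sub_neg_eq_add, norm_add_sq_real, norm_smul, inner_smul_right,
    real_inner_comm b, Real.norm_eq_abs, abs_of_pos (one_div_pos.2 hβ)]
  field_simp
  ring

/-- Along a closed loop trajectory in `Ω`, the cost exceeds the decrease of `V` at most by the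
deviation of the feedback from that of `V`. -/
theorem IsValue.verification (hV : P.IsValue V) (hV2 : MemCTC P.T (closure P.Ω) 2 V)
    (hv : MemCTC P.T (closure P.Ω) 2 v) {p : ℝ × Eucl d} (hp : p.1 ∈ Icc 0 P.T)
    (hΩ : ∀ t ∈ Icc p.1 P.T, P.extTraj v p t ∈ P.Ω) :
    V P.T (P.extTraj v p P.T) ≤ V p.1 p.2 - ∫ t in p.1..P.T,
      (P.extend (P.runCost v) t (P.extTraj v p t) - P.β / 2 *
        ‖P.extend (P.feedback v) t (P.extTraj v p t)
          - P.extend (P.feedback V) t (P.extTraj v p t)‖ ^ 2) := by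
  have hz : Continuous fun t => P.extTraj v p t :=
    (continuous_extTraj hv).comp (continuous_const.prodMk continuous_id)
  have hgr : Continuous fun t => (t, P.extTraj v p t) := continuous_id.prodMk hz
  set z := P.extTraj v p with hzdef
  set k : ℝ → ℝ := fun t => P.extend (P.runCost v) t (z t) - P.β / 2 *
    ‖P.extend (P.feedback v) t (z t) - P.extend (P.feedback V) t (z t)‖ ^ 2 with hk
  have hv1 : MemCTC P.T (closure P.Ω) 1 v := hv.of_le one_le_two
  have hV1 : MemCTC P.T (closure P.Ω) 1 V := hV2.of_le one_le_two
  have hk1 := (P.continuous_extend (continuousOn_runCost hv1)).comp hgr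
  have hk2 := (P.continuous_extend (continuousOn_feedback hv1)).comp hgr
  have hk3 := (P.continuous_extend (continuousOn_feedback hV1)).comp hgr
  have hkc : Continuous k := hk1.sub (continuous_const.mul ((hk2.sub hk3).norm.pow 2))
  have hspec := extTraj_spec hv p
  rw [P.clip_eq hp] at hspec
  have hmem : ∀ {t}, t ∈ Icc p.1 P.T → (t, z t) ∈ Icc 0 P.T ×ˢ closure P.Ω := fun ht =>
    ⟨⟨hp.1.trans ht.1, ht.2⟩, subset_closure (hΩ _ ht)⟩
  have hVz : ContinuousOn (fun t => V t (z t)) (Icc p.1 P.T) := by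
    have := hV2.continuousOn.comp hgr.continuousOn (s := Icc p.1 P.T) fun t ht => hmem ht
    exact this.congr fun _ _ => rfl
  have hB : ∀ x, HasDerivAt (fun t => V p.1 p.2 - ∫ s in p.1..t, k s) (-k x) x := fun x =>
    (intervalIntegral.integral_hasDerivAt_right (hkc.intervalIntegrable _ _)
      (hkc.stronglyMeasurableAtFilter _ _) hkc.continuousAt).const_sub _
  refine image_le_of_liminf_slope_right_le_deriv_boundary (B' := fun t => -k t) hVz
    (by simp [hzdef, hspec.1])
    (fun t _ => (hB t).continuousAt.continuousWithinAt) (fun t _ => (hB t).hasDerivWithinAt)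
    (fun t ht r hr => Eventually.frequently ?_) (right_mem_Icc.2 hp.2)
  have ht' : t ∈ Icc p.1 P.T := Ico_subset_Icc_self ht
  have ht0 : t ∈ Ico 0 P.T := ⟨hp.1.trans ht.1, ht.2⟩
  set x := z t with hx
  have hxΩ : x ∈ P.Ω := hΩ t ht'
  have hxK : x ∈ closure P.Ω := subset_closure hxΩ
  obtain ⟨C, hC0, hC⟩ := hV2.exists_abs_sub_le_sq P.isCompact_closure_Ω P.uniqueDiffOn_closure_Ω
    P.convex_closure_Ω
  set grad : ℝ → Eucl d → Eucl d := fun t y => gradientWithin (V t) (closure P.Ω) y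
  have hG : Continuous fun p : ℝ × Eucl d => P.extend grad p.1 p.2 :=
    P.continuous_extend (hV2.continuousOn_gradientWithin P.uniqueDiffOn_closure_Ω one_le_two)
  have hGx : Continuous fun s => P.extend grad s x :=
    hG.comp (continuous_id.prodMk continuous_const)
  set F := P.closedLoopField v t x
  have hslope : Tendsto (slope z t) (𝓝[>] t) (𝓝 F) := by
    have h := hspec.2 t ht'
    rw [P.extend_eq _ (Ico_subset_Icc_self ht0) hxK] at h
    have h' := (h.mono_of_mem_nhdsWithin (Icc_mem_nhdsGE_of_mem ht)).mono Ioi_subset_Ici_self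
    rwa [hasDerivWithinAt_iff_tendsto_slope' (by simp)] at h'
  have hzt : Tendsto z (𝓝[>] t) (𝓝 x) := hz.continuousAt.mono_left nhdsWithin_le_nhds
  have hGt : Tendsto (fun s => P.extend grad s x) (𝓝[>] t) (𝓝 (grad t x)) := by
    have := hGx.continuousAt (x := t) |>.mono_left (nhdsWithin_le_nhds (s := Ioi t))
    simp only at this
    rwa [P.extend_eq _ (Ico_subset_Icc_self ht0) hxK] at this
  -- first order change of `V(s, ·)` along the trajectory
  have hlim : Tendsto (fun s => inner ℝ (P.extend grad s x) (slope z t s)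
      + C * (‖z s - x‖ * ‖slope z t s‖)) (𝓝[>] t) (𝓝 (inner ℝ (grad t x) F)) := by
    have h1 := (hGt.inner hslope).add (((hzt.sub_const x).norm.mul hslope.norm).const_mul C)
    simpa using h1
  have hid := inner_gradientWithin_closedLoopField (P := P) v V t x
  have hkt : k t = P.runCost v t x - P.β / 2 * ‖P.feedback v t x - P.feedback V t x‖ ^ 2 := by
    simp only [hk]
    rw [← hx, P.extend_eq _ (Ico_subset_Icc_self ht0) hxK,
      P.extend_eq _ (Ico_subset_Icc_self ht0) hxK, P.extend_eq _ (Ico_subset_Icc_self ht0) hxK]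
  rw [← hkt] at hid
  set η := (r + k t) / 2 with hη
  have hη0 : 0 < η := by rw [hη]; linarith
  filter_upwards [hV.eventually_mul_le_sub hV2 ht0 hxΩ hη0,
    hlim.eventually_lt_const (lt_add_of_pos_right _ hη0), self_mem_nhdsWithin,
    nhdsWithin_le_nhds (Iio_mem_nhds ht.2)] with s h1 h2 h3 h4
  have h3 : t < s := h3
  have h4 : s < P.T := h4
  have hh : 0 < s - t := sub_pos.2 h3
  have hs : s ∈ Icc p.1 P.T := ⟨ht.1.trans h3.le, h4.le⟩
  have hs0 : s ∈ Icc 0 P.T := ⟨hp.1.trans hs.1, hs.2⟩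
  have h5 := le_of_abs_le (hC s hs0 x hxK (z s) (hmem hs).2)
  have h6 : z s - x = (s - t) • slope z t s := by
    rw [hx, slope, vsub_eq_sub, smul_smul, mul_inv_cancel₀ hh.ne', one_smul]
  have h7 : ‖z s - x‖ ^ 2 = (s - t) * (‖z s - x‖ * ‖slope z t s‖) := by
    rw [sq]
    nth_rewrite 2 [h6]
    rw [norm_smul, Real.norm_eq_abs, abs_of_pos hh]; ring
  have h8 : inner ℝ (grad s x) (z s - x) = (s - t) * inner ℝ (grad s x) (slope z t s) := by
    rw [h6, inner_smul_right]
  rw [P.extend_eq _ hs0 hxK] at h2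
  rw [h7] at h5
  have h9 := mul_lt_mul_of_pos_left h2 hh
  rw [slope_def_field, div_lt_iff₀ hh]
  change inner ℝ (grad s x) (z s - x) = _ at h8
  have h5' : V s (z s) - V s x - inner ℝ (grad s x) (z s - x)
      ≤ C * ((s - t) * (‖z s - x‖ * ‖slope z t s‖)) := h5
  rw [h8] at h5'
  have h10 : k t + (inner ℝ (grad t x) F) = P.ℓ t x + inner ℝ (grad t x) (P.f t x)
      - ‖ContinuousLinearMap.adjoint P.B (grad t x)‖ ^ 2 / (2 * P.β) := by
    linarith
  have h11 : (s - t) * (k t + inner ℝ (grad t x) F - η) ≤ V t x - V s x := by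
    rw [h10]; exact h1
  have h12 : r = 2 * η - k t := by rw [hη]; ring
  rw [h12]
  linarith

/-- For `v ∈ D`, the closed loop cost exceeds the value function at most by a quadratic expression
in the `C¹` distance of `v` and `V`. -/
theorem IsValue.extCost_le (hV : P.IsValue V) (hV2 : MemCTC P.T (closure P.Ω) 2 V)
    (hv : v ∈ P.setD) {p : ℝ × Eucl d} (hp : p ∈ P.initSet) :
    P.extCost v p ≤ V p.1 p.2 + P.T * (P.β / 2) *
      (‖P.B‖ / P.β * ctcNorm P.T (closure P.Ω) 1 (v - V)) ^ 2 := by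
  have hp1 : p.1 ∈ Icc 0 P.T := Ioo_subset_Icc_self hp.1
  have hΩ : ∀ t, P.extTraj v p t ∈ P.Ω := fun t =>
    hv.2.2 (extTraj_mem_closure_reach (solvable_of_mem_setD hv) hp1 hp.2 t)
  have h1 := hV.verification hV2 hv.1 hp1 fun t _ => hΩ t
  have h2 := hV.g_le (hΩ P.T)
  have hv1 : MemCTC P.T (closure P.Ω) 1 v := hv.1.of_le one_le_two
  have hV1 : MemCTC P.T (closure P.Ω) 1 V := hV2.of_le one_le_two
  have hgr : Continuous fun t => (t, P.extTraj v p t) := continuous_id.prodMk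
    ((continuous_extTraj hv.1).comp (continuous_const.prodMk continuous_id))
  have hk1 := (P.continuous_extend (continuousOn_runCost hv1)).comp hgr
  have hk2 := (P.continuous_extend (continuousOn_feedback hv1)).comp hgr
  have hk3 := (P.continuous_extend (continuousOn_feedback hV1)).comp hgr
  have hk4 := continuous_const (y := P.β / 2) |>.mul ((hk2.sub hk3).norm.pow 2)
  have e := intervalIntegral.integral_sub (μ := volume) (hk1.intervalIntegrable p.1 P.T)
    (hk4.intervalIntegrable p.1 P.T)
  simp only [Function.comp_apply, Pi.mul_apply, Pi.sub_apply, Pi.pow_apply] at e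
  rw [e] at h1
  have hβ := P.β_pos
  set c := P.β / 2 * (‖P.B‖ / P.β * ctcNorm P.T (closure P.Ω) 1 (v - V)) ^ 2 with hc
  have hc0 : 0 ≤ c := by positivity
  have h3 : ∫ t in p.1..P.T, P.β / 2 * ‖P.extend (P.feedback v) t (P.extTraj v p t)
      - P.extend (P.feedback V) t (P.extTraj v p t)‖ ^ 2 ≤ P.T * c := by
    calc _ ≤ ∫ t in p.1..P.T, c := by
          refine intervalIntegral.integral_mono_on hp1.2 (hk4.intervalIntegrable _ _) (by simp)
            fun t _ => ?_
          have := norm_feedback_sub_le hv1 hV1 (P.clip_mem t) (P.proj_mem (P.extTraj v p t))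
          rw [hc]
          gcongr
          exact this
      _ = (P.T - p.1) * c := by simp
      _ ≤ P.T * c := by gcongr; linarith [hp1.1]
  rw [extCost, P.proj_eq (subset_closure (hΩ P.T))]
  have h4 : P.T * (P.β / 2) * (‖P.B‖ / P.β * ctcNorm P.T (closure P.Ω) 1 (v - V)) ^ 2
      = P.T * c := by rw [hc]; ring
  rw [h4]
  linarith

end ControlProblem

/-! ### Weak and strong convergence in `L²` -/

section WeakConvergence

variable {M : ℕ} {a b : ℝ} {u : ℕ → ℝ → Eucl M} {uLim : ℝ → Eucl M}

theorem inner_toLp_eq {f g : ℝ → Eucl M} {μ : Measure ℝ} (hf : MemLp f 2 μ) (hg : MemLp g 2 μ) :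
    inner ℝ (hf.toLp f) (hg.toLp g) = ∫ t, inner ℝ (f t) (g t) ∂μ := by
  rw [L2.inner_def]
  refine integral_congr_ae ?_
  filter_upwards [hf.coeFn_toLp, hg.coeFn_toLp] with t h1 h2
  rw [h1, h2]

theorem norm_toLp_sq {f : ℝ → Eucl M} {μ : Measure ℝ} (hf : MemLp f 2 μ) :
    ‖hf.toLp f‖ ^ 2 = ∫ t, ‖f t‖ ^ 2 ∂μ := by
  rw [← real_inner_self_eq_norm_sq, inner_toLp_eq]
  simp only [real_inner_self_eq_norm_sq]

/-- Bounded sequences in `L²` have weakly convergent subsequences. -/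
theorem exists_weakConvL2_subseq (hu : ∀ n, MemLp (u n) 2 (volume.restrict (Ioo a b))) {R : ℝ}
    (hR : ∀ n, ∫ t in Ioo a b, ‖u n t‖ ^ 2 ≤ R) :
    ∃ ρ : ℕ → ℕ, StrictMono ρ ∧ ∃ uLim, WeakConvL2 a b (fun n => u (ρ n)) uLim := by
  set H := Lp (Eucl M) 2 (volume.restrict (Ioo a b))
  set D := InnerProductSpace.toDual ℝ H
  have hball : ∀ n, StrongDual.toWeakDual (D ((hu n).toLp (u n))) ∈
      WeakDual.toStrongDual ⁻¹' Metric.closedBall (0 : StrongDual ℝ H) (Real.sqrt R) := by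
    intro n
    change D ((hu n).toLp (u n)) ∈ Metric.closedBall (0 : StrongDual ℝ H) (Real.sqrt R)
    rw [mem_closedBall_zero_iff, LinearIsometryEquiv.norm_map]
    exact Real.le_sqrt_of_sq_le ((norm_toLp_sq (hu n)).trans_le (hR n))
  have : Fact ((2 : ENNReal) ≠ ⊤) := ⟨ENNReal.ofNat_ne_top⟩
  obtain ⟨φ, -, ρ, hρ, hφ⟩ := WeakDual.isSeqCompact_closedBall ℝ H 0 (Real.sqrt R) hball
  refine ⟨ρ, hρ, (D.symm (WeakDual.toStrongDual φ) : H), Lp.memLp _, fun ψ hψ => ?_⟩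
  have h1 := ((WeakDual.eval_continuous (𝕜 := ℝ) (hψ.toLp ψ)).tendsto φ).comp hφ
  have h2 : φ (hψ.toLp ψ)
      = ∫ t in Ioo a b, inner ℝ ((D.symm (WeakDual.toStrongDual φ) : H) t) (ψ t) := by
    rw [← inner_toLp_eq (Lp.memLp _) hψ, Lp.toLp_coeFn, InnerProductSpace.toDual_symm_apply]
    rfl
  rw [← h2]
  refine h1.congr fun n => ?_
  rw [← inner_toLp_eq (hu (ρ n)) hψ]
  rfl

/-- Weak convergence together with (an upper bound for) the limit of the norms gives strong
convergence. -/
theorem WeakConvL2.strongConvL2 (h : WeakConvL2 a b u uLim)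
    (hu : ∀ n, MemLp (u n) 2 (volume.restrict (Ioo a b))) {c : ℝ}
    (hc : Tendsto (fun n => ∫ t in Ioo a b, ‖u n t‖ ^ 2) atTop (𝓝 c))
    (hle : c ≤ ∫ t in Ioo a b, ‖uLim t‖ ^ 2) :
    StrongConvL2 a b u uLim ∧ ∫ t in Ioo a b, ‖uLim t‖ ^ 2 = c := by
  have h1 : Tendsto (fun n => ‖(hu n).toLp (u n) - h.1.toLp uLim‖ ^ 2) atTop
      (𝓝 (c - ∫ t in Ioo a b, ‖uLim t‖ ^ 2)) := by
    have h2 := h.2 uLim h.1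
    simp only [real_inner_self_eq_norm_sq] at h2
    have h3 := (hc.sub (h2.const_mul 2)).add_const (∫ t in Ioo a b, ‖uLim t‖ ^ 2)
    refine (h3.congr fun n => ?_).trans_eq (by ring_nf)
    rw [norm_sub_sq_real, norm_toLp_sq, norm_toLp_sq, inner_toLp_eq]
  have h2 := ge_of_tendsto' h1 fun n => sq_nonneg _
  have h3 : c - ∫ t in Ioo a b, ‖uLim t‖ ^ 2 = 0 := by linarith
  rw [h3] at h1
  refine ⟨⟨h.1, ?_⟩, by linarith⟩
  have h4 : Tendsto (fun n => ‖(hu n).toLp (u n) - h.1.toLp uLim‖) atTop (𝓝 0) := by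
    have := (Real.continuous_sqrt.tendsto 0).comp h1
    simpa [Function.comp_def] using this
  have h5 := ENNReal.tendsto_ofReal h4
  rw [ENNReal.ofReal_zero] at h5
  refine h5.congr fun n => ?_
  rw [← MemLp.toLp_sub, Lp.norm_toLp, ENNReal.ofReal_toReal ((hu n).sub h.1).2.ne]

/-- Weak convergence implies convergence of the primitives. -/
theorem WeakConvL2.tendsto_intervalIntegral (h : WeakConvL2 a b u uLim)
    (hu : ∀ n, MemLp (u n) 2 (volume.restrict (Ioo a b))) {t : ℝ} (ht : t ∈ Icc a b) :
    Tendsto (fun n => ∫ s in a..t, u n s) atTop (𝓝 (∫ s in a..t, uLim s)) := by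
  have key : ∀ {w : ℝ → Eucl M}, MemLp w 2 (volume.restrict (Ioo a b)) → ∀ c : Eucl M,
      ∫ s in Ioo a b, inner ℝ (w s) ((Ioo a t).indicator (fun _ => c) s)
        = inner ℝ (∫ s in a..t, w s) c := by
    intro w hw c
    have hi : IntegrableOn w (Ioo a t) := IntegrableOn.mono_set (t := Ioo a b)
      (hw.integrable one_le_two) (Ioo_subset_Ioo_right ht.2)
    have e : ∀ s, inner ℝ (w s) ((Ioo a t).indicator (fun _ => c) s)
        = (Ioo a t).indicator (fun s => inner ℝ (w s) c) s := fun s => by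
      by_cases hs : s ∈ Ioo a t <;> simp [hs]
    simp only [e]
    rw [setIntegral_indicator measurableSet_Ioo, inter_eq_right.2 (Ioo_subset_Ioo_right ht.2),
      intervalIntegral.integral_of_le ht.1, integral_Ioc_eq_integral_Ioo, real_inner_comm,
      ← integral_inner hi]
    simp only [real_inner_comm]
  have hc : ∀ c : Eucl M, Tendsto (fun n => inner ℝ (∫ s in a..t, u n s) c) atTop
      (𝓝 (inner ℝ (∫ s in a..t, uLim s) c)) := fun c => by
    have hm : MemLp ((Ioo a t).indicator fun _ => c) 2 (volume.restrict (Ioo a b)) :=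
      (memLp_const c).indicator measurableSet_Ioo
    have := h.2 _ hm
    rw [key h.1] at this
    exact this.congr fun n => key (hu n) c
  have hb := EuclideanSpace.basisFun (Fin M) ℝ
  have hsum : ∀ x : Eucl M, x = ∑ i, (inner ℝ x (hb i)) • hb i := fun x => by
    conv_lhs => rw [← hb.sum_repr' x]
    simp only [real_inner_comm]
  rw [hsum (∫ s in a..t, uLim s)]
  refine (tendsto_finsetSum _ fun i _ => (hc (hb i)).smul_const (hb i)).congr fun n => ?_
  exact (hsum _).symm

end WeakConvergence

/-- An integral form of Grönwall's inequality: if `a ≤ b + K ∫ a`, then the integral of `a` is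
bounded by a multiple of the integral of `b`. -/
theorem integral_le_exp_mul_integral {a b : ℝ → ℝ} {s t K : ℝ} (hst : s ≤ t) (hK : 0 ≤ K)
    (ha : ContinuousOn a (Icc s t)) (hb : ContinuousOn b (Icc s t))
    (hb0 : ∀ x ∈ Icc s t, 0 ≤ b x)
    (h : ∀ x ∈ Icc s t, a x ≤ b x + K * ∫ r in s..x, a r) :
    ∫ r in s..t, a r ≤ Real.exp (K * (t - s)) * ∫ r in s..t, b r := by
  have hint : ∀ {φ : ℝ → ℝ}, ContinuousOn φ (Icc s t) → IntegrableOn φ (uIcc s t) := fun hφ => by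
    rw [uIcc_of_le hst]; exact hφ.integrableOn_Icc
  have hprim : ∀ {φ : ℝ → ℝ}, ContinuousOn φ (Icc s t) →
      ContinuousOn (fun x => ∫ r in s..x, φ r) (Icc s t) := fun hφ => by
    have := intervalIntegral.continuousOn_primitive_interval (hint hφ)
    rwa [uIcc_of_le hst] at this
  have hder : ∀ {φ : ℝ → ℝ}, ContinuousOn φ (Icc s t) → ∀ x ∈ Ioo s t,
      HasDerivAt (fun x => ∫ r in s..x, φ r) (φ x) x := fun {φ} hφ x hx =>
    intervalIntegral.integral_hasDerivAt_right
      (hφ.mono (by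
        rw [uIcc_of_le hx.1.le]
        exact Icc_subset_Icc_right hx.2.le)).intervalIntegrable
      ((hφ.mono Ioo_subset_Icc_self).stronglyMeasurableAtFilter isOpen_Ioo x hx)
      (hφ.continuousAt (Icc_mem_nhds hx.1 hx.2))
  set E : ℝ → ℝ := fun x => Real.exp (-(K * (x - s))) * (∫ r in s..x, a r) - ∫ r in s..x, b r
    with hE
  have hanti : AntitoneOn E (Icc s t) := by
    refine antitoneOn_of_hasDerivWithinAt_nonpos (convex_Icc s t)
      (f' := fun x => Real.exp (-(K * (x - s))) * (-K) * (∫ r in s..x, a r)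
        + Real.exp (-(K * (x - s))) * a x - b x)
      (((by fun_prop : ContinuousOn (fun x => Real.exp (-(K * (x - s)))) (Icc s t)).mul
        (hprim ha)).sub (hprim hb)) (fun x hx => ?_) fun x hx => ?_
    · rw [interior_Icc] at hx ⊢
      have h1 : HasDerivAt (fun x => Real.exp (-(K * (x - s))))
          (Real.exp (-(K * (x - s))) * (-K)) x := by
        have := ((((hasDerivAt_id x).sub_const s).const_mul K).neg).exp
        simpa using this
      exact ((h1.mul (hder ha x hx)).sub (hder hb x hx)).hasDerivWithinAt
    · rw [interior_Icc] at hx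
      have hx' := Ioo_subset_Icc_self hx
      have h1 : Real.exp (-(K * (x - s))) ≤ 1 := by
        rw [Real.exp_le_one_iff]
        have := mul_nonneg hK (sub_nonneg.2 hx.1.le)
        linarith
      have h2 := mul_le_mul_of_nonneg_left (h x hx') (Real.exp_pos (-(K * (x - s)))).le
      have h3 := mul_le_mul_of_nonneg_right h1 (hb0 x hx')
      linarith
  have h1 := hanti (left_mem_Icc.2 hst) (right_mem_Icc.2 hst) hst
  simp only [hE, intervalIntegral.integral_same, mul_zero, sub_zero] at h1
  have h2 : Real.exp (-(K * (t - s))) * (∫ r in s..t, a r) ≤ ∫ r in s..t, b r := by linarith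
  have h3 := mul_le_mul_of_nonneg_left h2 (Real.exp_pos (K * (t - s))).le
  rwa [← mul_assoc, ← Real.exp_add, add_neg_cancel, Real.exp_zero, one_mul] at h3

namespace ControlProblem

variable {d M : ℕ} {P : ControlProblem d M} {V : ℝ → Eucl d → ℝ} {t₀ : ℝ} {y₀ : Eucl d}
  {u : ℕ → ℝ → Eucl M} {y : ℕ → ℝ → Eucl d} {uLim : ℝ → Eucl M}

/-! ### Limits of admissible pairs -/

/-- The state equation is closed under weak convergence of the controls. -/
theorem exists_isAdmissible_of_weakConvL2 (ht₀ : t₀ ∈ Icc 0 P.T)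
    (h : ∀ n, P.IsAdmissible t₀ y₀ (u n) (y n)) (hw : WeakConvL2 t₀ P.T u uLim) :
    ∃ yLim, P.IsAdmissible t₀ y₀ uLim yLim ∧
      ∀ t ∈ Icc t₀ P.T, Tendsto (fun n => y n t) atTop (𝓝 (yLim t)) := by
  obtain ⟨L, hL⟩ := P.exists_bound P.f_mem.continuousOn
  obtain ⟨K, hK⟩ := P.exists_lipschitzOnWith_f
  obtain ⟨R, hR⟩ := P.isCompact_closure_Ω.isBounded.exists_norm_le
  set W : (ℝ → Eucl M) → ℝ → Eucl d := fun u t => P.B (∫ s in t₀..t, u s) with hW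
  -- the limit control is set to zero outside `(t₀, T)`, so that its primitive is continuous
  set ū := (Ioo t₀ P.T).indicator uLim
  have hūi : Integrable ū :=
    (integrable_indicator_iff measurableSet_Ioo).2 (hw.1.integrable one_le_two)
  have hWc : Continuous (W ū) := P.B.continuous.comp
    (intervalIntegral.continuous_primitive (fun _ _ => hūi.intervalIntegrable) t₀)
  have hWeq : ∀ t ∈ Icc t₀ P.T, W ū t = W uLim t := fun t ht => by
    simp only [hW]
    rw [intervalIntegral.integral_of_le ht.1, intervalIntegral.integral_of_le ht.1,
      integral_Ioc_eq_integral_Ioo, integral_Ioc_eq_integral_Ioo]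
    congr 1
    exact setIntegral_congr_fun measurableSet_Ioo fun s hs =>
      indicator_of_mem (Ioo_subset_Ioo_right ht.2 hs) _
  have hWt : ∀ t ∈ Icc t₀ P.T, Tendsto (fun n => W (u n) t) atTop (𝓝 (W ū t)) := fun t ht => by
    rw [hWeq t ht]
    exact (P.B.continuous.tendsto _).comp (hw.tendsto_intervalIntegral (fun n => (h n).memLp) ht)
  have hf := P.continuous_extend P.f_mem.continuousOn
  -- the limit state is `z + W ū`, where `z` solves an ODE with Lipschitz right hand side
  obtain ⟨z, hz0, hz⟩ := exists_hasDerivWithinAt_of_bounded_lipschitz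
    (F := fun t x => P.extend P.f t (x + W ū t))
    (hf.comp (continuous_fst.prodMk (continuous_snd.add (hWc.comp continuous_fst))))
    (fun t x => hL _ (P.clip_mem t) _ (P.proj_mem _)) (K := K)
    (fun t => by
      refine LipschitzWith.of_dist_le_mul fun x x' => ?_
      have := (P.lipschitzWith_extend hK t).dist_le_mul (x + W ū t) (x' + W ū t)
      rwa [dist_add_right] at this) ht₀.2 y₀
  set Y : ℝ → Eucl d := fun t => z t + W ū t with hY
  have hzc : ContinuousOn z (Icc t₀ P.T) := fun t ht => (hz t ht).continuousWithinAt
  have hYc : ContinuousOn Y (Icc t₀ P.T) := hzc.add hWc.continuousOn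
  have hfY : ContinuousOn (fun t => P.extend P.f t (Y t)) (Icc t₀ P.T) :=
    hf.comp_continuousOn (continuousOn_id.prodMk hYc)
  have hfYi : ∀ t ∈ Icc t₀ P.T, IntervalIntegrable (fun t => P.extend P.f t (Y t)) volume t₀ t :=
    fun t ht => (hfY.mono (by
      rw [uIcc_of_le ht.1]; exact Icc_subset_Icc_right ht.2)).intervalIntegrable
  have hYeq : ∀ t ∈ Icc t₀ P.T, Y t = y₀ + ((∫ s in t₀..t, P.extend P.f s (Y s)) + W ū t) := by
    intro t ht
    have := intervalIntegral.integral_eq_sub_of_hasDeriv_right_of_le ht.1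
      (hzc.mono (Icc_subset_Icc_right ht.2))
      (fun s hs => ((hz s ⟨hs.1.le, hs.2.le.trans ht.2⟩).mono_of_mem_nhdsWithin
        (Icc_mem_nhdsGE_of_mem ⟨hs.1.le, hs.2.trans_le ht.2⟩)).mono Ioi_subset_Ici_self)
      (hfYi t ht)
    rw [hz0] at this
    rw [this]
    simp only [hY]
    abel
  have hyeq : ∀ n, ∀ t ∈ Icc t₀ P.T,
      y n t = y₀ + ((∫ s in t₀..t, P.extend P.f s (y n s)) + W (u n) t) := by
    intro n t ht
    have e := (h n).sub_eq ht₀.1 le_rfl ht.1 ht.2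
    rw [(h n).init ht₀.2] at e
    rw [e]
    congr 2
    refine intervalIntegral.integral_congr fun s hs => ?_
    rw [uIcc_of_le ht.1] at hs
    exact (P.extend_eq _ ⟨ht₀.1.trans hs.1, hs.2.trans ht.2⟩
      ((h n).mem_closure s ⟨hs.1, hs.2.trans ht.2⟩)).symm
  have hfyi : ∀ n, ContinuousOn (fun t => P.extend P.f t (y n t)) (Icc t₀ P.T) := fun n =>
    hf.comp_continuousOn (continuousOn_id.prodMk (h n).continuousOn)
  have hWn : ∀ n, ContinuousOn (W (u n)) (Icc t₀ P.T) := fun n => by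
    have := intervalIntegral.continuousOn_primitive_interval (f := u n) (μ := volume)
      (a := t₀) (b := P.T) (by
        rw [uIcc_of_le ht₀.2, integrableOn_Icc_iff_integrableOn_Ioo]
        exact (h n).integrableOn_control)
    rw [uIcc_of_le ht₀.2] at this
    exact P.B.continuous.comp_continuousOn this
  have hdiff : ∀ n, ∀ t ∈ Icc t₀ P.T,
      ‖y n t - Y t‖ ≤ ‖W (u n) t - W ū t‖ + K * ∫ s in t₀..t, ‖y n s - Y s‖ := by
    intro n t ht
    have hsub : uIcc t₀ t ⊆ Icc t₀ P.T := by
      rw [uIcc_of_le ht.1]; exact Icc_subset_Icc_right ht.2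
    have hi := ((hfyi n).mono hsub).intervalIntegrable (μ := volume)
    have hni : IntervalIntegrable (fun s => ‖y n s - Y s‖) volume t₀ t :=
      ((((h n).continuousOn.sub hYc).norm).mono hsub).intervalIntegrable
    have e : y n t - Y t = (W (u n) t - W ū t)
        + ∫ s in t₀..t, (P.extend P.f s (y n s) - P.extend P.f s (Y s)) := by
      rw [intervalIntegral.integral_sub hi (hfYi t ht), hyeq n t ht, hYeq t ht]
      abel
    rw [e]
    refine (norm_add_le _ _).trans (add_le_add_right ?_ _)
    refine (intervalIntegral.norm_integral_le_of_norm_le ht.1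
      (Eventually.of_forall fun s _ => ?_) (hni.const_mul K)).trans_eq
      (intervalIntegral.integral_const_mul _ _)
    exact (P.lipschitzWith_extend hK s).norm_sub_le _ _
  have hWb : ∀ n, ∀ t ∈ Icc t₀ P.T, ‖W (u n) t‖ ≤ R + R + L * (P.T - t₀) := by
    intro n t ht
    have e : W (u n) t = y n t - y n t₀ - ∫ s in t₀..t, P.extend P.f s (y n s) := by
      rw [(h n).init ht₀.2, hyeq n t ht]; abel
    have h1 := hR _ ((h n).mem_closure t ht)
    have h2 := hR _ ((h n).mem_closure t₀ (left_mem_Icc.2 ht₀.2))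
    have h3 : ‖∫ s in t₀..t, P.extend P.f s (y n s)‖ ≤ L * |t - t₀| :=
      intervalIntegral.norm_integral_le_of_norm_le_const
        fun s _ => hL _ (P.clip_mem s) _ (P.proj_mem _)
    rw [abs_of_nonneg (sub_nonneg.2 ht.1)] at h3
    have h4 : (L : ℝ) * (t - t₀) ≤ L * (P.T - t₀) := by gcongr; exact ht.2
    rw [e]
    exact (norm_sub_le _ _).trans (add_le_add ((norm_sub_le _ _).trans (add_le_add h1 h2))
      (h3.trans h4))
  have hWL : ∀ t ∈ Icc t₀ P.T, ‖W ū t‖ ≤ R + R + L * (P.T - t₀) := fun t ht =>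
    le_of_tendsto' (hWt t ht).norm fun n => hWb n t ht
  have hbc : ∀ n, ContinuousOn (fun t => ‖W (u n) t - W ū t‖) (Icc t₀ P.T) := fun n =>
    ((hWn n).sub hWc.continuousOn).norm
  have hb0 : Tendsto (fun n => ∫ t in t₀..P.T, ‖W (u n) t - W ū t‖) atTop (𝓝 0) := by
    have := intervalIntegral.tendsto_integral_filter_of_dominated_convergence (μ := volume)
      (a := t₀) (b := P.T) (l := atTop)
      (F := fun n t => ‖W (u n) t - W ū t‖) (f := fun _ => (0 : ℝ))
      (fun _ => (R + R + L * (P.T - t₀)) + (R + R + L * (P.T - t₀)))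
      (Eventually.of_forall fun n => by
        rw [uIoc_of_le ht₀.2]
        exact ((hbc n).mono Ioc_subset_Icc_self).aestronglyMeasurable measurableSet_Ioc)
      (Eventually.of_forall fun n => Eventually.of_forall fun t ht => by
        rw [uIoc_of_le ht₀.2] at ht
        rw [norm_norm]
        exact (norm_sub_le _ _).trans (add_le_add (hWb n t (Ioc_subset_Icc_self ht))
          (hWL t (Ioc_subset_Icc_self ht))))
      (by simp)
      (Eventually.of_forall fun t ht => by
        rw [uIoc_of_le ht₀.2] at ht
        have := ((hWt t (Ioc_subset_Icc_self ht)).sub_const (W ū t)).norm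
        simpa using this)
    simpa using this
  have hYt : ∀ t ∈ Icc t₀ P.T, Tendsto (fun n => y n t) atTop (𝓝 (Y t)) := by
    intro t ht
    rw [tendsto_iff_norm_sub_tendsto_zero]
    have h1 := ((hWt t ht).sub_const (W ū t)).norm
    rw [sub_self, norm_zero] at h1
    have h2 := h1.add (hb0.const_mul (K * Real.exp (K * (P.T - t₀))))
    rw [mul_zero, add_zero] at h2
    refine squeeze_zero (fun _ => norm_nonneg _) (fun n => ?_) h2
    refine (hdiff n t ht).trans (add_le_add_right ?_ _)
    have hac := ((h n).continuousOn.sub hYc).norm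
    have h3 := integral_le_exp_mul_integral ht₀.2 K.2 hac (hbc n) (fun _ _ => norm_nonneg _)
      (hdiff n)
    have h4 : ∫ s in t₀..t, ‖y n s - Y s‖ ≤ ∫ s in t₀..P.T, ‖y n s - Y s‖ :=
      intervalIntegral.integral_mono_interval le_rfl ht.1 ht.2
        (Eventually.of_forall fun _ => norm_nonneg _)
        ((hac.mono (by rw [uIcc_of_le ht₀.2])).intervalIntegrable)
    rw [mul_assoc]
    exact mul_le_mul_of_nonneg_left (h4.trans h3) K.2
  have hYK : ∀ t ∈ Icc t₀ P.T, Y t ∈ closure P.Ω := fun t ht =>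
    isClosed_closure.mem_of_tendsto (hYt t ht)
      (Eventually.of_forall fun n => (h n).mem_closure t ht)
  refine ⟨Y, ⟨hw.1, hYc, hYK, fun t ht => ?_⟩, hYt⟩
  have hui : IntervalIntegrable uLim volume t₀ t := by
    rw [intervalIntegrable_iff_integrableOn_Ioo_of_le ht.1]
    exact IntegrableOn.mono_set (t := Ioo t₀ P.T) (hw.1.integrable one_le_two)
      (Ioo_subset_Ioo_right ht.2)
  have hBi : IntervalIntegrable (fun s => P.B (uLim s)) volume t₀ t := by
    rw [intervalIntegrable_iff] at hui ⊢
    exact P.B.integrable_comp hui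
  have e : ∫ s in t₀..t, (P.f s (Y s) + P.B (uLim s))
      = ∫ s in t₀..t, (P.extend P.f s (Y s) + P.B (uLim s)) :=
    intervalIntegral.integral_congr fun s hs => by
      rw [uIcc_of_le ht.1] at hs
      rw [P.extend_eq _ ⟨ht₀.1.trans hs.1, hs.2.trans ht.2⟩ (hYK s ⟨hs.1, hs.2.trans ht.2⟩)]
  rw [e, intervalIntegral.integral_add (hfYi t ht) hBi, P.B.intervalIntegral_comp_comm hui,
    hYeq t ht, hWeq t ht]

/-- Weak limits of minimizing sequences of controls are optimal, and the convergence is strong. -/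
theorem IsValue.strongConvL2_of_tendsto (hV : P.IsValue V) (ht₀ : t₀ ∈ Icc 0 P.T)
    (hy₀ : y₀ ∈ P.Ω) (h : ∀ n, P.IsAdmissible t₀ y₀ (u n) (y n))
    (hcost : Tendsto (fun n => P.cost t₀ (u n) (y n)) atTop (𝓝 (V t₀ y₀)))
    (hw : WeakConvL2 t₀ P.T u uLim) :
    StrongConvL2 t₀ P.T u uLim ∧ P.IsOptimalControl t₀ y₀ uLim := by
  obtain ⟨Y, hadm, hY⟩ := exists_isAdmissible_of_weakConvL2 ht₀ h hw
  have hβ := P.β_pos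
  have hTm : P.T ∈ Icc t₀ P.T := right_mem_Icc.2 ht₀.2
  have hform : ∀ {u : ℝ → Eucl M} {y : ℝ → Eucl d}, P.IsAdmissible t₀ y₀ u y →
      P.cost t₀ u y = (∫ t in t₀..P.T, P.ℓ t (y t))
        + P.β / 2 * (∫ t in Ioo t₀ P.T, ‖u t‖ ^ 2) + P.g (y P.T) := fun hu => by
    rw [hu.cost_eq ht₀.1 ht₀.2 le_rfl, cost, intervalIntegral.integral_same, zero_add,
      intervalIntegral.integral_of_le (f := fun t => ‖_‖ ^ 2) ht₀.2, integral_Ioc_eq_integral_Ioo]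
  obtain ⟨Lℓ, hLℓ⟩ := P.exists_bound P.ℓ_mem.continuousOn
  have hℓ : Tendsto (fun n => ∫ t in t₀..P.T, P.ℓ t (y n t)) atTop
      (𝓝 (∫ t in t₀..P.T, P.ℓ t (Y t))) := by
    refine intervalIntegral.tendsto_integral_filter_of_dominated_convergence (fun _ => Lℓ)
      (Eventually.of_forall fun n => ?_) (Eventually.of_forall fun n =>
        Eventually.of_forall fun t ht => ?_) (by simp) (Eventually.of_forall fun t ht => ?_)
    · rw [uIoc_of_le ht₀.2]
      exact (((h n).continuousOn_comp ht₀.1 P.ℓ_mem.continuousOn).mono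
        Ioc_subset_Icc_self).aestronglyMeasurable measurableSet_Ioc
    · rw [uIoc_of_le ht₀.2] at ht
      exact hLℓ t ⟨ht₀.1.trans ht.1.le, ht.2⟩ _ ((h n).mem_closure t (Ioc_subset_Icc_self ht))
    · rw [uIoc_of_le ht₀.2] at ht
      have ht' : t ∈ Icc t₀ P.T := Ioc_subset_Icc_self ht
      have ht0 : t ∈ Icc 0 P.T := ⟨ht₀.1.trans ht.1.le, ht.2⟩
      have hc : ContinuousWithinAt (P.ℓ t) (closure P.Ω) (Y t) :=
        (P.ℓ_mem.1 t ht0).continuousOn _ (hadm.mem_closure t ht')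
      exact hc.tendsto.comp (tendsto_nhdsWithin_iff.2
        ⟨hY t ht', Eventually.of_forall fun n => (h n).mem_closure t ht'⟩)
  have hg : Tendsto (fun n => P.g (y n P.T)) atTop (𝓝 (P.g (Y P.T))) :=
    (P.g_mem.continuousOn _ (hadm.mem_closure _ hTm)).tendsto.comp (tendsto_nhdsWithin_iff.2
      ⟨hY _ hTm, Eventually.of_forall fun n => (h n).mem_closure _ hTm⟩)
  set c := (V t₀ y₀ - (∫ t in t₀..P.T, P.ℓ t (Y t)) - P.g (Y P.T)) / (P.β / 2) with hc
  have hnorm : Tendsto (fun n => ∫ t in Ioo t₀ P.T, ‖u n t‖ ^ 2) atTop (𝓝 c) := by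
    refine (((hcost.sub hℓ).sub hg).div_const (P.β / 2)).congr fun n => ?_
    rw [hform (h n)]
    field_simp
    ring
  have hle := hV.le_cost ht₀ hy₀ hadm
  have hf := hform hadm
  have hcβ : c * (P.β / 2) = V t₀ y₀ - (∫ t in t₀..P.T, P.ℓ t (Y t)) - P.g (Y P.T) := by
    rw [hc]; field_simp
  obtain ⟨hs, hs'⟩ := hw.strongConvL2 (fun n => (h n).memLp) hnorm (by
    have : c * (P.β / 2) ≤ (∫ t in Ioo t₀ P.T, ‖uLim t‖ ^ 2) * (P.β / 2) := by linarith
    exact le_of_mul_le_mul_right this (by positivity))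
  refine ⟨hs, Y, hadm, fun u' y' h' => le_trans ?_ (hV.le_cost ht₀ hy₀ h')⟩
  rw [hs'] at hf
  linarith

end ControlProblem

namespace ControlProblem

variable {d M : ℕ} {P : ControlProblem d M} {v w V : ℝ → Eucl d → ℝ}

/-! ### Comparison of the averaged costs -/

theorem IsValue.extCost_eq (hV : P.IsValue V) (hVD : V ∈ P.setD) :
    EqOn (P.extCost V) (fun p => V p.1 p.2) P.initSet := fun p hp => by
  have h1 := hV.extCost_le hVD.1 hVD hp
  have h2 := hV.le_closedLoopCost (solvable_of_mem_setD hVD) (Ioo_subset_Icc_self hp.1) hp.2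
  rw [(solvable_of_mem_setD hVD).closedLoopCost_eq (Ioo_subset_Icc_self hp.1) hp.2] at h2
  rw [ctcNorm_sub_self] at h1
  simp only [mul_zero, ne_eq, OfNat.ofNat_ne_zero, not_false_eq_true, zero_pow, add_zero] at h1
  exact le_antisymm h1 h2

theorem IsValue.le_extCost (hV : P.IsValue V) (hw : P.Solvable w) {p : ℝ × Eucl d}
    (hp : p ∈ P.initSet) : V p.1 p.2 ≤ P.extCost w p := by
  have := hV.le_closedLoopCost hw (Ioo_subset_Icc_self hp.1) hp.2
  rwa [hw.closedLoopCost_eq (Ioo_subset_Icc_self hp.1) hp.2] at this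

theorem integrableOn_extCost (hv : MemCTC P.T (closure P.Ω) 2 v) :
    IntegrableOn (P.extCost v) P.initSet :=
  integrableOn_initSet (continuous_extCost hv) fun _ _ => rfl

theorem IsValue.integrableOn (hV : P.IsValue V) (hVD : V ∈ P.setD) :
    IntegrableOn (fun p : ℝ × Eucl d => V p.1 p.2) P.initSet :=
  integrableOn_initSet (continuous_extCost hVD.1) (hV.extCost_eq hVD).symm

theorem IsValue.learnCost_le (hV : P.IsValue V) (hVD : V ∈ P.setD) (hw : P.Solvable w) :
    P.learnCost V ≤ P.learnCost w := by
  have hT := P.T_pos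
  have hVs := solvable_of_mem_setD hVD
  rw [hVs.learnCost_eq, hw.learnCost_eq]
  refine mul_le_mul_of_nonneg_left (setIntegral_mono_on (integrableOn_extCost hVD.1)
    (integrableOn_extCost hw.1) measurableSet_initSet fun p hp => ?_) (by positivity)
  rw [hV.extCost_eq hVD hp]
  exact hV.le_extCost hw hp

theorem IsValue.learnCost_le_add (hV : P.IsValue V) (hVD : V ∈ P.setD) (hv : v ∈ P.setD) :
    P.learnCost v ≤ P.learnCost V + P.T * (P.β / 2) *
      (‖P.B‖ / P.β * ctcNorm P.T (closure P.Ω) 1 (v - V)) ^ 2 := by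
  set c := P.T * (P.β / 2) * (‖P.B‖ / P.β * ctcNorm P.T (closure P.Ω) 1 (v - V)) ^ 2 with hc
  have hpos : 0 < P.T * (volume P.ω).toReal := mul_pos P.T_pos volume_ω_toReal_pos
  have hVi := integrableOn_extCost hVD.1
  have hci : IntegrableOn (fun _ : ℝ × Eucl d => c) P.initSet :=
    integrableOn_const volume_initSet_lt_top.ne
  have h1 : ∫ p in P.initSet, P.extCost v p ≤ ∫ p in P.initSet, (P.extCost V p + c) :=
    setIntegral_mono_on (integrableOn_extCost hv.1) (hVi.add hci) measurableSet_initSet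
      fun p hp => by
        rw [hV.extCost_eq hVD hp]
        exact hV.extCost_le hVD.1 hv hp
  rw [integral_add hVi hci, setIntegral_const, measureReal_initSet, smul_eq_mul] at h1
  rw [(solvable_of_mem_setD hv).learnCost_eq, (solvable_of_mem_setD hVD).learnCost_eq,
    inv_mul_le_iff₀ hpos, mul_add, mul_inv_cancel_left₀ hpos.ne']
  exact h1

/-- As the closed loop costs are never below the value function, their `L¹` distance is the
difference of their means. -/
theorem IsValue.setIntegral_abs_sub_eq (hV : P.IsValue V) (hVD : V ∈ P.setD)
    (hw : P.Solvable w) :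
    ∫ p in P.initSet, |P.extCost w p - V p.1 p.2|
      = P.T * (volume P.ω).toReal * (P.learnCost w - P.learnCost V) := by
  have hpos : 0 < P.T * (volume P.ω).toReal := mul_pos P.T_pos volume_ω_toReal_pos
  rw [hw.learnCost_eq, (solvable_of_mem_setD hVD).learnCost_eq, ← mul_sub,
    mul_inv_cancel_left₀ hpos.ne', ← integral_sub (integrableOn_extCost hw.1)
    (integrableOn_extCost hVD.1)]
  refine setIntegral_congr_fun measurableSet_initSet fun p hp => ?_
  rw [hV.extCost_eq hVD hp, abs_of_nonneg (sub_nonneg.2 (hV.le_extCost hw hp))]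

theorem IsValue.integral_abs_closedLoopCost_sub_eq (hV : P.IsValue V) (hVD : V ∈ P.setD)
    (hw : P.Solvable w) {G : ℝ × Eucl d → ℝ} (hG : EqOn G (fun p => V p.1 p.2) P.initSet) :
    ∫ y₀ in P.ω, ∫ t₀ in (0)..P.T, |P.closedLoopCost w t₀ y₀ - G (t₀, y₀)|
      = P.T * (volume P.ω).toReal * (P.learnCost w - P.learnCost V) := by
  have h1 : EqOn (fun p : ℝ × Eucl d => |P.closedLoopCost w p.1 p.2 - G p|)
      (fun p => |P.extCost w p - V p.1 p.2|) P.initSet := fun p hp => by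
    have := hw.eqOn_closedLoopCost hp
    simp only at this
    simp only [this, hG hp]
  have hint : IntegrableOn (fun p => |P.extCost w p - V p.1 p.2|) P.initSet :=
    ((integrableOn_extCost hw.1).sub (hV.integrableOn hVD)).abs
  rw [← hV.setIntegral_abs_sub_eq hVD hw, ← setIntegral_congr_fun measurableSet_initSet h1]
  exact integral_integral_eq (F := fun p => |P.closedLoopCost w p.1 p.2 - G p|)
    (hint.congr_fun h1.symm measurableSet_initSet)

/-! ### Convergence of the closed loop controls -/

/-- If the closed loop costs converge in `L¹` to the value function, then along a subsequence that
does not depend on the initial value, weak limits of the closed loop controls are optimal. -/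
theorem IsValue.exists_subseq_controls (hV : P.IsValue V) (hVD : V ∈ P.setD)
    {w : ℕ → ℝ → Eucl d → ℝ} (hw : ∀ n, P.Solvable (w n))
    (hlim : Tendsto (fun n => P.learnCost (w n)) atTop (𝓝 (P.learnCost V))) :
    ∃ σ : ℕ → ℕ, StrictMono σ ∧ ∀ᵐ p : ℝ × Eucl d ∂(volume.restrict P.initSet),
      (∃ ρ : ℕ → ℕ, StrictMono ρ ∧ ∃ uLim : ℝ → Eucl M,
        WeakConvL2 p.1 P.T (fun j => P.closedLoopControl (w (σ (ρ j))) p.1 p.2) uLim) ∧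
      ∀ ρ : ℕ → ℕ, StrictMono ρ → ∀ uLim : ℝ → Eucl M,
        WeakConvL2 p.1 P.T (fun j => P.closedLoopControl (w (σ (ρ j))) p.1 p.2) uLim →
        StrongConvL2 p.1 P.T (fun j => P.closedLoopControl (w (σ (ρ j))) p.1 p.2) uLim ∧
          P.IsOptimalControl p.1 p.2 uLim := by
  have hint : ∀ n, IntegrableOn (P.extCost (w n) - fun p => V p.1 p.2) P.initSet := fun n =>
    (integrableOn_extCost (hw n).1).sub (hV.integrableOn hVD)
  have hL1 : Tendsto (fun n => eLpNorm (P.extCost (w n) - fun p => V p.1 p.2) 1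
      (volume.restrict P.initSet)) atTop (𝓝 0) := by
    have h1 := (hlim.sub_const (P.learnCost V)).const_mul (P.T * (volume P.ω).toReal)
    rw [sub_self, mul_zero] at h1
    have h2 := ENNReal.tendsto_ofReal h1
    rw [ENNReal.ofReal_zero] at h2
    refine h2.congr fun n => ?_
    rw [eLpNorm_one_eq_lintegral_enorm, ← ofReal_integral_norm_eq_lintegral_enorm (hint n),
      ← hV.setIntegral_abs_sub_eq hVD (hw n)]
    rfl
  obtain ⟨σ, hσ, hae⟩ := (tendstoInMeasure_of_tendsto_eLpNorm one_ne_zero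
    (fun n => (integrableOn_extCost (hw n).1).aestronglyMeasurable)
    (hV.integrableOn hVD).aestronglyMeasurable hL1).exists_seq_tendsto_ae
  refine ⟨σ, hσ, ?_⟩
  filter_upwards [hae, ae_restrict_mem measurableSet_initSet] with p hp hmem
  have hp1 : p.1 ∈ Icc 0 P.T := Ioo_subset_Icc_self hmem.1
  have hadm : ∀ n, P.IsAdmissible p.1 p.2 (P.closedLoopControl (w (σ n)) p.1 p.2)
      (P.flow (w (σ n)) p.1 p.2) := fun n => (hw (σ n)).isAdmissible hp1 hmem.2
  have hcost : Tendsto (fun n => P.cost p.1 (P.closedLoopControl (w (σ n)) p.1 p.2)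
      (P.flow (w (σ n)) p.1 p.2)) atTop (𝓝 (V p.1 p.2)) :=
    hp.congr fun n => ((hw (σ n)).closedLoopCost_eq hp1 hmem.2).symm
  refine ⟨?_, fun ρ hρ uLim hu => hV.strongConvL2_of_tendsto hp1 (P.ω_subset_Ω hmem.2)
    (u := fun n => P.closedLoopControl (w (σ (ρ n))) p.1 p.2)
    (y := fun n => P.flow (w (σ (ρ n))) p.1 p.2) (fun n => hadm (ρ n))
    (hcost.comp hρ.tendsto_atTop) hu⟩
  obtain ⟨R, hR⟩ := hcost.bddAbove_range
  refine exists_weakConvL2_subseq (u := fun n => P.closedLoopControl (w (σ n)) p.1 p.2)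
    (fun n => (hadm n).memLp) (R := R / (P.β / 2)) fun n => ?_
  have h1 := (hadm n).energy_le hp1 (right_mem_Icc.2 hp1.2)
  rw [intervalIntegral.integral_of_le hp1.2, integral_Ioc_eq_integral_Ioo] at h1
  rw [le_div_iff₀ (half_pos P.β_pos), mul_comm]
  exact h1.trans (hR ⟨n, rfl⟩)

end ControlProblem

end

/-! ### Convergence of the learning problems -/

theorem mainTheorem1 (d M : ℕ) :
    -- the constant depends only on `T`, `β`, `Ω`, `‖f‖`, `‖V‖` and `|B|`
    ∃ C : ℝ → ℝ → Set (Eucl d) → ℝ → ℝ → ℝ → ℝ,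
      (∀ T β Ω a b c, 0 < C T β Ω a b c) ∧
      ∀ (P : ControlProblem d M) (V : ℝ → Eucl d → ℝ),
        (∀ t₀ ∈ Icc 0 P.T, ∀ y₀ ∈ P.Ω, (V t₀ y₀ : EReal) = P.valueFn t₀ y₀) →
        V ∈ P.setD →
        ∀ (N : ℕ → ℕ) (I : (k : ℕ) → (Fin (N k) → ℝ) → ℝ → Eucl d → ℝ)
          (ϑ : (k : ℕ) → Fin (N k) → ℝ), P.Approximates V N I ϑ →
        ∃ k₀ : ℕ,
          (∀ k ≥ k₀, ∀ γ > 0, ∀ r ∈ Icc (0 : ℝ) 1, ∃ θ, P.IsSolution (I k) γ r θ) ∧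
          ∀ r ∈ Icc (0 : ℝ) 1, ∃ γ : ℕ → ℝ,
            (∀ k, 0 ≤ γ k) ∧
            (∀ k, (∃ t ∈ Icc 0 P.T, ∃ y ∈ closure P.Ω, I k (ϑ k) t y ≠ V t y) → 0 < γ k) ∧
            (∀ k ≥ k₀, ∃ θ, P.IsSolution (I k) (γ k) r θ) ∧
            ∀ θ : (k : ℕ) → Fin (N k) → ℝ,
              (∀ k ≥ k₀, P.IsSolution (I k) (γ k) r (θ k)) →
              -- convergence rate of the closed loop costs
              (∀ k ≥ k₀,
                IntegrableOn (fun p : ℝ × Eucl d => P.closedLoopCost (I k (θ k)) p.1 p.2)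
                  (Ioo 0 P.T ×ˢ P.ω) ∧
                IntegrableOn (fun p : ℝ × Eucl d => P.closedLoopCost V p.1 p.2)
                  (Ioo 0 P.T ×ˢ P.ω) ∧
                IntegrableOn (fun p : ℝ × Eucl d => V p.1 p.2) (Ioo 0 P.T ×ˢ P.ω) ∧
                (∫ y₀ in P.ω, ∫ t₀ in (0)..P.T,
                    |P.closedLoopCost (I k (θ k)) t₀ y₀ - P.closedLoopCost V t₀ y₀|) ≤
                  C P.T P.β P.Ω P.fNorm (ctcNorm P.T (closure P.Ω) 1 V) ‖P.B‖ *
                    ctcNorm P.T (closure P.Ω) 1 (I k (ϑ k) - V) ∧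
                (∫ y₀ in P.ω, ∫ t₀ in (0)..P.T,
                    |P.closedLoopCost (I k (θ k)) t₀ y₀ - V t₀ y₀|) ≤
                  C P.T P.β P.Ω P.fNorm (ctcNorm P.T (closure P.Ω) 1 V) ‖P.B‖ *
                    ctcNorm P.T (closure P.Ω) 1 (I k (ϑ k) - V)) ∧
              -- convergence of the closed loop controls
              (∀ k ≥ k₀, ∀ t₀ ∈ Ioo 0 P.T, ∀ y₀ ∈ P.ω,
                MemLp (P.closedLoopControl (I k (θ k)) t₀ y₀) 2
                  (volume.restrict (Ioo t₀ P.T))) ∧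
              ∀ κ : ℕ → ℕ, StrictMono κ → ∃ σ : ℕ → ℕ, StrictMono σ ∧
                ∀ᵐ p : ℝ × Eucl d ∂(volume.restrict (Ioo 0 P.T ×ˢ P.ω)),
                  (∃ ρ : ℕ → ℕ, StrictMono ρ ∧ ∃ uLim : ℝ → Eucl M,
                    WeakConvL2 p.1 P.T (fun j => P.closedLoopControl
                      (I (κ (σ (ρ j))) (θ (κ (σ (ρ j))))) p.1 p.2) uLim) ∧
                  ∀ ρ : ℕ → ℕ, StrictMono ρ → ∀ uLim : ℝ → Eucl M,
                    WeakConvL2 p.1 P.T (fun j => P.closedLoopControl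
                      (I (κ (σ (ρ j))) (θ (κ (σ (ρ j))))) p.1 p.2) uLim →
                    StrongConvL2 p.1 P.T (fun j => P.closedLoopControl
                      (I (κ (σ (ρ j))) (θ (κ (σ (ρ j))))) p.1 p.2) uLim ∧
                    P.IsOptimalControl p.1 p.2 uLim := by
  refine ⟨fun T β Ω _ _ c => |T| * (volume Ω).toReal * (|T| * (c ^ 2 / (2 * |β|)) + 1) + 1,
    fun T β Ω a b c => by positivity, ?_⟩
  intro P V hV hVD N I ϑ hI
  replace hV : P.IsValue V := hV
  have hT := P.T_pos
  have hβ := P.β_pos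
  obtain ⟨ε₀, hε₀, hnear⟩ := ControlProblem.exists_forall_mem_setD hVD
  set ε : ℕ → ℝ := fun k => ctcNorm P.T (closure P.Ω) 1 (I k (ϑ k) - V)
  have hε0 : ∀ k, 0 ≤ ε k := fun k => ctcNorm_nonneg
  obtain ⟨k₀, hk₀⟩ := eventually_atTop.1
    ((hI.tendsto.eventually_lt_const hε₀).and (hI.tendsto.eventually_le_const one_pos))
  have hmem : ∀ k ≥ k₀, I k (ϑ k) ∈ P.setD := fun k hk => hnear _ (hI.mem k _) (hk₀ k hk).1
  have hsol : ∀ k ≥ k₀, ∀ γ > 0, ∀ r ∈ Icc (0 : ℝ) 1, ∃ θ, P.IsSolution (I k) γ r θ :=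
    fun k hk γ hγ r hr => ControlProblem.exists_isSolution (hI.mem k) (hI.continuous k)
      (ControlProblem.setD_subset_closureD (hmem k hk)) hγ hr
  refine ⟨k₀, hsol, fun r hr => ?_⟩
  -- this choice keeps the penalty of `ϑ k` below the approximation error
  set γ : ℕ → ℝ := fun k => ε k / (1 + ControlProblem.penalty r (ϑ k)) with hγ
  have hpen : ∀ k, 0 < 1 + ControlProblem.penalty r (ϑ k) := fun k => by
    linarith [ControlProblem.penalty_nonneg hr (ϑ k)]
  have hγ0 : ∀ k, 0 ≤ γ k := fun k => div_nonneg (hε0 k) (hpen k).le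
  have hγpen : ∀ k, γ k * ControlProblem.penalty r (ϑ k) ≤ ε k := fun k => by
    rw [hγ, div_mul_eq_mul_div, div_le_iff₀ (hpen k)]
    have := hε0 k
    nlinarith
  refine ⟨γ, hγ0, ?_, fun k hk => ?_, fun θ hθ => ?_⟩
  · rintro k ⟨t, ht, y, hy, hne⟩
    refine div_pos (lt_of_lt_of_le (norm_pos_iff.2 (sub_ne_zero.2 hne)) ?_) (hpen k)
    exact (((hI.mem k (ϑ k)).sub P.uniqueDiffOn_closure_Ω hVD.1).of_le
      one_le_two).norm_le_ctcNorm P.isCompact_closure_Ω ht hy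
  · rcases (hγ0 k).eq_or_lt with h0 | hpos
    · -- no penalty: then `I k (ϑ k)` has distance zero to `V`, so it is itself optimal
      refine ⟨ϑ k, ControlProblem.setD_subset_closureD (hmem k hk), fun θ' hθ' => ?_⟩
      have h1 : ε k = 0 := ((div_eq_zero_iff).1 h0.symm).resolve_right (hpen k).ne'
      have h2 := hV.learnCost_le_add hVD (hmem k hk)
      have h3 := hV.learnCost_le hVD (ControlProblem.solvable_of_mem_closureD hθ')
      change P.learnCost (I k (ϑ k)) ≤ P.learnCost V + P.T * (P.β / 2) *
        (‖P.B‖ / P.β * ε k) ^ 2 at h2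
      rw [h1, mul_zero, zero_pow two_ne_zero, mul_zero, add_zero] at h2
      rw [← h0, zero_mul, zero_mul, add_zero, add_zero]
      exact h2.trans h3
    · exact hsol k hk _ hpos r hr
  · have hs : ∀ k ≥ k₀, P.Solvable (I k (θ k)) := fun k hk =>
      ControlProblem.solvable_of_mem_closureD (hθ k hk).1
    set A := P.T * (‖P.B‖ ^ 2 / (2 * P.β)) + 1 with hA
    have hA0 : 0 ≤ A := by positivity
    -- compare the minimizer with `ϑ k`
    have hJ : ∀ k ≥ k₀, P.learnCost (I k (θ k)) - P.learnCost V ≤ A * ε k := by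
      intro k hk
      have h1 := (hθ k hk).2 (ϑ k) (ControlProblem.setD_subset_closureD (hmem k hk))
      have h2 := hV.learnCost_le_add hVD (hmem k hk)
      have h3 := mul_nonneg (hγ0 k) (ControlProblem.penalty_nonneg hr (θ k))
      have h4 : ε k ^ 2 ≤ ε k := by
        have := (hk₀ k hk).2
        nlinarith [hε0 k]
      have h5 : P.T * (P.β / 2) * (‖P.B‖ / P.β * ε k) ^ 2
          = P.T * (‖P.B‖ ^ 2 / (2 * P.β)) * ε k ^ 2 := by field_simp
      have h6 : P.T * (‖P.B‖ ^ 2 / (2 * P.β)) * ε k ^ 2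
          ≤ P.T * (‖P.B‖ ^ 2 / (2 * P.β)) * ε k := by gcongr
      change P.learnCost (I k (ϑ k)) ≤ P.learnCost V + P.T * (P.β / 2) *
        (‖P.B‖ / P.β * ε k) ^ 2 at h2
      rw [hA]
      linarith [hγpen k]
    have hbound : ∀ k ≥ k₀, P.T * (volume P.ω).toReal
        * (P.learnCost (I k (θ k)) - P.learnCost V)
        ≤ (|P.T| * (volume P.Ω).toReal * (|P.T| * (‖P.B‖ ^ 2 / (2 * |P.β|)) + 1) + 1) * ε k := by
      intro k hk
      rw [abs_of_pos hT, abs_of_pos hβ, ← hA]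
      have hvol : (volume P.ω).toReal ≤ (volume P.Ω).toReal :=
        ENNReal.toReal_mono P.isBounded_Ω.measure_lt_top.ne (measure_mono P.ω_subset_Ω)
      calc _ ≤ P.T * (volume P.ω).toReal * (A * ε k) :=
            mul_le_mul_of_nonneg_left (hJ k hk) (by positivity)
        _ ≤ P.T * (volume P.Ω).toReal * (A * ε k) := by
            have := mul_nonneg hA0 (hε0 k)
            gcongr
        _ ≤ _ := by nlinarith [hε0 k]
    refine ⟨fun k hk => ⟨(hs k hk).integrableOn_closedLoopCost,
      (ControlProblem.solvable_of_mem_setD hVD).integrableOn_closedLoopCost,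
      hV.integrableOn hVD, ?_, ?_⟩,
      fun k hk t₀ ht₀ y₀ hy₀ => ((hs k hk).isAdmissible (Ioo_subset_Icc_self ht₀) hy₀).memLp,
      fun κ hκ => ?_⟩
    · refine (hV.integral_abs_closedLoopCost_sub_eq hVD (hs k hk)
        (G := fun p => P.closedLoopCost V p.1 p.2) fun p hp => ?_).trans_le (hbound k hk)
      exact ((ControlProblem.solvable_of_mem_setD hVD).eqOn_closedLoopCost hp).trans
        (hV.extCost_eq hVD hp)
    · exact (hV.integral_abs_closedLoopCost_sub_eq hVD (hs k hk)
        (G := fun p => V p.1 p.2) fun p _ => rfl).trans_le (hbound k hk)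
    · -- drop the indices below `k₀`
      have hκ' : ∀ n, k₀ ≤ κ (n + k₀) := fun n => (Nat.le_add_left _ _).trans (hκ.id_le _)
      have hshift : Tendsto (fun n => κ (n + k₀)) atTop atTop :=
        hκ.tendsto_atTop.comp (tendsto_add_atTop_nat k₀)
      have hlim : Tendsto (fun n => P.learnCost (I (κ (n + k₀)) (θ (κ (n + k₀))))) atTop
          (𝓝 (P.learnCost V)) := by
        have h1 := ((hI.tendsto.comp hshift).const_mul A).const_add (P.learnCost V)
        rw [mul_zero, add_zero] at h1
        refine tendsto_of_tendsto_of_tendsto_of_le_of_le tendsto_const_nhds h1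
          (fun n => hV.learnCost_le hVD (hs _ (hκ' n))) fun n => ?_
        have := hJ _ (hκ' n)
        change _ ≤ P.learnCost V + A * ε (κ (n + k₀))
        linarith
      obtain ⟨σ, hσ, h⟩ := hV.exists_subseq_controls hVD (fun n => hs _ (hκ' n)) hlim
      exact ⟨fun n => σ n + k₀, fun m n hmn => Nat.add_lt_add_right (hσ hmn) _, h⟩
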